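/- **Setting.** Let $\ell\ge 3$, let $\mathcal K$ be a class of finite $\ell$-hypergraphs (the edge relation is $\ell$-ary, fully symmetric, and contains only injective tuples) which is finitely bounded, as witnessed by $b\in\mathbb N$: $\mathcal K$ consists of all finite $\ell$-hypergraphs into which no member of some finite set of hypergraphs with at most $b$ vertices embeds. Assume that the class $\vec{\mathcal K}$ of all expansions of members of $\mathcal K$ by a linear order is an amalgamation class, and let $(\mathbb H,<)$ be its Fraïssé limit, with domain $H$. Let $E$ be the set of hyperedges, $I_n$ the set of injective $n$-tuples, $I=I_\ell$, $N=I\setminus E$. Write $O(a)$ and $O_<(a)$ for the orbits of a tuple $a$ under $\mathrm{Aut}(\mathbb H)$ and $\mathrm{Aut}(\mathbb H,<)$. Let $\mathbb A$ be a first-order reduct of $\mathbb H$ with the following polymorphisms, both canonical with respect to $(\mathbb H,<)$: * a ternary injection $m$ such that $O(m(a,a,b))=O(m(a,b,a))=O(m(b,a,a))=O(b)$ for all $a,b\in I$; * a binary injection $p_1$ such that $O(p_1(a,b))=O(a)$ for all $a,b\in I$, and $p_1(x,y)<p_1(x',y')$ whenever $y<y'$, or $y=y'$ and $x<x'$. Assume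 moreover that (i) every union of orbits of $\ell$-tuples under $\mathrm{Aut}(\mathbb H)$ which is preserved by $m$ and $p_1$ is a relation of $\mathbb A$, and (ii) for every instance of $\mathrm{CSP}(\mathbb A)$, the equivalent $(2\ell,\max(3\ell,b))$-minimal instance is an instance of $\mathrm{CSP}(\mathbb A)$. **Instances.** An instance over a set $B$ consists of a finite linearly ordered set $V$ of variables and a set of constraints $C\subseteq B^U$ with scopes $U\subseteq V$. A solution is a map $s:V\to B$ with $s|_U\in C$ for every constraint $C$ with scope $U$. The instance is trivial if it contains an empty constraint. It is an instance of $\mathrm{CSP}(\mathbb A)$ if every scope is non-empty and every constraint is of the form $\{f\in H^U: (f(u_1),\dots,f(u_k))\in R\}$ with $R$ a relation of $\mathbb A$ and $U=\{u_1,\dots,u_k\}$ (repetitions allowed). It is $(m,n)$-minimal if every non-empty set of at most $n$ variables is contained in some scope and, for every tuple $v$ of at most $m$ variables, all constraints $C$ whose scope contains $v$ have the same projection $\mathrm{proj}_v(C)=\{f(v):f\in C\}$; this is then called $\mathrm{proj}_v(\mathcal I)$. $m$-minimal means $(m,m)$-minimal. The $(m,n)$-minimal instance equivalent to $\mathcal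 I$ is obtained by adding the full constraint on each non-empty set of at most $n$ variables not contained in a scope, and then shrinking all constraints to the largest family of subsets that satisfies the condition on projections. The restriction of an instance to $S\subseteq V$ has variables $S$ and constraints $\{f|_{U\cap S}:f\in C\}$. Let $[V]^\ell$ be the set of strictly increasing $\ell$-tuples of variables. The finitisation $\mathcal I_{\rm fin}$ of $\mathcal I$ is the instance over the set $\mathcal O$ of orbits of $\ell$-tuples under $\mathrm{Aut}(\mathbb H)$ with variables $[V]^\ell$ that has for every constraint $C$ with scope $U$ the constraint $\{g\in\mathcal O^{[U]^\ell}: \exists f\in C\ \forall v\in[U]^\ell\ f(v)\in g(v)\}$. The injectivisation $\mathcal J^{(\rm inj)}$ of an instance $\mathcal J$ over $\mathcal O$ is obtained by removing from all constraints the maps that take a value outside $\{E,N\}$. The injective finitisation of $\mathcal I$ on $S\subseteq[V]^\ell$ is the restriction of $(\mathcal I_{\rm fin})^{(\rm inj)}$ to $S$. A non-injective orbit $O\in\mathcal O$ is deterministic if for every $a\in O$ there is $\alpha\in\mathrm{Aut}(\mathbb H)$ with $O_<(p_1(\alpha(a),e))=O_<(p_1(\alpha(a),n))$ for all strictly increasing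 $e\in E$, $n\in N$; otherwise it is non-deterministic. Orbits $O,P$ are linked at $v$ in an instance $\mathcal J$ over $\mathcal O$ if there are $k\ge1$, variables $v=v_1,\dots,v_{k+1}=v$, constraints $C_1,\dots,C_k$ and orbits $O=c_1,\dots,c_{k+1}=P$ with $(c_i,c_{i+1})\in\mathrm{proj}_{(v_i,v_{i+1})}(C_i)$ for all $i$. A non-trivial $\ell$-minimal instance $\mathcal I$ of $\mathrm{CSP}(\mathbb A)$ is *inj-irreducible* if for every $S\subseteq[V]^\ell$ one of the following holds for the restriction $\mathcal J$ of $\mathcal I_{\rm fin}$ to $S$: $\mathcal J^{(\rm inj)}$ has a solution; or for some $v\in S$, $\mathrm{proj}_v(\mathcal J)$ contains $E$ and $N$ and these are not linked at $v$; or for some $v\in S$, an orbit from $\{E,N\}$ is linked at $v$ to a non-deterministic orbit. **The algorithm InjIrreducibility.** Given an instance $\mathcal I$ of $\mathrm{CSP}(\mathbb A)$, repeat the following. 1. Make $\mathcal I$ $(2\ell,\max(3\ell,b))$-minimal and eq-subdirect, by alternating the replacement of $\mathcal I$ by the equivalent $(2\ell,\max(3\ell,b))$-minimal instance with the procedure Eq-Subdirect,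 until no constraint changes. Eq-Subdirect goes through the tuples $v\in[V]^\ell$ in an arbitrary order, lets $P$ be the union of $\mathrm{proj}_v(\mathcal I)\cap I$ and of all non-injective orbits $O\subseteq \mathrm{proj}_v(\mathcal I)$ under $\mathrm{Aut}(\mathbb H)$ for which $(\mathcal I^{v\in O})_{\rm eq}$ has a solution, and replaces $\mathcal I$ by $\mathcal I^{v\in P}$; whenever the result is not $\ell$-minimal, it makes it $\ell$-minimal and starts again. Here $\mathcal I^{v\in R}$ arises by replacing each constraint $C$ whose scope contains $v$ by $\{g\in C:g(v)\in R\}$, and $\mathcal I_{\rm eq}$ by replacing each $C$ by $\{\sigma h:h\in C,\sigma\in\mathrm{Sym}(H)\}$. 2. Identify all variables $x,y$ with $\mathrm{proj}_{(x,y)}(\mathcal I)=\{(a,a):a\in H\}$. 3. For every $u\in[V]^\ell$ and every partition $\{E^1_u,\dots,E^s_u\}$ ($s\ge 1$) of $\mathrm{proj}_u(\mathcal I)$ into non-empty sets that are pp-definable in $\mathbb A$, such that $\mathrm{proj}_u(\mathcal I)\cap I\subseteq E^1_u$ and $E^1_u$ contains no non-deterministic orbit, run ExtendPartition: start with $S=\{u\}$;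 as long as there are $v\in S$ and $w\in[V]^\ell\setminus S$ such that the sets $E^t_w:=\{a:\exists b\in E^t_v\ (b,a)\in\mathrm{proj}_{(v,w)}(\mathcal I)\}$ ($1\le t\le s$) are pairwise disjoint and $E^1_w$ contains no non-deterministic orbit, add such a $w$ to $S$ with these sets. If the injective finitisation of $\mathcal I$ on the resulting $S$ has a solution for all $u$ and all such partitions, stop and output $\mathcal I$. Otherwise, for one partition for which it has no solution, replace every constraint $C$ by the set of those $f\in C$ with $f(v)\notin E^1_v$ for all $v\in S$ contained in the scope of $C$, and go back to step 1. **Theorem.** Let $\mathcal I$ be an instance of $\mathrm{CSP}(\mathbb A)$. The algorithm InjIrreducibility has an output on $\mathcal I$, and for every output $\mathcal I'$ that it can produce on $\mathcal I$ (in whichever order the loops are executed), $\mathcal I'$ is an instance of $\mathrm{CSP}(\mathbb A)$, $\mathcal I'$ has a solution if and only if $\mathcal I$ has a solution, and $\mathcal I'$ is either trivial or inj-irreducible. -/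

import Mathlib

open CategoryTheory FirstOrder

universe u

/-! ## Hypergraphs, ordered hypergraphs, and their Fraïssé limits -/

/-- The only relation symbol of the language of `ℓ`-hypergraphs; it is `ℓ`-ary. -/
inductive HyperRel (ℓ : ℕ) : ℕ → Type
  | edge : HyperRel ℓ ℓ

/-- The language of `ℓ`-hypergraphs. -/
def hyperLang (ℓ : ℕ) : FirstOrder.Language.{0, 0} := ⟨fun _ => Empty, HyperRel ℓ⟩

/-- The language of ordered `ℓ`-hypergraphs. -/
abbrev ordHyperLang (ℓ : ℕ) : FirstOrder.Language.{0, 0} := (hyperLang ℓ).sum FirstOrder.Language.order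

instance (ℓ n : ℕ) : IsEmpty ((hyperLang ℓ).Functions n) := inferInstanceAs (IsEmpty Empty)

instance (ℓ n : ℕ) : IsEmpty ((ordHyperLang ℓ).Functions n) :=
  inferInstanceAs (IsEmpty (Empty ⊕ FirstOrder.Language.order.Functions n))

attribute [local instance] FirstOrder.Language.orderStructure

/-- The set `E` of hyperedges. -/
def edgeSet (ℓ : ℕ) (H : Type*) [(hyperLang ℓ).Structure H] : Set (Fin ℓ → H) :=
  {x | FirstOrder.Language.Structure.RelMap (L := hyperLang ℓ) HyperRel.edge x}

/-- The set `N` of injective `ℓ`-tuples that are not hyperedges. -/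
def nonEdgeSet (ℓ : ℕ) (H : Type*) [(hyperLang ℓ).Structure H] : Set (Fin ℓ → H) :=
  {x | Function.Injective x ∧ x ∉ edgeSet ℓ H}

/-- A structure is an `ℓ`-hypergraph if all hyperedges are injective tuples and the edge relation
is fully symmetric. -/
def IsHypergraph (ℓ : ℕ) (H : Type*) [(hyperLang ℓ).Structure H] : Prop :=
  (∀ x ∈ edgeSet ℓ H, Function.Injective x) ∧
    ∀ x ∈ edgeSet ℓ H, ∀ σ : Equiv.Perm (Fin ℓ), x ∘ σ ∈ edgeSet ℓ H

/-- `K` is a class of finite `ℓ`-hypergraphs that is finitely bounded, as witnessed by `b`: it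
consists of all finite `ℓ`-hypergraphs into which no member of some finite set of finite
hypergraphs with at most `b` vertices embeds. -/
def FinitelyBoundedBy {ℓ : ℕ} (K : Set (Bundled.{u} (hyperLang ℓ).Structure)) (b : ℕ) : Prop :=
  ∃ F : Set (Bundled.{u} (hyperLang ℓ).Structure), F.Finite ∧
    (∀ X ∈ F, Finite X ∧ IsHypergraph ℓ X ∧ Nat.card X ≤ b) ∧
    ∀ X : Bundled.{u} (hyperLang ℓ).Structure,
      X ∈ K ↔ Finite X ∧ IsHypergraph ℓ X ∧ ∀ Y ∈ F, IsEmpty (Y ↪[hyperLang ℓ] X)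

/-- The class of all expansions of members of `K` by a linear order. -/
def orderedClass {ℓ : ℕ} (K : Set (Bundled.{u} (hyperLang ℓ).Structure)) :
    Set (Bundled.{u} (ordHyperLang ℓ).Structure) :=
  {M | (⟨M, (FirstOrder.Language.LHom.sumInl : hyperLang ℓ →ᴸ ordHyperLang ℓ).reduct M⟩ :
      Bundled.{u} (hyperLang ℓ).Structure) ∈ K ∧
    M ⊨ (ordHyperLang ℓ).linearOrderTheory}

section Orbits

variable (ℓ : ℕ) {H : Type*} [(hyperLang ℓ).Structure H]

/-- The orbit `O(a)` of a tuple under `Aut(ℍ)`. -/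
def orb {k : ℕ} (a : Fin k → H) : Set (Fin k → H) :=
  {b | ∃ α : H ≃[hyperLang ℓ] H, ∀ i, b i = α (a i)}

/-- The orbit of a tuple under `Aut(ℍ, <)`. -/
def orbLT [LinearOrder H] {k : ℕ} (a : Fin k → H) : Set (Fin k → H) :=
  {b | ∃ α : H ≃[ordHyperLang ℓ] H, ∀ i, b i = α (a i)}

variable (H) in
/-- The set `𝒪` of orbits of `ℓ`-tuples under `Aut(ℍ)`. -/
def Orb : Type _ := {O : Set (Fin ℓ → H) // ∃ a, O = orb ℓ a}

end Orbits

/-- The set of injective `n`-tuples. -/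
def injTuples (H : Type*) (n : ℕ) : Set (Fin n → H) := {a | Function.Injective a}

/-! ## Operations and their properties -/

/-- Operations of arity `n`. -/
abbrev Op (H : Type*) (n : ℕ) := (Fin n → H) → H

/-- The componentwise action of an operation on tuples. -/
def Op.app {H : Type*} {n k : ℕ} (f : Op H n) (a : Fin n → Fin k → H) : Fin k → H :=
  fun j => f fun i => a i j

/-- `f` preserves the relation `R`. -/
def Op.Preserves {H : Type*} {n k : ℕ} (f : Op H n) (R : Set (Fin k → H)) : Prop :=
  ∀ a : Fin n → Fin k → H, (∀ i, a i ∈ R) → f.app a ∈ R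

/-- `f` is a polymorphism of the structure that `H` carries in the language `LA`. -/
def Op.IsPolymorphism {H : Type*} {n : ℕ} (f : Op H n)
    (LA : FirstOrder.Language) [LA.Structure H] : Prop :=
  ∀ (k : ℕ) (r : LA.Relations k), f.Preserves {x | FirstOrder.Language.Structure.RelMap r x}

/-- `f` is canonical with respect to `(ℍ, <)`: the orbit of `f(a₁, …, aₙ)` under `Aut(ℍ, <)`
depends only on the orbits of `a₁, …, aₙ`. -/
def Op.IsCanonical (ℓ : ℕ) {H : Type*} [(hyperLang ℓ).Structure H] [LinearOrder H] {n : ℕ}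
    (f : Op H n) : Prop :=
  ∀ (k : ℕ) (a b : Fin n → Fin k → H), (∀ i, orbLT ℓ (a i) = orbLT ℓ (b i)) →
    orbLT ℓ (f.app a) = orbLT ℓ (f.app b)

/-- The ternary operation `m` is an injection, canonical with respect to `(ℍ, <)`, that acts as a
minority operation on the orbits of injective `ℓ`-tuples. -/
structure IsInjectiveLinear (ℓ : ℕ) {H : Type*} [(hyperLang ℓ).Structure H] [LinearOrder H]
    (m : Op H 3) : Prop where
  injective : Function.Injective m
  canonical : m.IsCanonical ℓ
  minority : ∀ a ∈ injTuples H ℓ, ∀ b ∈ injTuples H ℓ,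
    orb ℓ (m.app ![a, a, b]) = orb ℓ b ∧ orb ℓ (m.app ![a, b, a]) = orb ℓ b ∧
      orb ℓ (m.app ![b, a, a]) = orb ℓ b

/-- The binary operation `p` is an injection, canonical with respect to `(ℍ, <)`, that acts as the
first projection on the orbits of injective `ℓ`-tuples, and `(x, y) ↦ p(y, x)` acts
lexicographically on the order. -/
structure IsLexProjection (ℓ : ℕ) {H : Type*} [(hyperLang ℓ).Structure H] [LinearOrder H]
    (p : Op H 2) : Prop where
  injective : Function.Injective p
  canonical : p.IsCanonical ℓ
  first : ∀ a ∈ injTuples H ℓ, ∀ b ∈ injTuples H ℓ, orb ℓ (p.app ![a, b]) = orb ℓ a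
  lex : ∀ x y x' y' : H, y < y' ∨ y = y' ∧ x < x' → p ![x, y] < p ![x', y']

/-- A non-injective orbit `O` is deterministic if for every `a ∈ O` there is `α ∈ Aut(ℍ)` such that
`p(O_<(α a), O_<(e)) = p(O_<(α a), O_<(n))` for strictly increasing `e ∈ E` and `n ∈ N`. -/
def IsDeterministic (ℓ : ℕ) {H : Type*} [(hyperLang ℓ).Structure H] [LinearOrder H]
    (p : Op H 2) (O : Set (Fin ℓ → H)) : Prop :=
  ∀ a ∈ O, ∃ α : H ≃[hyperLang ℓ] H, ∀ e ∈ edgeSet ℓ H, ∀ n ∈ nonEdgeSet ℓ H,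
    StrictMono e → StrictMono n →
      orbLT ℓ (p.app ![fun i => α (a i), e]) = orbLT ℓ (p.app ![fun i => α (a i), n])

/-- `O` is a non-deterministic (in particular, non-injective) orbit. -/
def IsNonDeterministic (ℓ : ℕ) {H : Type*} [(hyperLang ℓ).Structure H] [LinearOrder H]
    (p : Op H 2) (O : Orb ℓ H) : Prop :=
  Disjoint O.1 (injTuples H ℓ) ∧ ¬ IsDeterministic ℓ p O.1

/-- The set `E` contains no non-deterministic orbit. -/
def NoNonDeterministic (ℓ : ℕ) {H : Type*} [(hyperLang ℓ).Structure H] [LinearOrder H]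
    (p : Op H 2) (E : Set (Fin ℓ → H)) : Prop :=
  ∀ O : Orb ℓ H, IsNonDeterministic ℓ p O → ¬ O.1 ⊆ E

/-! ## First-order reducts and pp-definability -/

/-- All relations of the `LA`-structure on `H` are first-order definable (without parameters) in
the hypergraph on `H`. -/
def IsFOReduct (ℓ : ℕ) (H : Type*) [(hyperLang ℓ).Structure H] (LA : FirstOrder.Language)
    [LA.Structure H] : Prop :=
  ∀ (k : ℕ) (r : LA.Relations k),
    (∅ : Set H).Definable (hyperLang ℓ) {x : Fin k → H | FirstOrder.Language.Structure.RelMap r x}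

/-- `R` is definable by a primitive positive formula: an existentially quantified finite
conjunction of atomic formulas. -/
def PPDefinable (LA : FirstOrder.Language) {H : Type*} [LA.Structure H] {k : ℕ} (R : Set (Fin k → H)) :
    Prop :=
  ∃ (n : ℕ) (Φ : List (LA.Formula (Fin k ⊕ Fin n))), (∀ φ ∈ Φ, φ.IsAtomic) ∧
    ∀ a, a ∈ R ↔ ∃ b : Fin n → H, ∀ φ ∈ Φ, φ.Realize (Sum.elim a b)

/-! ## CSP instances -/

/-- A constraint over the set `B`: a set of maps from its scope to `B`. -/
structure Constraint (X B : Type*) where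
  scope : Set X
  rel : Set (scope → B)

/-- The projection of a constraint to a tuple of variables; it is only meaningful if all entries
of the tuple lie in the scope. -/
def Constraint.proj {X B : Type*} (C : Constraint X B) {k : ℕ} (v : Fin k → X) :
    Set (Fin k → B) :=
  {a | ∃ f ∈ C.rel, ∃ h : ∀ i, v i ∈ C.scope, ∀ i, a i = f ⟨v i, h i⟩}

/-- The restriction of a constraint to a set of variables. -/
def Constraint.restrict {X B : Type*} (C : Constraint X B) (S : Set X) : Constraint X B where
  scope := C.scope ∩ S
  rel := {g | ∃ f ∈ C.rel, ∀ x : ↥(C.scope ∩ S), g x = f ⟨x.1, x.2.1⟩}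

/-- A CSP instance over the set `B`, with variables from `X`. -/
structure CSPInst (X B : Type*) where
  vars : Set X
  cons : Set (Constraint X B)
  scope_subset : ∀ C ∈ cons, C.scope ⊆ vars

namespace CSPInst

variable {X B : Type*} (I : CSPInst X B)

/-- `s` satisfies all constraints. -/
def IsSolution (s : I.vars → B) : Prop :=
  ∀ (C) (hC : C ∈ I.cons), (fun x : C.scope => s ⟨x.1, I.scope_subset C hC x.2⟩) ∈ C.rel

def HasSolution : Prop := ∃ s, I.IsSolution s

/-- The instance contains an empty constraint. -/
def Trivial : Prop := ∃ C ∈ I.cons, C.rel = ∅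

/-- The projection of the instance to a tuple of variables. It is used for `m`-minimal instances
and tuples of length at most `m`, where it equals the projection of any constraint whose scope
contains the tuple. -/
def proj {k : ℕ} (v : Fin k → X) : Set (Fin k → B) := ⋃ C ∈ I.cons, C.proj v

/-- `(m, n)`-minimality: every non-empty set of at most `n` variables is contained in the scope of
some constraint, and any two constraints whose scopes contain a given tuple of at most `m`
variables have the same projection to it. -/
def Minimal (m n : ℕ) : Prop :=
  (∀ L ⊆ I.vars, L.Nonempty → L.encard ≤ n → ∃ C ∈ I.cons, L ⊆ C.scope) ∧
  ∀ k ≤ m, ∀ v : Fin k → X, ∀ C ∈ I.cons, ∀ D ∈ I.cons,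
    (∀ i, v i ∈ C.scope) → (∀ i, v i ∈ D.scope) → C.proj v = D.proj v

/-- Add the full constraint on every non-empty set of at most `n` variables that is not yet
contained in the scope of a constraint. -/
def complete (n : ℕ) : CSPInst X B where
  vars := I.vars
  cons := I.cons ∪ {C | C.scope ⊆ I.vars ∧ C.scope.Nonempty ∧ C.scope.encard ≤ n ∧
    (¬ ∃ D ∈ I.cons, C.scope ⊆ D.scope) ∧ C.rel = Set.univ}
  scope_subset := by
    rintro C (hC | hC)
    · exact I.scope_subset C hC
    · exact hC.1

/-- The family of sets `D C ⊆ C`, for `C` a constraint of the instance, is consistent for all tuples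
of at most `m` variables. -/
def Consistent (m : ℕ) (D : ∀ C : Constraint X B, Set (C.scope → B)) : Prop :=
  (∀ C ∈ I.cons, D C ⊆ C.rel) ∧
  ∀ k ≤ m, ∀ v : Fin k → X, ∀ C₁ ∈ I.cons, ∀ C₂ ∈ I.cons,
    (∀ i, v i ∈ C₁.scope) → (∀ i, v i ∈ C₂.scope) →
      Constraint.proj ⟨C₁.scope, D C₁⟩ v = Constraint.proj ⟨C₂.scope, D C₂⟩ v

/-- The `(m, n)`-minimal instance equivalent to `I`: after adding full constraints, shrink the
constraints to the largest consistent family of subsets. -/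
def minimalize (m n : ℕ) : CSPInst X B where
  vars := I.vars
  cons := (fun C => ⟨C.scope, {f | ∃ D, (I.complete n).Consistent m D ∧ f ∈ D C}⟩) ''
    (I.complete n).cons
  scope_subset := by
    rintro _ ⟨C, hC, rfl⟩
    exact (I.complete n).scope_subset C hC

/-- Replace every constraint `C` whose scope contains all variables of the tuple `v` by
`{g ∈ C | g(v) ∈ R}`. -/
def restrictTuple {k : ℕ} (v : Fin k → X) (R : Set (Fin k → B)) : CSPInst X B where
  vars := I.vars
  cons := (fun C => ⟨C.scope,
    {g | g ∈ C.rel ∧ ∀ h : ∀ i, v i ∈ C.scope, (fun i => g ⟨v i, h i⟩) ∈ R}⟩) '' I.cons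
  scope_subset := by
    rintro _ ⟨C, hC, rfl⟩
    exact I.scope_subset C hC

/-- The instance `I_eq`: close every constraint under the full symmetric group. -/
def eqInst : CSPInst X B where
  vars := I.vars
  cons := (fun C => ⟨C.scope, {g | ∃ h ∈ C.rel, ∃ σ : Equiv.Perm B, ∀ x, g x = σ (h x)}⟩) '' I.cons
  scope_subset := by
    rintro _ ⟨C, hC, rfl⟩
    exact I.scope_subset C hC

/-- The restriction of an instance to a set `S` of its variables. -/
def restrict (S : Set X) : CSPInst X B where
  vars := S
  cons := (fun C => C.restrict S) '' I.cons
  scope_subset := by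
    rintro _ ⟨C, _, rfl⟩ x hx
    exact hx.2

/-- One element connects to another via a single constraint. -/
def Step (x y : X × B) : Prop :=
  ∃ C ∈ I.cons, ![x.2, y.2] ∈ C.proj ![x.1, y.1]

/-- `a` and `b` are connected by a path from `v` to `v`; on the projection of a `1`-minimal instance
to `v`, this is the linkedness congruence. -/
def Linked (v : X) (a b : B) : Prop := Relation.TransGen I.Step (v, a) (v, b)

/-- `I` is an instance of the CSP of the `LA`-structure on `B`: it has finitely many variables, and
every constraint has a non-empty scope and is given by a relation of the structure and an
enumeration (possibly with repetitions) of the scope. -/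
def IsInstanceOf (LA : FirstOrder.Language) [LA.Structure B] : Prop :=
  I.vars.Finite ∧ ∀ C ∈ I.cons, C.scope.Nonempty ∧
    ∃ (k : ℕ) (r : LA.Relations k) (u : Fin k → C.scope), Function.Surjective u ∧
      ∀ f : C.scope → B, f ∈ C.rel ↔ FirstOrder.Language.Structure.RelMap r (f ∘ u)

end CSPInst

/-! ## Finitisation and inj-irreducibility -/

/-- The increasing (hence injective) `ℓ`-tuples of elements of `U`. -/
def incTuples (ℓ : ℕ) {V : Type*} [LinearOrder V] (U : Set V) : Set (Fin ℓ ↪o V) :=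
  {v | ∀ i, v i ∈ U}

section Finitisation

variable (ℓ : ℕ) {V H : Type*} [LinearOrder V] [(hyperLang ℓ).Structure H]

/-- The constraint of the finitisation that corresponds to `C`. -/
def Constraint.fin (C : Constraint V H) : Constraint (Fin ℓ ↪o V) (Orb ℓ H) where
  scope := incTuples ℓ C.scope
  rel := {g | ∃ f ∈ C.rel, ∀ v : incTuples ℓ C.scope,
    (fun i => f ⟨v.1 i, v.2 i⟩) ∈ (g v).1}

/-- The finitisation of an instance. -/
def CSPInst.fin (I : CSPInst V H) : CSPInst (Fin ℓ ↪o V) (Orb ℓ H) where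
  vars := incTuples ℓ I.vars
  cons := Constraint.fin ℓ '' I.cons
  scope_subset := by
    rintro _ ⟨C, hC, rfl⟩ v hv i
    exact I.scope_subset C hC (hv i)

variable {ℓ} in
/-- The injectivisation of an instance over the set of orbits: remove from all constraints all maps
that take a value other than the injective orbits `E` and `N`. -/
def CSPInst.inj {X : Type*} (J : CSPInst X (Orb ℓ H)) : CSPInst X (Orb ℓ H) where
  vars := J.vars
  cons := (fun C => ⟨C.scope,
    {g | g ∈ C.rel ∧ ∀ x, (g x).1 = edgeSet ℓ H ∨ (g x).1 = nonEdgeSet ℓ H}⟩) '' J.cons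
  scope_subset := by
    rintro _ ⟨C, hC, rfl⟩
    exact J.scope_subset C hC

/-- The injective finitisation of `I` on `S`. -/
def CSPInst.injFinOn (I : CSPInst V H) (S : Set (Fin ℓ ↪o V)) :
    CSPInst (Fin ℓ ↪o V) (Orb ℓ H) :=
  (I.fin ℓ).inj.restrict S

/-- Inj-irreducible instances of the CSP of the `LA`-structure on `H`. -/
def CSPInst.InjIrreducible [LinearOrder H] (LA : FirstOrder.Language) [LA.Structure H] (p : Op H 2)
    (I : CSPInst V H) : Prop :=
  I.IsInstanceOf LA ∧ ¬ I.Trivial ∧ I.Minimal ℓ ℓ ∧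
  ∀ S : Set (Fin ℓ ↪o V), S ⊆ incTuples ℓ I.vars →
    let J := (I.fin ℓ).restrict S
    J.inj.HasSolution ∨
    (∃ v ∈ S, ∃ E N : Orb ℓ H, E.1 = edgeSet ℓ H ∧ N.1 = nonEdgeSet ℓ H ∧
      ![E] ∈ J.proj ![v] ∧ ![N] ∈ J.proj ![v] ∧ ¬ J.Linked v E N) ∨
    (∃ v ∈ S, ∃ O P : Orb ℓ H, (O.1 = edgeSet ℓ H ∨ O.1 = nonEdgeSet ℓ H) ∧
      IsNonDeterministic ℓ p P ∧ J.Linked v O P)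

end Finitisation

/-! ## The algorithm

The procedures are formalized as relations between inputs and outputs, so that all orders in which
the loops may be executed are covered. -/

section Algorithm

variable (ℓ : ℕ) {V H : Type*} [LinearOrder V] [(hyperLang ℓ).Structure H]

/-- The set `P`: the injective tuples in the projection of `I` to `v`, together with the non-injective
orbits `O` in this projection such that `(I^{v ∈ O})_eq` has a solution. -/
def eqPart (I : CSPInst V H) (v : Fin ℓ ↪o V) : Set (Fin ℓ → H) :=
  (I.proj v ∩ injTuples H ℓ) ∪
    ⋃ O ∈ {O : Orb ℓ H | Disjoint O.1 (injTuples H ℓ) ∧ O.1 ⊆ I.proj v ∧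
      (I.restrictTuple v O.1).eqInst.HasSolution}, O.1

open Classical in
/-- One run of the outer loop of the procedure Eq-Subdirect, where the list is the sequence of tuples
still to be processed. The second component is the final value of the variable `changed`; once it
is set to true, the remaining tuples are skipped. -/
noncomputable def eqPass : List (Fin ℓ ↪o V) → CSPInst V H → CSPInst V H × Bool
  | [], I => (I, false)
  | v :: l, I =>
    if (I.restrictTuple v (eqPart ℓ I v)).Minimal ℓ ℓ then
      eqPass l (I.restrictTuple v (eqPart ℓ I v))
    else ((I.restrictTuple v (eqPart ℓ I v)).minimalize ℓ ℓ, true)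

/-- The procedure Eq-Subdirect, on input the first argument, may return the second. -/
inductive EqSubdirectOutput : CSPInst V H → CSPInst V H → Prop
  | finish {I J : CSPInst V H} (l : List (Fin ℓ ↪o V)) (hl : ∀ v, v ∈ l ↔ v ∈ incTuples ℓ I.vars)
      (h : eqPass ℓ l I = (J, false)) : EqSubdirectOutput I J
  | next {I J K : CSPInst V H} (l : List (Fin ℓ ↪o V)) (hl : ∀ v, v ∈ l ↔ v ∈ incTuples ℓ I.vars)
      (h : eqPass ℓ l I = (J, true)) (hK : EqSubdirectOutput J K) : EqSubdirectOutput I K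

/-- Computation of an `(m, n)`-minimal eq-subdirect instance: the `(m, n)`-minimality procedure and
the procedure Eq-Subdirect are alternated until no constraint changes. -/
inductive MinimalEqSubdirectOutput (m n : ℕ) : CSPInst V H → CSPInst V H → Prop
  | finish {I : CSPInst V H} (h : EqSubdirectOutput ℓ (I.minimalize m n) (I.minimalize m n)) :
      MinimalEqSubdirectOutput m n I (I.minimalize m n)
  | next {I J K : CSPInst V H} (h : EqSubdirectOutput ℓ (I.minimalize m n) J)
      (hne : J ≠ I.minimalize m n) (hK : MinimalEqSubdirectOutput m n J K) :
      MinimalEqSubdirectOutput m n I K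

/-- The variables `x` and `y` are forced to be equal by the projection of the instance to `(x, y)`. -/
def ForcedEqual (I : CSPInst V H) (x y : V) : Prop :=
  x = y ∨ I.proj ![x, y] = {a | a 0 = a 1}

/-- Rename the variables of an instance along `r`, for `r` identifying variables only if they have
the same value in every map of every constraint. -/
def CSPInst.rename (I : CSPInst V H) (r : V → V) : CSPInst V H where
  vars := r '' I.vars
  cons := (fun C => ⟨r '' C.scope,
    {f | (fun x : C.scope => f ⟨r x.1, Set.mem_image_of_mem r x.2⟩) ∈ C.rel}⟩) '' I.cons
  scope_subset := by
    rintro _ ⟨C, hC, rfl⟩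
    exact Set.image_mono (I.scope_subset C hC)

/-- The procedure IdentifyAllEqual: choose a representative in every class of variables that are
forced to be equal, and rename every variable to its representative. -/
def IdentifyAllEqualOutput (I J : CSPInst V H) : Prop :=
  ∃ r : V → V, (∀ x ∈ I.vars, r x ∈ I.vars ∧ ForcedEqual I x (r x)) ∧
    (∀ x ∈ I.vars, ∀ y ∈ I.vars, ForcedEqual I x y → r x = r y) ∧ J = I.rename r

variable [LinearOrder H]

/-- `E 0, …, E s` are the classes of a partition of the projection of `I` to `u` that the algorithm
considers (`E 0` is the distinguished class). -/
structure IsAdmissiblePartition (LA : FirstOrder.Language) [LA.Structure H] (p : Op H 2) (I : CSPInst V H)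
    (u : Fin ℓ ↪o V) {s : ℕ} (E : Fin (s + 1) → Set (Fin ℓ → H)) : Prop where
  nonempty : ∀ i, (E i).Nonempty
  disjoint : ∀ i j, i ≠ j → Disjoint (E i) (E j)
  union : ⋃ i, E i = I.proj u
  ppDefinable : ∀ i, PPDefinable LA (E i)
  inj_subset : I.proj u ∩ injTuples H ℓ ⊆ E 0
  noNonDet : NoNonDeterministic ℓ p (E 0)

variable {ℓ} in
/-- The class `{a | ∃ b ∈ E, (b, a) ∈ proj_{(v, w)}(I)}`. -/
def transport (I : CSPInst V H) (v w : Fin ℓ ↪o V) (E : Set (Fin ℓ → H)) : Set (Fin ℓ → H) :=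
  {a | ∃ b ∈ E, Fin.append b a ∈ I.proj (Fin.append v w)}

/-- The state of the procedure ExtendPartition: a set `S` of tuples of variables, and a family of
`s + 1` classes for every tuple (only those for tuples in `S` matter). -/
abbrev PartState (ℓ : ℕ) (V H : Type*) [LinearOrder V] (s : ℕ) :=
  Set (Fin ℓ ↪o V) × ((Fin ℓ ↪o V) → Fin (s + 1) → Set (Fin ℓ → H))

open Classical in
/-- One step of the procedure ExtendPartition that adds a tuple `w` to `S`. -/
def ExtendStep (p : Op H 2) (I : CSPInst V H) {s : ℕ} (σ τ : PartState ℓ V H s) : Prop :=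
  ∃ v ∈ σ.1, ∃ w ∈ incTuples ℓ I.vars, w ∉ σ.1 ∧
    (∀ i j, i ≠ j → Disjoint (transport I v w (σ.2 v i)) (transport I v w (σ.2 v j))) ∧
    NoNonDeterministic ℓ p (transport I v w (σ.2 v 0)) ∧
    τ = (insert w σ.1, Function.update σ.2 w fun t => transport I v w (σ.2 v t))

/-- The procedure ExtendPartition, started with the tuple `u` and the partition `E`, may return `τ`:
tuples are added until no further tuple can be added. -/
def ExtendPartitionOutput (p : Op H 2) (I : CSPInst V H) (u : Fin ℓ ↪o V) {s : ℕ}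
    (E : Fin (s + 1) → Set (Fin ℓ → H)) (τ : PartState ℓ V H s) : Prop :=
  Relation.ReflTransGen (ExtendStep ℓ p I) ({u}, fun _ => E) τ ∧
    ∀ τ', ¬ ExtendStep ℓ p I τ τ'

/-- Replace every constraint `C` by the set of all `f ∈ C` such that `f(v) ∉ E v` for every `v ∈ S` all
of whose variables are in the scope of `C`. -/
def CSPInst.removeClasses {ℓ : ℕ} (I : CSPInst V H) (S : Set (Fin ℓ ↪o V))
    (E : (Fin ℓ ↪o V) → Set (Fin ℓ → H)) : CSPInst V H where
  vars := I.vars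
  cons := (fun C => ⟨C.scope, {f | f ∈ C.rel ∧ ∀ v ∈ S, ∀ h : ∀ i, v i ∈ C.scope,
    (fun i => f ⟨v i, h i⟩) ∉ E v}⟩) '' I.cons
  scope_subset := by
    rintro _ ⟨C, hC, rfl⟩
    exact I.scope_subset C hC

/-- The procedure InjIrreducibility, on input the first argument, may return the second. In every run
of its main loop, it replaces the instance `I` by a minimal eq-subdirect instance `J`, and then `J`
by the instance `K` obtained by identifying variables. If for all admissible partitions the
injective finitisation of `K` on the set computed by ExtendPartition has a solution, it returns `K`;
otherwise, it removes the first classes for one partition for which this fails, and starts the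
next run. -/
inductive InjIrreducibilityOutput (LA : FirstOrder.Language) [LA.Structure H] (p : Op H 2) (b : ℕ) :
    CSPInst V H → CSPInst V H → Prop
  | finish {I J K : CSPInst V H}
      (hJ : MinimalEqSubdirectOutput ℓ (2 * ℓ) (max (3 * ℓ) b) I J)
      (hK : IdentifyAllEqualOutput J K)
      (h : ∀ u ∈ incTuples ℓ K.vars, ∀ (s : ℕ) (E : Fin (s + 1) → Set (Fin ℓ → H)),
        IsAdmissiblePartition ℓ LA p K u E →
        ∃ τ : PartState ℓ V H s, ExtendPartitionOutput ℓ p K u E τ ∧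
          (K.injFinOn ℓ τ.1).HasSolution) :
      InjIrreducibilityOutput LA p b I K
  | next {I J K I' : CSPInst V H}
      (hJ : MinimalEqSubdirectOutput ℓ (2 * ℓ) (max (3 * ℓ) b) I J)
      (hK : IdentifyAllEqualOutput J K)
      (u : Fin ℓ ↪o V) (hu : u ∈ incTuples ℓ K.vars) (s : ℕ)
      (E : Fin (s + 1) → Set (Fin ℓ → H)) (hE : IsAdmissiblePartition ℓ LA p K u E)
      (τ : PartState ℓ V H s) (hτ : ExtendPartitionOutput ℓ p K u E τ)
      (hno : ¬ (K.injFinOn ℓ τ.1).HasSolution)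
      (hI' : InjIrreducibilityOutput LA p b (K.removeClasses τ.1 fun v => τ.2 v 0) I') :
      InjIrreducibilityOutput LA p b I I'


end Algorithm

/-! Two facts about `ℍ` drive the proof. Every linear order on a finite set of elements can be
imposed by an automorphism of `ℍ`, because the ordered class contains all orderings of its members
(`exists_equiv_order`). And the orbit of a non-injective `ℓ`-tuple is determined by its kernel
(`sameType_of_not_injective`). So if one map is chosen in every constraint, all with a common
kernel, then the orbits on an `ℓ`-tuple of variables agree across constraints, except that an
injective value may be an edge in one constraint and a non-edge in another.

The core is `hasSolution_injFinOn`. Let `F C` be such a family whose values on the tuples in `S` are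
injective with the same edge status in all constraints, or lie in deterministic orbits. Start from
increasing maps `G C` in the constraints and, for each `w ∈ S` in turn, replace `G C` by `p(α F C, G
C)`, where the automorphisms `α` impose one common order on the `F C`. Since the second argument of
`p` dominates the order, the new maps are increasing. Where `F` is injective, `p` copies its status.
Where it is not, canonicity keeps a status that was already independent of the constraint, and at
`w` itself determinism, with a suitable order, makes the status independent of `G`. After all of `S`
is treated, the statuses form a solution of the injective finitisation.

ExtendPartition propagates the classes, so a family with a common kernel has the same class index on
all of `S` (`PartSystem.exists_index`). A solution of `I` of index `0` would give a solution of the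
injective finitisation; if there is none, removing the distinguished classes loses no solution. The
same argument shows that the complement of a distinguished class is invariant
(`PartSystem.presBy_diff`): eq-subdirectness extends non-injective tuples outside the class to
families with a common kernel, and if `m` or `p` led back into the class, its values on these
families would form a family of index `0`. Hence the reduced instance stays in the CSP; closure of
the CSP under such intersections is extracted from hypothesis (ii) in `IsTemplate.isOf_inter`.

For irreducibility, suppose that no injective orbit is linked to a non-deterministic one on `S`, and
let `u ∈ S`. The linkedness classes at `u`, with all classes of injective tuples merged into one,
form an admissible partition, and every tuple of `S` can be added to it directly from `u`. The
stopping condition then yields a solution on a superset of `S`.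

For termination, each round removes variables or properly shrinks constraints, and by
oligomorphicity there are only finitely many invariant constraints on a finite set of variables. -/

section Hypergraph

/-! ### Types of finite tuples and homogeneity with and without the order. -/

open FirstOrder.Language FirstOrder.Language.Structure

/-- Two maps into a hypergraph have the same kernel, and the same tuples of their domain are mapped
to hyperedges. -/
def SameType (ℓ : ℕ) {H U : Type*} [(hyperLang ℓ).Structure H] (f g : U → H) : Prop :=
  (∀ x y, f x = f y ↔ g x = g y) ∧ ∀ t : Fin ℓ → U, f ∘ t ∈ edgeSet ℓ H ↔ g ∘ t ∈ edgeSet ℓ H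

theorem SameType.symm {ℓ : ℕ} {H U : Type*} [(hyperLang ℓ).Structure H] {f g : U → H}
    (h : SameType ℓ f g) : SameType ℓ g f :=
  ⟨fun x y => (h.1 x y).symm, fun t => (h.2 t).symm⟩

theorem SameType.trans {ℓ : ℕ} {H U : Type*} [(hyperLang ℓ).Structure H] {f g k : U → H}
    (h : SameType ℓ f g) (h' : SameType ℓ g k) : SameType ℓ f k :=
  ⟨fun x y => (h.1 x y).trans (h'.1 x y), fun t => (h.2 t).trans (h'.2 t)⟩

theorem SameType.comp {ℓ : ℕ} {H U W : Type*} [(hyperLang ℓ).Structure H] {f g : U → H}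
    (h : SameType ℓ f g) (t : W → U) : SameType ℓ (f ∘ t) (g ∘ t) :=
  ⟨fun x y => h.1 (t x) (t y), fun r => h.2 (t ∘ r)⟩

theorem mem_edgeSet_equiv {ℓ : ℕ} {H : Type*} [(hyperLang ℓ).Structure H]
    (α : H ≃[hyperLang ℓ] H) (x : Fin ℓ → H) : (fun i => α (x i)) ∈ edgeSet ℓ H ↔ x ∈ edgeSet ℓ H :=
  α.map_rel HyperRel.edge x

theorem sameType_equiv {ℓ : ℕ} {H U : Type*} [(hyperLang ℓ).Structure H]
    (α : H ≃[hyperLang ℓ] H) (f : U → H) : SameType ℓ (fun x => α (f x)) f :=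
  ⟨fun _ _ => α.injective.eq_iff, fun t => mem_edgeSet_equiv α (f ∘ t)⟩

/-- An automorphism of the ordered hypergraph, as an automorphism of the hypergraph. -/
def ordEquivReduct {ℓ : ℕ} {H : Type*} [(hyperLang ℓ).Structure H] [LinearOrder H]
    (α : H ≃[ordHyperLang ℓ] H) : H ≃[hyperLang ℓ] H where
  toEquiv := α.toEquiv
  map_fun' := fun {_} f => isEmptyElim f
  map_rel' := fun {_} r x => α.map_rel (Sum.inl r) x

theorem ordEquiv_lt_iff {ℓ : ℕ} {H : Type*} [(hyperLang ℓ).Structure H] [LinearOrder H]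
    (α : H ≃[ordHyperLang ℓ] H) (x y : H) : α x < α y ↔ x < y := by
  have h := α.map_rel (Sum.inr FirstOrder.Language.orderRel.le) ![y, x]
  have h' : α y ≤ α x ↔ y ≤ x := h
  rw [← not_le, ← not_le, h']

variable {ℓ : ℕ} {K : Set (Bundled.{u} (hyperLang ℓ).Structure)} {b : ℕ}
  {H : Type u} [Countable H] [(hyperLang ℓ).Structure H] [LinearOrder H]

/-- The finite substructure of `H` generated by the image lies in the age, so its reduct lies in
`K`; and `K` is closed under embedded hypergraphs because it is given by forbidden embeddings. -/
theorem mem_class_of_injective (hK : FinitelyBoundedBy K b)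
    (hlim : IsFraisseLimit (orderedClass K) H) (X : Type u) [str : (hyperLang ℓ).Structure X]
    [Finite X] (g : X → H) (hg : Function.Injective g)
    (he : ∀ x : Fin ℓ → X, x ∈ edgeSet ℓ X ↔ g ∘ x ∈ edgeSet ℓ H) :
    (⟨X, str⟩ : Bundled.{u} (hyperLang ℓ).Structure) ∈ K := by
  let S : (ordHyperLang ℓ).Substructure H := Substructure.closure (ordHyperLang ℓ) (Set.range g)
  have hS : ∀ x, g x ∈ S := fun x => Substructure.subset_closure ⟨x, rfl⟩
  have hfg : S.FG := Substructure.fg_closure (Set.finite_range g)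
  have hmem : (⟨S, inferInstance⟩ : Bundled.{u} (ordHyperLang ℓ).Structure) ∈ orderedClass K := by
    rw [← hlim.age]
    exact ⟨S.fg_iff_structure_fg.1 hfg, ⟨S.subtype⟩⟩
  obtain ⟨hmemK, -⟩ := hmem
  obtain ⟨F, hF, hF', hFK⟩ := hK
  obtain ⟨hfin, ⟨hinj, hsym⟩, hno⟩ := (hFK _).1 hmemK
  let _ : (hyperLang ℓ).Structure S :=
    (LHom.sumInl : hyperLang ℓ →ᴸ ordHyperLang ℓ).reduct S
  have hedge : ∀ x : Fin ℓ → X, x ∈ edgeSet ℓ X ↔ (fun i => (⟨g (x i), hS _⟩ : S)) ∈ edgeSet ℓ S :=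
    fun x => he x
  let emb : X ↪[hyperLang ℓ] S :=
    { toFun := fun x => ⟨g x, hS x⟩
      inj' := fun x y h => hg (congrArg Subtype.val h)
      map_fun' := fun {_} f => isEmptyElim f
      map_rel' := by
        intro n r x
        cases r
        exact (hedge x).symm }
  refine (hFK _).2 ⟨‹_›, ⟨fun x hx => ?_, fun x hx σ => ?_⟩, fun Y hY => ⟨fun k => ?_⟩⟩
  · have := hinj _ ((hedge x).1 hx)
    intro i j hij
    exact this (by simp [hij])
  · exact (hedge _).2 (hsym _ ((hedge x).1 hx) σ)
  · exact (hno Y hY).false (emb.comp k)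

/-- Both axioms concern one edge at a time, and the structure induced on the entries of an edge
belongs to `K`. -/
theorem isHypergraph_limit (hK : FinitelyBoundedBy K b)
    (hlim : IsFraisseLimit (orderedClass K) H) : IsHypergraph ℓ H := by
  obtain ⟨F, hF, hF', hFK⟩ := id hK
  have key : ∀ x ∈ edgeSet ℓ H, Function.Injective x ∧
      ∀ σ : Equiv.Perm (Fin ℓ), x ∘ σ ∈ edgeSet ℓ H := by
    intro x hx
    let _ : (hyperLang ℓ).Structure (Set.range x) :=
      { funMap := fun {_} f => isEmptyElim f
        RelMap := fun {_} r y => RelMap r (Subtype.val ∘ y) }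
    have hm := mem_class_of_injective hK hlim (Set.range x) Subtype.val Subtype.val_injective
      (fun _ => Iff.rfl)
    obtain ⟨-, ⟨hinj, hsym⟩, -⟩ := (hFK _).1 hm
    have hx' : (fun i => (⟨x i, i, rfl⟩ : Set.range x)) ∈ edgeSet ℓ (Set.range x) := hx
    refine ⟨fun i j hij => hinj _ hx' (Subtype.ext hij), fun σ => hsym _ hx' σ⟩
  exact ⟨fun x hx => (key x hx).1, fun x hx => (key x hx).2⟩

theorem exists_ordEquiv_of_sameType (hlim : IsFraisseLimit (orderedClass K) H) {U : Type*}
    [Finite U] (f g : U → H) (h : SameType ℓ f g) (hlt : ∀ x y, f x < f y ↔ g x < g y) :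
    ∃ α : H ≃[ordHyperLang ℓ] H, ∀ x, g x = α (f x) := by
  let S : (ordHyperLang ℓ).Substructure H := Substructure.closure (ordHyperLang ℓ) (Set.range f)
  have hS : ∀ x : S, ∃ y, f y = x := fun x =>
    (Substructure.mem_closure_iff_of_isRelational (ordHyperLang ℓ) (Set.range f) x.1).1 x.2
  choose k hk using hS
  have hle : ∀ x y, f x ≤ f y ↔ g x ≤ g y := fun x y => by
    rw [← not_lt, ← not_lt, hlt]
  let emb : S ↪[ordHyperLang ℓ] H :=
    { toFun := fun x => g (k x)
      inj' := fun x y hxy => Subtype.ext (by rw [← hk x, ← hk y]; exact (h.1 _ _).2 hxy)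
      map_fun' := fun {_} f => isEmptyElim f
      map_rel' := by
        intro n r x
        rcases r with r | r
        · cases r
          have := (h.2 (k ∘ x)).symm
          have h2 : f ∘ (k ∘ x) = Subtype.val ∘ x := funext fun i => hk (x i)
          rw [h2] at this
          exact this
        · cases r
          have := (hle (k (x 0)) (k (x 1))).symm
          rw [hk, hk] at this
          exact this }
  obtain ⟨α, hα⟩ := hlim.ultrahomogeneous S (Substructure.fg_closure (Set.finite_range f)) emb
  refine ⟨α, fun x => ?_⟩
  have hx : f x ∈ S := Substructure.subset_closure ⟨x, rfl⟩
  have h1 : emb ⟨f x, hx⟩ = α (f x) := by rw [hα]; rfl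
  rw [← h1]
  exact (h.1 _ _).1 (hk ⟨f x, hx⟩).symm

/-- Membership in the ordered class puts no condition on the order beyond linearity, so the
hypergraph induced along `f`, with the order of `T`, is in the age. -/
theorem exists_sameType_ordered (hK : FinitelyBoundedBy K b)
    (hlim : IsFraisseLimit (orderedClass K) H) {T : Type u} [Finite T] [LinearOrder T]
    (f : T → H) (hf : Function.Injective f) : ∃ e : T → H, SameType ℓ e f ∧ ∀ x y, e x < e y ↔ x < y := by
  let strT : (hyperLang ℓ).Structure T :=
    { funMap := fun {_} f => isEmptyElim f
      RelMap := fun {_} r y => RelMap r (f ∘ y) }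
  have hmemK := mem_class_of_injective hK hlim T f hf (fun _ => Iff.rfl)
  have hmem : (⟨T, inferInstance⟩ : Bundled.{u} (ordHyperLang ℓ).Structure) ∈ orderedClass K := by
    refine ⟨?_, ?_⟩
    · convert hmemK
      exact Structure.ext (by funext n f; exact isEmptyElim f) rfl
    · have : (ordHyperLang ℓ).OrderedStructure T := ⟨fun x => Iff.rfl⟩
      exact model_linearOrder (L := ordHyperLang ℓ) (M := T)
  rw [← hlim.age] at hmem
  obtain ⟨-, ⟨e⟩⟩ := hmem
  refine ⟨e, ⟨fun x y => ?_, fun t => ?_⟩, fun x y => ?_⟩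
  · rw [e.injective.eq_iff, hf.eq_iff]
  · exact e.map_rel (Sum.inl HyperRel.edge) t
  · have h := e.map_rel (Sum.inr FirstOrder.Language.orderRel.le) ![y, x]
    have h' : e y ≤ e x ↔ y ≤ x := h
    rw [← not_le, h', not_le]

theorem exists_sameType_of_order (hK : FinitelyBoundedBy K b)
    (hlim : IsFraisseLimit (orderedClass K) H) {U L : Type*} [Finite U] [LinearOrder L]
    (f : U → H) (c : U → L) (hc : ∀ x y, f x = f y ↔ c x = c y) :
    ∃ g : U → H, SameType ℓ g f ∧ ∀ x y, g x < g y ↔ c x < c y := by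
  have hT : ∀ x : Set.range f, ∃ y, f y = x.1 := fun x => x.2
  choose k hk using hT
  have hck : ∀ x, c (k ⟨f x, x, rfl⟩) = c x := fun x => (hc _ _).1 (hk _)
  -- The order is pulled back along `c` to the range of `f`, on which `c` is injective. The range
  -- replaces `U` because it lies in the universe of `H` and its inclusion is injective.
  obtain ⟨e, he, hmono⟩ := @exists_sameType_ordered ℓ K b H _ _ _ hK hlim (Set.range f) _
    (LinearOrder.lift' (fun x => c (k x)) (fun x y hxy => Subtype.ext (by
      rw [← hk x, ← hk y]; exact (hc _ _).2 hxy))) Subtype.val Subtype.val_injective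
  refine ⟨fun x => e ⟨f x, x, rfl⟩, ?_, fun x y => ?_⟩
  · have := he.comp fun x => (⟨f x, x, rfl⟩ : Set.range f)
    exact this
  · rw [← hck x, ← hck y]
    exact hmono ⟨f x, x, rfl⟩ ⟨f y, y, rfl⟩

/-- Homogeneity of the hypergraph without the order, by a back-and-forth argument. -/
theorem isUltrahomogeneous_limit (hK : FinitelyBoundedBy K b)
    (hlim : IsFraisseLimit (orderedClass K) H) : (hyperLang ℓ).IsUltrahomogeneous H := by
  rw [isUltrahomogeneous_iff_IsExtensionPair (Structure.cg_of_countable),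
    isExtensionPair_iff_exists_embedding_closure_singleton_sup]
  intro S hS f a
  have hfin : Finite S := hS.finite
  by_cases ha : a ∈ S
  · have hle : Substructure.closure (hyperLang ℓ) {a} ⊔ S ≤ S :=
      sup_le (Substructure.closure_le.2 (by simpa using ha)) le_rfl
    exact ⟨f.comp (Substructure.inclusion hle), by ext; rfl⟩
  -- A copy of `S ∪ {a}` in which `S` is ordered as its image under `f` and `a` is put on top. The
  -- restriction of this copy to `S` agrees with `f` in type and order, so homogeneity of the
  -- ordered structure moves the copy onto an extension of `f`.
  obtain ⟨g, hg, hglt⟩ := exists_sameType_of_order hK hlim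
    (fun x : Option S => x.elim a Subtype.val)
    (fun x : Option S => (x.elim ⊤ (fun s => (f s : H)) : WithTop H)) (by
      rintro (_ | x) (_ | y)
      · simp
      · simp only [Option.elim]
        exact iff_of_false (fun h => ha (h ▸ y.2)) (by simp)
      · simp only [Option.elim]
        exact iff_of_false (fun h => ha (h ▸ x.2)) (by simp)
      · simp only [Option.elim, WithTop.coe_inj]
        rw [f.injective.eq_iff, Subtype.ext_iff])
  have hfS : SameType ℓ (fun x : S => g (some x)) f := by
    have h1 := hg.comp (fun x : S => some x)
    refine h1.trans ⟨fun x y => ?_, fun t => ?_⟩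
    · rw [f.injective.eq_iff, Subtype.ext_iff]
      rfl
    · exact (f.map_rel HyperRel.edge t).symm
  obtain ⟨β, hβ⟩ := exists_ordEquiv_of_sameType hlim (fun x : S => g (some x)) f hfS
    (fun x y => by rw [hglt]; simp)
  have hmem : ∀ x : (Substructure.closure (hyperLang ℓ) {a} ⊔ S : (hyperLang ℓ).Substructure H),
      x.1 ∈ S ∨ x.1 = a := by
    have : Substructure.closure (hyperLang ℓ) {a} ⊔ S
        ≤ Substructure.closure (hyperLang ℓ) ({a} ∪ S) := by
      rw [Substructure.closure_union, Substructure.closure_eq]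
    intro x
    have hx := (Substructure.mem_closure_iff_of_isRelational (hyperLang ℓ) _ _).1 (this x.2)
    rcases hx with hx | hx
    · exact Or.inr hx
    · exact Or.inl hx
  have hlift : ∀ x : (Substructure.closure (hyperLang ℓ) {a} ⊔ S : (hyperLang ℓ).Substructure H),
      ∃ o : Option S, o.elim a Subtype.val = x.1 := by
    intro x
    rcases hmem x with hx | hx
    · exact ⟨some ⟨_, hx⟩, rfl⟩
    · exact ⟨none, hx.symm⟩
  choose o ho using hlift
  have hty : SameType ℓ (fun x => β (g (o x))) (fun x => x.1) := by
    have h1 := (sameType_equiv (ordEquivReduct β) (fun x => g (o x))).trans (hg.comp o)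
    have h2 : (fun x : Option S => x.elim a Subtype.val) ∘ o = fun x => x.1 := funext ho
    rwa [h2] at h1
  refine ⟨⟨⟨fun x => β (g (o x)), fun x y hxy => Subtype.ext ((hty.1 x y).1 hxy)⟩,
    fun {_} f => isEmptyElim f, ?_⟩, ?_⟩
  · intro n r x
    cases r
    exact hty.2 x
  · ext x
    change f x = β (g (o _))
    rw [hβ x]
    refine congrArg β ((hg.1 (some x) _).2 ?_)
    exact (ho (Substructure.inclusion le_sup_right x)).symm

theorem exists_equiv_of_sameType (hK : FinitelyBoundedBy K b)
    (hlim : IsFraisseLimit (orderedClass K) H) {U : Type*}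
    [Finite U] (f g : U → H) (h : SameType ℓ f g) :
    ∃ α : H ≃[hyperLang ℓ] H, ∀ x, g x = α (f x) := by
  let S : (hyperLang ℓ).Substructure H := Substructure.closure (hyperLang ℓ) (Set.range f)
  have hS : ∀ x : S, ∃ y, f y = x := fun x =>
    (Substructure.mem_closure_iff_of_isRelational (hyperLang ℓ) (Set.range f) x.1).1 x.2
  choose k hk using hS
  let emb : S ↪[hyperLang ℓ] H :=
    { toFun := fun x => g (k x)
      inj' := fun x y hxy => Subtype.ext (by rw [← hk x, ← hk y]; exact (h.1 _ _).2 hxy)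
      map_fun' := fun {_} f => isEmptyElim f
      map_rel' := by
        intro n r x
        cases r
        have := (h.2 (k ∘ x)).symm
        have h2 : f ∘ (k ∘ x) = Subtype.val ∘ x := funext fun i => hk (x i)
        rw [h2] at this
        exact this }
  obtain ⟨α, hα⟩ := isUltrahomogeneous_limit hK hlim S
    (Substructure.fg_closure (Set.finite_range f)) emb
  refine ⟨α, fun x => ?_⟩
  have hx : f x ∈ S := Substructure.subset_closure ⟨x, rfl⟩
  have h1 : emb ⟨f x, hx⟩ = α (f x) := by rw [hα]; rfl
  rw [← h1]
  exact (h.1 _ _).1 (hk ⟨f x, hx⟩).symm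

/-- Every finite family of elements can be reordered arbitrarily by an automorphism of the
hypergraph. -/
theorem exists_equiv_order (hK : FinitelyBoundedBy K b)
    (hlim : IsFraisseLimit (orderedClass K) H) {U L : Type*} [Finite U] [LinearOrder L]
    (f : U → H) (c : U → L) (hc : ∀ x y, f x = f y ↔ c x = c y) :
    ∃ α : H ≃[hyperLang ℓ] H, ∀ x y, α (f x) < α (f y) ↔ c x < c y := by
  obtain ⟨g, hg, hlt⟩ := exists_sameType_of_order hK hlim f c hc
  obtain ⟨α, hα⟩ := exists_equiv_of_sameType hK hlim f g hg.symm
  exact ⟨α, fun x y => by rw [← hα, ← hα, hlt]⟩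

theorem mem_orb_iff (hK : FinitelyBoundedBy K b) (hlim : IsFraisseLimit (orderedClass K) H)
    {k : ℕ} (x y : Fin k → H) : y ∈ orb ℓ x ↔ SameType ℓ x y := by
  refine ⟨?_, fun h => exists_equiv_of_sameType hK hlim x y h⟩
  rintro ⟨α, hα⟩
  rw [show y = fun i => α (x i) from funext hα]
  exact (sameType_equiv α x).symm

theorem edgeSet_comp_iff_false {X : Type*} [(hyperLang ℓ).Structure X] (hH : IsHypergraph ℓ X)
    {x : Fin ℓ → X} (hx : ¬ Function.Injective x) (t : Fin ℓ → Fin ℓ) : x ∘ t ∉ edgeSet ℓ X := by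
  intro h
  have h1 := hH.1 _ h
  have ht : Function.Bijective t := Finite.injective_iff_bijective.1 h1.of_comp
  have := h1.comp (Equiv.ofBijective t ht).symm.injective
  have h2 : (x ∘ t) ∘ (Equiv.ofBijective t ht).symm = x := by
    ext i
    simp [Function.comp_def, Equiv.ofBijective_apply_symm_apply]
  exact hx (h2 ▸ this)

/-- An edge `x ∘ t` forces `t` to be a permutation and `x` to be injective. So no edge can be formed
from the entries of a non-injective `ℓ`-tuple, and only its kernel remains. -/
theorem sameType_of_not_injective {X : Type*} [(hyperLang ℓ).Structure X] (hH : IsHypergraph ℓ X)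
    {x y : Fin ℓ → X} (hx : ¬ Function.Injective x) (h : ∀ i j, x i = x j ↔ y i = y j) :
    SameType ℓ x y := by
  refine ⟨h, fun t => iff_of_false (edgeSet_comp_iff_false hH hx t)
    (edgeSet_comp_iff_false hH (fun hy => hx fun i j hij => hy ((h i j).1 hij)) t)⟩

/-- Only permutations `t` can make `x ∘ t` an edge, and full symmetry then reduces the question to
`x` itself. -/
theorem sameType_of_injective {X : Type*} [(hyperLang ℓ).Structure X] (hH : IsHypergraph ℓ X)
    {x y : Fin ℓ → X} (hx : Function.Injective x) (hy : Function.Injective y)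
    (h : x ∈ edgeSet ℓ X ↔ y ∈ edgeSet ℓ X) : SameType ℓ x y := by
  refine ⟨fun i j => by rw [hx.eq_iff, hy.eq_iff], fun t => ?_⟩
  have key : ∀ z : Fin ℓ → X, z ∘ t ∈ edgeSet ℓ X → Function.Bijective t := fun z hz =>
    Finite.injective_iff_bijective.1 (hH.1 _ hz).of_comp
  have key2 : ∀ z : Fin ℓ → X, Function.Bijective t → (z ∘ t ∈ edgeSet ℓ X ↔ z ∈ edgeSet ℓ X) := by
    intro z ht
    refine ⟨fun hz => ?_, fun hz => hH.2 z hz (Equiv.ofBijective t ht)⟩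
    have := hH.2 _ hz (Equiv.ofBijective t ht).symm
    convert this using 1
    ext i
    simp [Function.comp_def, Equiv.ofBijective_apply_symm_apply]
  constructor
  · intro hz
    exact (key2 y (key x hz)).2 (h.1 ((key2 x (key x hz)).1 hz))
  · intro hz
    exact (key2 x (key y hz)).2 (h.2 ((key2 y (key y hz)).1 hz))

end Hypergraph

/-! ### Orbits under the two automorphism groups, and kernels. -/

theorem orbLT_eq_of_sameType {ℓ : ℕ} {K : Set (Bundled.{u} (hyperLang ℓ).Structure)}
    {H : Type u} [Countable H] [(hyperLang ℓ).Structure H] [LinearOrder H]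
    (hlim : FirstOrder.Language.IsFraisseLimit (orderedClass K) H) {k : ℕ} {x y : Fin k → H}
    (h : SameType ℓ x y) (hlt : ∀ i j, x i < x j ↔ y i < y j) : orbLT ℓ x = orbLT ℓ y := by
  have key : ∀ {x y : Fin k → H}, SameType ℓ x y → (∀ i j, x i < x j ↔ y i < y j) →
      orbLT ℓ x ⊆ orbLT ℓ y := by
    rintro x y h hlt z ⟨β, hβ⟩
    obtain ⟨α, hα⟩ := exists_ordEquiv_of_sameType hlim y x h.symm fun i j => (hlt i j).symm
    exact ⟨β.comp α, fun i => by rw [hβ, hα]; rfl⟩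
  exact (key h hlt).antisymm (key h.symm fun i j => (hlt i j).symm)

theorem mem_orbLT_self {ℓ : ℕ} {H : Type*} [(hyperLang ℓ).Structure H] [LinearOrder H] {k : ℕ}
    (x : Fin k → H) : x ∈ orbLT ℓ x :=
  ⟨FirstOrder.Language.Equiv.refl _ _, fun _ => rfl⟩

theorem mem_orb_self {ℓ : ℕ} {H : Type*} [(hyperLang ℓ).Structure H] {k : ℕ}
    (x : Fin k → H) : x ∈ orb ℓ x :=
  ⟨FirstOrder.Language.Equiv.refl _ _, fun _ => rfl⟩

theorem sameType_of_orbLT_eq {ℓ : ℕ} {H : Type*} [(hyperLang ℓ).Structure H] [LinearOrder H]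
    {k : ℕ} {x y : Fin k → H} (h : orbLT ℓ x = orbLT ℓ y) :
    SameType ℓ x y ∧ ∀ i j, x i < x j ↔ y i < y j := by
  have hx : x ∈ orbLT ℓ y := h ▸ mem_orbLT_self x
  obtain ⟨α, hα⟩ := hx
  rw [show x = fun i => α (y i) from funext hα]
  exact ⟨sameType_equiv (ordEquivReduct α) y, fun i j => ordEquiv_lt_iff α _ _⟩

/-- A finite family of elements can be mapped to any other with the same kernel by a
permutation. -/
theorem exists_perm_of_kernel {U H : Type*} [Finite U] (f g : U → H)
    (h : ∀ x y, f x = f y ↔ g x = g y) : ∃ σ : Equiv.Perm H, ∀ x, g x = σ (f x) := by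
  classical
  obtain ⟨n, ⟨e⟩⟩ := Finite.exists_equiv_fin (Set.range f)
  have hf : ∀ z : Set.range f, ∃ x, f x = z := fun z => z.2
  choose k hk using hf
  let x : Fin n ↪ H := ⟨fun i => (e.symm i).1, fun i j hij => e.symm.injective (Subtype.ext hij)⟩
  let y : Fin n ↪ H := ⟨fun i => g (k (e.symm i)), fun i j hij => e.symm.injective (Subtype.ext (by
    rw [← hk, ← hk (e.symm j)]; exact (h _ _).2 hij))⟩
  obtain ⟨σ, hσ⟩ := (Equiv.Perm.isMultiplyPretransitive H n).exists_smul_eq x y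
  refine ⟨σ, fun z => ?_⟩
  have h2 : σ (f z) = g (k ⟨f z, z, rfl⟩) := by
    have h3 : ∀ z : Set.range f, σ (e.symm (e z)).1 = g (k (e.symm (e z))) := fun z =>
      DFunLike.congr_fun hσ (e z)
    simpa using h3 ⟨f z, z, rfl⟩
  rw [h2]
  exact (h _ _).1 (hk ⟨f z, z, rfl⟩).symm

/-! ## Invariant relations -/

/-- The operation `q` preserves the set `R` of maps. -/
def PresBy {X H : Type*} {n : ℕ} (q : Op H n) (R : Set (X → H)) : Prop :=
  ∀ a : Fin n → X → H, (∀ i, a i ∈ R) → (fun x => q fun i => a i x) ∈ R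

/-- The automorphisms of the hypergraph, as unary operations, and the operations `m` and `p`. -/
inductive IsBasicOp (ℓ : ℕ) {H : Type*} [(hyperLang ℓ).Structure H] (m : Op H 3) (p : Op H 2) :
    ∀ n : ℕ, Op H n → Prop
  | aut (α : H ≃[hyperLang ℓ] H) : IsBasicOp ℓ m p 1 fun x => α (x 0)
  | tern : IsBasicOp ℓ m p 3 m
  | bin : IsBasicOp ℓ m p 2 p

/-- Invariance under automorphisms of the hypergraph and under the operations `m` and `p`. -/
def Invariant (ℓ : ℕ) {X H : Type*} [(hyperLang ℓ).Structure H] (m : Op H 3) (p : Op H 2)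
    (R : Set (X → H)) : Prop :=
  ∀ n q, IsBasicOp ℓ m p n q → PresBy q R

section Invariant

variable {ℓ : ℕ} {X H : Type*} [(hyperLang ℓ).Structure H] {m : Op H 3} {p : Op H 2}

theorem Invariant.aut {R : Set (X → H)} (h : Invariant ℓ m p R) (α : H ≃[hyperLang ℓ] H)
    {f : X → H} (hf : f ∈ R) : (fun x => α (f x)) ∈ R :=
  h 1 _ (.aut α) (fun _ => f) fun _ => hf

theorem Invariant.bin {R : Set (X → H)} (h : Invariant ℓ m p R)
    {f g : X → H} (hf : f ∈ R) (hg : g ∈ R) : (fun x => p ![f x, g x]) ∈ R := by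
  have := h 2 _ .bin ![f, g] (by intro i; fin_cases i <;> assumption)
  convert this using 3
  ext i; fin_cases i <;> rfl

theorem Invariant.orb_subset {k : ℕ} {R : Set (Fin k → H)} (h : Invariant ℓ m p R)
    {a : Fin k → H} (ha : a ∈ R) : orb ℓ a ⊆ R := by
  rintro b ⟨α, hα⟩
  rw [show b = fun i => α (a i) from funext hα]
  exact h.aut α ha

theorem invariant_univ : Invariant ℓ m p (Set.univ : Set (X → H)) := fun _ _ _ _ _ => trivial

theorem Invariant.inter {R S : Set (X → H)} (hR : Invariant ℓ m p R) (hS : Invariant ℓ m p S) :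
    Invariant ℓ m p (R ∩ S) :=
  fun n q hq a ha => ⟨hR n q hq a fun i => (ha i).1, hS n q hq a fun i => (ha i).2⟩

theorem Invariant.proj {C : Constraint X H} (h : Invariant ℓ m p C.rel) {k : ℕ} (v : Fin k → X) :
    Invariant ℓ m p (C.proj v) := by
  intro n q hq a ha
  choose f hf hv hfv using ha
  by_cases hv' : ∀ i, v i ∈ C.scope
  · exact ⟨_, h n q hq f hf, hv', fun i => congrArg q (funext fun j => hfv j i)⟩
  -- If the tuple leaves the scope, the projection is empty; as basic operations have positive
  -- arity, some argument would lie in it.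
  · cases hq with
    | aut α => exact absurd (hv 0) hv'
    | tern => exact absurd (hv 0) hv'
    | bin => exact absurd (hv 0) hv'

theorem IsBasicOp.injective (hm : Function.Injective m) (hp : Function.Injective p) {n : ℕ}
    {q : Op H n} (hq : IsBasicOp ℓ m p n q) : Function.Injective q := by
  cases hq with
  | aut α => exact fun x y h => funext fun i => by rw [Subsingleton.elim i 0]; exact α.injective h
  | tern => exact hm
  | bin => exact hp

theorem IsBasicOp.pos {n : ℕ} {q : Op H n} (hq : IsBasicOp ℓ m p n q) : 0 < n := by
  cases hq <;> simp

end Invariant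

/-! ## Minimality -/

namespace CSPInst

section General

variable {X B : Type*} {I J : CSPInst X B}

theorem ext' (h1 : I.vars = J.vars) (h2 : I.cons = J.cons) : I = J := by
  cases I; cases J; cases h1; cases h2; rfl

theorem mem_proj {k : ℕ} {v : Fin k → X} {a : Fin k → B} :
    a ∈ I.proj v ↔ ∃ C ∈ I.cons, a ∈ C.proj v := by
  simp [proj]

/-- Every non-empty set of at most `n` variables is contained in a scope. -/
def Covers (I : CSPInst X B) (n : ℕ) : Prop :=
  ∀ L ⊆ I.vars, L.Nonempty → L.encard ≤ n → ∃ C ∈ I.cons, L ⊆ C.scope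

theorem Covers.tuple {n : ℕ} (h : I.Covers n) {k : ℕ} (hk : 0 < k) (hkn : k ≤ n)
    (v : Fin k → X) (hv : ∀ i, v i ∈ I.vars) : ∃ C ∈ I.cons, ∀ i, v i ∈ C.scope := by
  obtain ⟨C, hC, hvC⟩ := h (Set.range v) (by rintro _ ⟨i, rfl⟩; exact hv i) ⟨v ⟨0, hk⟩, _, rfl⟩ (by
    rw [← Set.image_univ]
    refine (Set.encard_image_le _ _).trans ?_
    rw [Set.encard_univ, ENat.card_eq_coe_fintype_card, Fintype.card_fin]
    exact_mod_cast hkn)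
  exact ⟨C, hC, fun i => hvC ⟨i, rfl⟩⟩

theorem Minimal.proj_eq {m n : ℕ} (h : I.Minimal m n) {k : ℕ} (hk : k ≤ m) {v : Fin k → X}
    {C : Constraint X B} (hC : C ∈ I.cons) (hv : ∀ i, v i ∈ C.scope) : I.proj v = C.proj v := by
  ext a
  rw [mem_proj]
  refine ⟨?_, fun ha => ⟨C, hC, ha⟩⟩
  rintro ⟨D, hD, ha⟩
  obtain ⟨f, hf, hvD, -⟩ := id ha
  rwa [h.2 k hk v C hC D hD hv hvD]

theorem Minimal.mono {m n m' n' : ℕ} (h : I.Minimal m n) (hm : m' ≤ m) (hn : n' ≤ n) :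
    I.Minimal m' n' :=
  ⟨fun L hL hne hc => h.1 L hL hne (hc.trans (by exact_mod_cast hn)),
    fun k hk => h.2 k (hk.trans hm)⟩

theorem cons_complete (n : ℕ) (h : I.Covers n) : (I.complete n).cons = I.cons := by
  refine Set.union_eq_left.2 ?_
  rintro C ⟨h1, h2, h3, h4, -⟩
  exact absurd (h _ h1 h2 h3) h4

theorem covers_complete (I : CSPInst X B) (n : ℕ) : (I.complete n).Covers n := by
  intro L hL hne hn
  by_cases h : ∃ D ∈ I.cons, L ⊆ D.scope
  · obtain ⟨D, hD, h⟩ := h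
    exact ⟨D, Or.inl hD, h⟩
  · exact ⟨⟨L, Set.univ⟩, Or.inr ⟨hL, hne, hn, h, rfl⟩, subset_rfl⟩

/-- The largest consistent family of subsets of the constraints. -/
def maxFam (I : CSPInst X B) (m : ℕ) (C : Constraint X B) : Set (C.scope → B) :=
  {f | ∃ D, I.Consistent m D ∧ f ∈ D C}

/-- Unions of consistent families are consistent, so a largest one exists. -/
theorem consistent_maxFam (I : CSPInst X B) (m : ℕ) : I.Consistent m (I.maxFam m) := by
  refine ⟨fun C hC f ⟨D, hD, hf⟩ => hD.1 C hC hf, ?_⟩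
  have key : ∀ k ≤ m, ∀ v : Fin k → X, ∀ C₁ ∈ I.cons, ∀ C₂ ∈ I.cons,
    (∀ i, v i ∈ C₁.scope) → (∀ i, v i ∈ C₂.scope) →
      Constraint.proj ⟨C₁.scope, I.maxFam m C₁⟩ v ⊆
        Constraint.proj ⟨C₂.scope, I.maxFam m C₂⟩ v := by
    rintro k hk v C hC C' hC' hv hv' a ⟨f, ⟨D, hD, hf⟩, h⟩
    have : a ∈ Constraint.proj ⟨C.scope, D C⟩ v := ⟨f, hf, h⟩
    rw [hD.2 k hk v C hC C' hC' hv hv'] at this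
    obtain ⟨g, hg, h'⟩ := this
    exact ⟨g, ⟨D, hD, hg⟩, h'⟩
  exact fun k hk v C hC C' hC' hv hv' =>
    (key k hk v C hC C' hC' hv hv').antisymm (key k hk v C' hC' C hC hv' hv)

theorem cons_minimalize (I : CSPInst X B) (m n : ℕ) : (I.minimalize m n).cons =
    (fun C => ⟨C.scope, (I.complete n).maxFam m C⟩) '' (I.complete n).cons := rfl

theorem minimal_minimalize (I : CSPInst X B) (m n : ℕ) : (I.minimalize m n).Minimal m n := by
  refine ⟨fun L hL hne hn => ?_, ?_⟩
  · obtain ⟨C, hC, h⟩ := I.covers_complete n L hL hne hn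
    exact ⟨_, ⟨C, hC, rfl⟩, h⟩
  · rintro k hk v _ ⟨C, hC, rfl⟩ _ ⟨D, hD, rfl⟩ hv hv'
    exact ((I.complete n).consistent_maxFam m).2 k hk v C hC D hD hv hv'

theorem IsSolution.minimalize {s : I.vars → B} (hs : I.IsSolution s) (m n : ℕ) :
    (I.minimalize m n).IsSolution s := by
  rintro _ ⟨C, hC, rfl⟩
  have hs' : (I.complete n).IsSolution s := by
    rintro C (hC | hC)
    · exact hs C hC
    · rw [hC.2.2.2.2]; trivial
  -- The restrictions of `s`, one for each constraint, form a consistent family of singletons, hence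
  -- survive in the largest one.
  refine ⟨fun C => {f | ∃ h : C.scope ⊆ I.vars, f = fun x : C.scope => s ⟨x.1, h x.2⟩},
    ⟨?_, ?_⟩, (I.complete n).scope_subset C hC, rfl⟩
  · rintro D hD _ ⟨h, rfl⟩
    exact hs' D hD
  · have key : ∀ {k : ℕ} (v : Fin k → X) (C : Constraint X B), C ∈ (I.complete n).cons →
        (∀ i, v i ∈ C.scope) → Constraint.proj ⟨C.scope,
          {f | ∃ h : C.scope ⊆ I.vars, f = fun x : C.scope => s ⟨x.1, h x.2⟩}⟩ v =
          {a | ∃ h : ∀ i, v i ∈ I.vars, ∀ i, a i = s ⟨v i, h i⟩} := by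
      intro k v C hC hv
      ext a
      constructor
      · rintro ⟨_, ⟨h, rfl⟩, hv, ha⟩
        exact ⟨fun i => h (hv i), ha⟩
      · rintro ⟨h, ha⟩
        exact ⟨_, ⟨(I.complete n).scope_subset C hC, rfl⟩, hv, ha⟩
    intro k hk v C₁ h1 C₂ h2 hv1 hv2
    rw [key v C₁ h1 hv1, key v C₂ h2 hv2]

theorem hasSolution_of_minimalize {m n : ℕ} (h : (I.minimalize m n).HasSolution) :
    I.HasSolution := by
  obtain ⟨s, hs⟩ := h
  refine ⟨s, fun C hC => ?_⟩
  exact ((I.complete n).consistent_maxFam m).1 C (Or.inl hC) (hs _ ⟨C, Or.inl hC, rfl⟩)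

end General

end CSPInst

/-! ## Shrinking the constraints of an instance -/

/-- `C` arises from `D` by removing maps. -/
def Constraint.Le {X B : Type*} (C D : Constraint X B) : Prop := ∃ R ⊆ D.rel, C = ⟨D.scope, R⟩

namespace Constraint

variable {X B : Type*} {C D E : Constraint X B}

theorem Le.refl (C : Constraint X B) : C.Le C := ⟨C.rel, subset_rfl, rfl⟩

theorem Le.trans (h : C.Le D) (h' : D.Le E) : C.Le E := by
  obtain ⟨R, hR, rfl⟩ := h
  obtain ⟨R', hR', rfl⟩ := h'
  exact ⟨R, hR.trans hR', rfl⟩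

theorem Le.antisymm (h : C.Le D) (h' : D.Le C) : C = D := by
  obtain ⟨R, hR, rfl⟩ := h
  obtain ⟨R', hR', h⟩ := h'
  cases D
  simp only [Constraint.mk.injEq, heq_eq_eq, true_and] at h
  subst h
  rw [hR.antisymm hR']

end Constraint

namespace CSPInst

variable {X B : Type*} {I J K : CSPInst X B}

/-- `J` arises from `I` by removing maps from constraints. -/
def Shrinks (I J : CSPInst X B) : Prop :=
  J.vars = I.vars ∧ ∃ φ : Constraint X B → Constraint X B, (∀ C ∈ I.cons, (φ C).Le C) ∧
    J.cons = φ '' I.cons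

theorem Shrinks.refl (I : CSPInst X B) : I.Shrinks I :=
  ⟨rfl, id, fun C _ => .refl C, by simp⟩

theorem Shrinks.trans (h : I.Shrinks J) (h' : J.Shrinks K) : I.Shrinks K := by
  obtain ⟨h1, φ, h2, h3⟩ := h
  obtain ⟨h1', φ', h2', h3'⟩ := h'
  refine ⟨h1'.trans h1, φ' ∘ φ, fun C hC => (h2' _ (h3 ▸ ⟨C, hC, rfl⟩)).trans (h2 C hC), ?_⟩
  rw [h3', h3, Set.image_comp]

/-- Since constraints form a set, a shrinking may merge some of them or turn one into another. A
shrinking map of a finite set onto itself is a permutation, so some iterate returns to `C`, which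
squeezes `φ C` between `C` and `C`. -/
theorem Shrinks.eq_of_eq (hfin : I.cons.Finite) {φ : Constraint X B → Constraint X B}
    (h : ∀ C ∈ I.cons, (φ C).Le C) (h' : I.cons = φ '' I.cons) : ∀ C ∈ I.cons, φ C = C := by
  have hmaps : Set.MapsTo φ I.cons I.cons := fun C hC => h' ▸ ⟨C, hC, rfl⟩
  have hinj : Set.InjOn φ I.cons := by
    refine Set.injOn_of_ncard_image_eq ?_ hfin
    rw [← h']
  have hiter : ∀ n : ℕ, ∀ C ∈ I.cons, φ^[n] C ∈ I.cons ∧ (φ^[n] C).Le C := by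
    intro n
    induction n with
    | zero => exact fun C hC => ⟨hC, .refl C⟩
    | succ n ih =>
      intro C hC
      rw [Function.iterate_succ_apply']
      exact ⟨hmaps (ih C hC).1, (h _ (ih C hC).1).trans (ih C hC).2⟩
  intro C hC
  have := hfin.to_subtype
  let ψ : I.cons → I.cons := fun D => ⟨φ D.1, hmaps D.2⟩
  have hψ : Function.Injective ψ := fun D E hDE =>
    Subtype.ext (hinj D.2 E.2 (congrArg Subtype.val hDE))
  obtain ⟨n, hn, hψn⟩ := Function.Injective.mem_periodicPts hψ ⟨C, hC⟩
  have h1 : φ^[n] C = C := by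
    have h2 : ∀ k, (ψ^[k] ⟨C, hC⟩ : I.cons).1 = φ^[k] C := by
      intro k
      induction k with
      | zero => rfl
      | succ k ih => rw [Function.iterate_succ_apply', Function.iterate_succ_apply', ← ih]
    rw [← h2 n, hψn.eq]
  refine (h C hC).antisymm ?_
  obtain ⟨k, rfl⟩ : ∃ k, n = k + 1 := ⟨n - 1, by omega⟩
  rw [Function.iterate_succ_apply] at h1
  have := (hiter k (φ C) (hmaps hC)).2
  rwa [h1] at this

/-- Makes shrinking a partial order on finite instances; this is what turns every change made by the
algorithm into progress. -/
theorem Shrinks.antisymm (hfin : I.cons.Finite) (h : I.Shrinks J) (h' : J.Shrinks I) : I = J := by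
  obtain ⟨h1, φ, h2, h3⟩ := h
  obtain ⟨-, φ', h2', h3'⟩ := h'
  refine ext' h1.symm ?_
  have hcomp : ∀ C ∈ I.cons, φ' (φ C) = C := by
    refine Shrinks.eq_of_eq (φ := φ' ∘ φ) hfin (fun C hC =>
      (h2' _ (h3 ▸ ⟨C, hC, rfl⟩)).trans (h2 C hC)) ?_
    rw [Set.image_comp, ← h3, ← h3']
  have hid : ∀ C ∈ I.cons, φ C = C := fun C hC => (h2 C hC).antisymm (by
    have := h2' _ (h3 ▸ ⟨C, hC, rfl⟩ : φ C ∈ J.cons)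
    rwa [hcomp C hC] at this)
  rw [h3]
  ext C
  constructor
  · exact fun hC => ⟨C, hC, hid C hC⟩
  · rintro ⟨D, hD, rfl⟩
    rwa [hid D hD]

theorem Shrinks.covers (h : I.Shrinks J) {n : ℕ} (hI : I.Covers n) : J.Covers n := by
  obtain ⟨h1, φ, h2, h3⟩ := h
  intro L hL hne hn
  obtain ⟨C, hC, hLC⟩ := hI L (h1 ▸ hL) hne hn
  obtain ⟨R, -, hR⟩ := h2 C hC
  exact ⟨φ C, h3 ▸ ⟨C, hC, rfl⟩, by rw [hR]; exact hLC⟩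

theorem Shrinks.hasSolution (h : I.Shrinks J) (hJ : J.HasSolution) : I.HasSolution := by
  obtain ⟨vars, cons, hsc⟩ := J
  obtain ⟨rfl, φ, h2, h3⟩ := h
  obtain ⟨s, hs⟩ := hJ
  refine ⟨s, fun C hC => ?_⟩
  obtain ⟨R, hR, hφ⟩ := h2 C hC
  have hmem : (⟨C.scope, R⟩ : Constraint X B) ∈ cons := by
    change cons = φ '' I.cons at h3
    rw [h3, ← hφ]
    exact ⟨C, hC, rfl⟩
  exact hR (hs _ hmem)

theorem shrinks_restrictTuple (I : CSPInst X B) {k : ℕ} (v : Fin k → X) (R : Set (Fin k → B)) :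
    I.Shrinks (I.restrictTuple v R) :=
  ⟨rfl, _, fun _ _ => ⟨_, fun _ hg => hg.1, rfl⟩, rfl⟩

theorem shrinks_minimalize {m n : ℕ} (h : I.Covers n) : I.Shrinks (I.minimalize m n) := by
  refine ⟨rfl, fun C => ⟨C.scope, (I.complete n).maxFam m C⟩, fun C hC => ⟨_, ?_, rfl⟩, ?_⟩
  · exact ((I.complete n).consistent_maxFam m).1 C (Or.inl hC)
  · rw [cons_minimalize, cons_complete n h]

end CSPInst

/-- The properties of the template that the algorithm relies on: all relations are invariant, all
invariant `ℓ`-ary relations belong to the template, and passing to the equivalent minimal instance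
does not leave its CSP. -/
structure IsTemplate (ℓ : ℕ) (V : Type*) {H : Type*} [(hyperLang ℓ).Structure H]
    (LA : FirstOrder.Language) [LA.Structure H] (m : Op H 3) (p : Op H 2) (N : ℕ) : Prop where
  three_le : 3 ≤ ℓ
  le_cover : 3 * ℓ ≤ N
  invariant : ∀ (k : ℕ) (r : LA.Relations k),
    Invariant ℓ m p {x : Fin k → H | FirstOrder.Language.Structure.RelMap r x}
  exists_rel : ∀ R : Set (Fin ℓ → H), Invariant ℓ m p R →
    ∃ r : LA.Relations ℓ, {x | FirstOrder.Language.Structure.RelMap r x} = R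
  minimalize : ∀ I : CSPInst V H, I.IsInstanceOf LA → (I.minimalize (2 * ℓ) N).IsInstanceOf LA

theorem relMap_equiv_of_isFOReduct {ℓ : ℕ} {H : Type*} [(hyperLang ℓ).Structure H]
    {LA : FirstOrder.Language} [LA.Structure H] (hred : IsFOReduct ℓ H LA)
    (α : H ≃[hyperLang ℓ] H) {k : ℕ} (r : LA.Relations k) (x : Fin k → H) :
    FirstOrder.Language.Structure.RelMap r (fun i => α (x i)) ↔
      FirstOrder.Language.Structure.RelMap r x := by
  obtain ⟨φ, hφ⟩ := Set.empty_definable_iff.1 (hred k r)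
  have h : ∀ y, FirstOrder.Language.Structure.RelMap r y ↔ φ.Realize y := fun y => by
    change y ∈ {x : Fin k → H | FirstOrder.Language.Structure.RelMap r x} ↔ _
    rw [hφ]; rfl
  rw [h, h]
  exact FirstOrder.Language.StrongHomClass.realize_formula α φ

theorem isTemplate {ℓ : ℕ} (hℓ : 3 ≤ ℓ) {H V : Type*} [(hyperLang ℓ).Structure H]
    {LA : FirstOrder.Language} [LA.Structure H] (hred : IsFOReduct ℓ H LA)
    {m : Op H 3} (hmpol : m.IsPolymorphism LA) {p : Op H 2} (hppol : p.IsPolymorphism LA)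
    (horb : ∀ R : Set (Fin ℓ → H), (∀ a ∈ R, orb ℓ a ⊆ R) → m.Preserves R → p.Preserves R →
      ∃ r : LA.Relations ℓ, {x | FirstOrder.Language.Structure.RelMap r x} = R) {N : ℕ}
    (hN : 3 * ℓ ≤ N)
    (hmin : ∀ I : CSPInst V H, I.IsInstanceOf LA → (I.minimalize (2 * ℓ) N).IsInstanceOf LA) :
    IsTemplate ℓ V LA m p N where
  three_le := hℓ
  le_cover := hN
  invariant k r := by
    intro n q hq
    cases hq with
    | aut α => exact fun a ha => (relMap_equiv_of_isFOReduct hred α r (a 0)).2 (ha 0)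
    | tern => exact hmpol k r
    | bin => exact hppol k r
  exists_rel R hR := horb R (fun a ha => hR.orb_subset ha) (hR 3 m .tern) (hR 2 p .bin)
  minimalize := hmin

/-- A constraint given by a relation of the template. -/
def Constraint.IsOf {X B : Type*} (C : Constraint X B) (LA : FirstOrder.Language) [LA.Structure B] :
    Prop :=
  C.scope.Nonempty ∧ ∃ (k : ℕ) (r : LA.Relations k) (u : Fin k → C.scope), Function.Surjective u ∧
    ∀ f : C.scope → B, f ∈ C.rel ↔ FirstOrder.Language.Structure.RelMap r (f ∘ u)

theorem Constraint.mk_congr {X B : Type*} {S : Set X} {R R' : Set (S → B)} (h : R = R') :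
    (⟨S, R⟩ : Constraint X B) = ⟨S, R'⟩ := by rw [h]

/-- Finitely many variables, and invariant constraints with non-empty scopes. -/
def CSPInst.Tame (ℓ : ℕ) {V H : Type*} [(hyperLang ℓ).Structure H] (m : Op H 3) (p : Op H 2)
    (I : CSPInst V H) : Prop :=
  I.vars.Finite ∧ ∀ C ∈ I.cons, C.scope.Nonempty ∧ Invariant ℓ m p C.rel

/-! ### Closure of the CSP of the template under the modifications made by the algorithm. -/

section Template

variable {ℓ : ℕ} {V H : Type*} [(hyperLang ℓ).Structure H] {LA : FirstOrder.Language}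
  [LA.Structure H] {m : Op H 3} {p : Op H 2} {N : ℕ}

theorem IsTemplate.tame (hT : IsTemplate ℓ V LA m p N) {I : CSPInst V H} (hI : I.IsInstanceOf LA) :
    I.Tame ℓ m p := by
  refine ⟨hI.1, fun C hC => ?_⟩
  obtain ⟨hne, k, r, u, -, hr⟩ := hI.2 C hC
  refine ⟨hne, fun n q hq a ha => (hr _).2 ?_⟩
  exact hT.invariant k r n q hq (fun i => a i ∘ u) fun i => (hr _).1 (ha i)

/-- Constraints of the template are closed under intersections with invariant `ℓ`-ary relations. -/
theorem IsTemplate.isOf_inter (hT : IsTemplate ℓ V LA m p N) {C : Constraint V H}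
    (hC : C.IsOf LA) (hfin : C.scope.Finite) (R : (Fin ℓ → V) → Set (Fin ℓ → H))
    (hR : ∀ v, Invariant ℓ m p (R v)) :
    Constraint.IsOf ⟨C.scope, {f | f ∈ C.rel ∧ ∀ v : Fin ℓ → V, ∀ h : ∀ i, v i ∈ C.scope,
      (fun i => f ⟨v i, h i⟩) ∈ R v}⟩ LA := by
  set T : Set (C.scope → H) := {f | f ∈ C.rel ∧ ∀ v : Fin ℓ → V, ∀ h : ∀ i, v i ∈ C.scope,
      (fun i => f ⟨v i, h i⟩) ∈ R v} with hTdef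
  let A : (Fin ℓ → V) → Constraint V H := fun v =>
    ⟨Set.range v, {f | (fun i => f ⟨v i, i, rfl⟩) ∈ R v}⟩
  -- The template need not be closed under conjunctions by definition. Instead, `C` and the
  -- relations `R v` are put into one instance: in its equivalent minimal instance, `C` shrinks to
  -- exactly the wanted intersection.
  let Q : CSPInst V H :=
    { vars := C.scope
      cons := insert C {D | ∃ v : Fin ℓ → V, (∀ i, v i ∈ C.scope) ∧ D = A v}
      scope_subset := by
        rintro D (rfl | ⟨v, hv, rfl⟩)
        · exact subset_rfl
        · rintro _ ⟨i, rfl⟩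
          exact hv i }
  have hQ : Q.IsInstanceOf LA := by
    refine ⟨hfin, ?_⟩
    rintro D (rfl | ⟨v, hv, rfl⟩)
    · exact hC
    · obtain ⟨r, hr⟩ := hT.exists_rel (R v) (hR v)
      refine ⟨⟨v ⟨0, by have := hT.three_le; omega⟩, _, rfl⟩, ℓ, r, fun i => ⟨v i, i, rfl⟩, ?_, ?_⟩
      · rintro ⟨_, i, rfl⟩
        exact ⟨i, rfl⟩
      · intro f
        change _ ∈ R v ↔ _
        rw [← hr]
        rfl
  have hCQ : C ∈ Q.cons := Set.mem_insert _ _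
  have hcov : Q.Covers N := fun L hL _ _ => ⟨C, hCQ, hL⟩
  have hmin := (hT.minimalize Q hQ).2 ⟨C.scope, (Q.complete N).maxFam (2 * ℓ) C⟩
    ⟨C, Or.inl hCQ, rfl⟩
  suffices (Q.complete N).maxFam (2 * ℓ) C = T by rwa [this] at hmin
  apply Set.Subset.antisymm
  · rintro f ⟨D, hD, hf⟩
    refine ⟨hD.1 C (Or.inl hCQ) hf, fun v hv => ?_⟩
    have hA : A v ∈ (Q.complete N).cons := Or.inl (Or.inr ⟨v, hv, rfl⟩)
    have h1 : (fun i => f ⟨v i, hv i⟩) ∈ Constraint.proj ⟨C.scope, D C⟩ v :=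
      ⟨f, hf, hv, fun _ => rfl⟩
    rw [hD.2 ℓ (by omega) v C (Or.inl hCQ) (A v) hA hv fun i => ⟨i, rfl⟩] at h1
    obtain ⟨g, hg, hv', hgf⟩ := h1
    have := hD.1 (A v) hA hg
    rw [show (fun i => f ⟨v i, hv i⟩) = fun i => g ⟨v i, i, rfl⟩ from funext hgf]
    exact this
  · intro f hf
    -- All scopes lie inside that of `C`, so the restrictions of `T` to them form a consistent
    -- family.
    refine ⟨fun D => {g | ∃ f ∈ T, ∀ x : D.scope, ∃ hx : x.1 ∈ C.scope, g x = f ⟨x.1, hx⟩},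
      ⟨?_, ?_⟩, f, hf, fun x => ⟨x.2, rfl⟩⟩
    · rw [CSPInst.cons_complete N hcov]
      rintro D (rfl | ⟨v, hv, rfl⟩)
      · rintro g ⟨f, hf, h⟩
        rw [show g = f from funext fun x => (h x).2]
        exact hf.1
      · rintro g ⟨f, hf, h⟩
        change (fun i => g _) ∈ R v
        rw [show (fun i => g ⟨v i, i, rfl⟩) = fun i => f ⟨v i, hv i⟩ from
          funext fun i => (h _).2]
        exact hf.2 v hv
    · have key : ∀ {k : ℕ} (v : Fin k → V), ∀ D ∈ (Q.complete N).cons, (∀ i, v i ∈ D.scope) →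
          Constraint.proj ⟨D.scope,
            {g | ∃ f ∈ T, ∀ x : D.scope, ∃ hx : x.1 ∈ C.scope, g x = f ⟨x.1, hx⟩}⟩ v =
          {a | ∃ f ∈ T, ∀ i, ∃ hx : v i ∈ C.scope, a i = f ⟨v i, hx⟩} := by
        intro k v D hD hv
        have hsc := (Q.complete N).scope_subset D hD
        ext a
        constructor
        · rintro ⟨g, ⟨f, hf, h⟩, hv, ha⟩
          refine ⟨f, hf, fun i => ?_⟩
          obtain ⟨hx, hg⟩ := h ⟨v i, hv i⟩
          exact ⟨hx, (ha i).trans hg⟩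
        · rintro ⟨f, hf, h⟩
          exact ⟨fun x => f ⟨x.1, hsc x.2⟩, ⟨f, hf, fun x => ⟨hsc x.2, rfl⟩⟩, hv,
            fun i => (h i).2⟩
      intro k _ v C₁ h1 C₂ h2 hv1 hv2
      rw [key v C₁ h1 hv1, key v C₂ h2 hv2]

/-- Replacing every constraint `C` by `{f ∈ C | f(v) ∈ R v}` preserves instances. -/
theorem IsTemplate.isInstanceOf_image (hT : IsTemplate ℓ V LA m p N) {I J : CSPInst V H}
    (hI : I.IsInstanceOf LA) (hv : J.vars = I.vars)
    (h : ∀ D ∈ J.cons, ∃ C ∈ I.cons, ∃ R : (Fin ℓ → V) → Set (Fin ℓ → H),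
      (∀ v, Invariant ℓ m p (R v)) ∧ D = ⟨C.scope, {f | f ∈ C.rel ∧ ∀ v : Fin ℓ → V,
        ∀ h : ∀ i, v i ∈ C.scope, (fun i => f ⟨v i, h i⟩) ∈ R v}⟩) : J.IsInstanceOf LA := by
  refine ⟨hv ▸ hI.1, fun D hD => ?_⟩
  obtain ⟨C, hC, R, hR, rfl⟩ := h D hD
  exact hT.isOf_inter (hI.2 C hC) (hI.1.subset (I.scope_subset C hC)) R hR

theorem IsTemplate.restrictTuple (hT : IsTemplate ℓ V LA m p N) {I : CSPInst V H}
    (hI : I.IsInstanceOf LA) (v : Fin ℓ → V) {P : Set (Fin ℓ → H)} (hP : Invariant ℓ m p P) :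
    (I.restrictTuple v P).IsInstanceOf LA := by
  classical
  refine hT.isInstanceOf_image hI rfl ?_
  rintro _ ⟨C, hC, rfl⟩
  refine ⟨C, hC, fun w => if w = v then P else Set.univ, fun w => ?_, ?_⟩
  · dsimp only
    split_ifs
    exacts [hP, invariant_univ]
  · refine Constraint.mk_congr (Set.ext fun f => ?_)
    refine and_congr_right fun _ => ⟨fun h w hw => ?_, fun h hv => ?_⟩
    · by_cases hwv : w = v
      · subst hwv
        simpa using h hw
      · simp [hwv]
    · simpa using h v hv

/-- The images under `q` of the members of the largest family again form a consistent family, so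
they are contained in it. -/
theorem CSPInst.invariant_maxFam {I : CSPInst V H} {n : ℕ}
    (hI : ∀ C ∈ I.cons, Invariant ℓ m p C.rel) (C : Constraint V H) :
    Invariant ℓ m p (I.maxFam n C) := by
  intro k q hq a ha
  refine ⟨fun C => {f | ∃ a : Fin k → C.scope → H, (∀ i, a i ∈ I.maxFam n C) ∧
    f = fun x => q fun i => a i x}, ⟨?_, ?_⟩, a, ha, rfl⟩
  · rintro D hD _ ⟨a, ha, rfl⟩
    exact hI D hD k q hq a fun i => (I.consistent_maxFam n).1 D hD (ha i)
  · have key : ∀ j ≤ n, ∀ v : Fin j → V, ∀ C₁ ∈ I.cons, ∀ C₂ ∈ I.cons,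
        (∀ i, v i ∈ C₁.scope) → (∀ i, v i ∈ C₂.scope) →
        Constraint.proj ⟨C₁.scope, {f | ∃ a : Fin k → C₁.scope → H, (∀ i, a i ∈ I.maxFam n C₁) ∧
          f = fun x => q fun i => a i x}⟩ v ⊆
        Constraint.proj ⟨C₂.scope, {f | ∃ a : Fin k → C₂.scope → H, (∀ i, a i ∈ I.maxFam n C₂) ∧
          f = fun x => q fun i => a i x}⟩ v := by
      rintro j hj v C₁ h1 C₂ h2 hv1 hv2 b ⟨_, ⟨a, ha, rfl⟩, hv, hb⟩
      have h3 : ∀ i, ∃ g ∈ I.maxFam n C₂, ∀ t, a i ⟨v t, hv t⟩ = g ⟨v t, hv2 t⟩ := by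
        intro i
        have : (fun t => a i ⟨v t, hv t⟩) ∈ Constraint.proj ⟨C₁.scope, I.maxFam n C₁⟩ v :=
          ⟨a i, ha i, hv, fun _ => rfl⟩
        rw [(I.consistent_maxFam n).2 j hj v C₁ h1 C₂ h2 hv1 hv2] at this
        obtain ⟨g, hg, _, h⟩ := this
        exact ⟨g, hg, h⟩
      choose g hg hgv using h3
      exact ⟨_, ⟨g, hg, rfl⟩, hv2, fun t => (hb t).trans
        (congrArg q (funext fun i => hgv i t))⟩
    exact fun j hj v C₁ h1 C₂ h2 hv1 hv2 =>
      (key j hj v C₁ h1 C₂ h2 hv1 hv2).antisymm (key j hj v C₂ h2 C₁ h1 hv2 hv1)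

/-- If every small set of variables is covered by a scope, then `(ℓ, ℓ)`-minimality preserves
instances. -/
theorem IsTemplate.minimalize_of_covers (hT : IsTemplate ℓ V LA m p N) {I : CSPInst V H}
    (hI : I.IsInstanceOf LA) (hcov : I.Covers ℓ) : (I.minimalize ℓ ℓ).IsInstanceOf LA := by
  have hℓ := hT.three_le
  have hcons := CSPInst.cons_complete ℓ hcov
  have htame := hT.tame hI
  set M := (I.complete ℓ).maxFam ℓ with hM
  have hcon : (I.complete ℓ).Consistent ℓ M := (I.complete ℓ).consistent_maxFam ℓ
  have hinv : ∀ C, Invariant ℓ m p (M C) :=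
    CSPInst.invariant_maxFam (by rw [hcons]; exact fun C hC => (htame.2 C hC).2)
  refine hT.isInstanceOf_image hI rfl ?_
  intro D hD
  rw [CSPInst.cons_minimalize, hcons] at hD
  obtain ⟨C, hC, rfl⟩ := hD
  have hC' : C ∈ (I.complete ℓ).cons := Or.inl hC
  -- The minimal constraint is cut out of `C` by its own `ℓ`-ary projections: the family defined in
  -- this way has the same projections to short tuples as `M`, so it is consistent and lies below
  -- the largest family.
  refine ⟨C, hC, fun v => Constraint.proj ⟨C.scope, M C⟩ v, fun v =>
    Invariant.proj (C := ⟨C.scope, M C⟩) (hinv C) v, ?_⟩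
  refine Constraint.mk_congr ?_
  apply Set.Subset.antisymm
  · exact fun f hf => ⟨hcon.1 C hC' hf, fun v hv => ⟨f, hf, hv, fun _ => rfl⟩⟩
  · rintro f hf
    refine ⟨fun D => {g | g ∈ D.rel ∧ ∀ v : Fin ℓ → V, ∀ h : ∀ i, v i ∈ D.scope,
      (fun i => g ⟨v i, h i⟩) ∈ Constraint.proj ⟨D.scope, M D⟩ v}, ⟨fun D _ g hg => hg.1, ?_⟩, hf⟩
    have key : ∀ k ≤ ℓ, ∀ v : Fin k → V, ∀ C ∈ (I.complete ℓ).cons, (∀ i, v i ∈ C.scope) →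
        Constraint.proj ⟨C.scope, {g | g ∈ C.rel ∧ ∀ v : Fin ℓ → V, ∀ h : ∀ i, v i ∈ C.scope,
          (fun i => g ⟨v i, h i⟩) ∈ Constraint.proj ⟨C.scope, M C⟩ v}⟩ v =
        Constraint.proj ⟨C.scope, M C⟩ v := by
      intro k hk v C hC hv
      apply Set.Subset.antisymm
      · rintro a ⟨g, hg, _, ha⟩
        rw [hcons] at hC
        obtain ⟨x, hx⟩ := (htame.2 C hC).1
        -- Shorter tuples are padded with a variable of the scope, which is non-empty.
        let w : Fin ℓ → V := fun i => if h : i.1 < k then v ⟨i, h⟩ else x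
        have hw : ∀ i, w i ∈ C.scope := by
          intro i
          dsimp only [w]
          split_ifs
          exacts [hv _, hx]
        obtain ⟨g', hg', _, h⟩ := hg.2 w hw
        refine ⟨g', hg', hv, fun i => (ha i).trans ?_⟩
        have h2 := h ⟨i.1, i.2.trans_le hk⟩
        have h3 : w ⟨i.1, i.2.trans_le hk⟩ = v i := by simp [w]
        simpa [h3] using h2
      · rintro a ⟨g, hg, h⟩
        exact ⟨g, ⟨hcon.1 C hC hg, fun w hw => ⟨g, hg, hw, fun _ => rfl⟩⟩, h⟩
    intro k hk v C₁ h1 C₂ h2 hv1 hv2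
    rw [key k hk v C₁ h1 hv1, key k hk v C₂ h2 hv2]
    exact hcon.2 k hk v C₁ h1 C₂ h2 hv1 hv2

theorem CSPInst.invariant_proj {I : CSPInst V H} (hI : I.Tame ℓ m p) {k n : ℕ} (hk : 0 < k)
    (hmin : I.Minimal k n) (hn : k ≤ n) (v : Fin k → V) (hv : ∀ i, v i ∈ I.vars) :
    Invariant ℓ m p (I.proj v) := by
  obtain ⟨C, hC, hvC⟩ := CSPInst.Covers.tuple hmin.1 hk hn v hv
  rw [hmin.proj_eq le_rfl hC hvC]
  exact (hI.2 C hC).2.proj v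

end Template

/-! ## Finiteness and termination -/

section Finiteness

variable {ℓ : ℕ} {K : Set (Bundled.{u} (hyperLang ℓ).Structure)} {b : ℕ}
  {H : Type u} [Countable H] [(hyperLang ℓ).Structure H] [LinearOrder H]

/-- By homogeneity a closed set is determined by the types of its members, and a finite set carries
only finitely many types. -/
theorem finite_aut_closed (hK : FinitelyBoundedBy K b)
    (hlim : FirstOrder.Language.IsFraisseLimit (orderedClass K) H) (U : Type*) [Finite U] :
    {R : Set (U → H) | ∀ f ∈ R, ∀ α : H ≃[hyperLang ℓ] H, (fun x => α (f x)) ∈ R}.Finite := by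
  let typ : (U → H) → (U → U → Prop) × ((Fin ℓ → U) → Prop) := fun f =>
    (fun x y => f x = f y, fun t => f ∘ t ∈ edgeSet ℓ H)
  have htyp : ∀ f g, typ f = typ g → SameType ℓ f g := fun f g h =>
    ⟨fun x y => iff_of_eq (congrFun (congrFun (congrArg Prod.fst h) x) y),
      fun t => iff_of_eq (congrFun (congrArg Prod.snd h) t)⟩
  have key : ∀ R S : Set (U → H),
      (∀ f ∈ S, ∀ α : H ≃[hyperLang ℓ] H, (fun x => α (f x)) ∈ S) →
      typ '' R = typ '' S → R ⊆ S := by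
    intro R S hS h f hf
    have : typ f ∈ typ '' S := h ▸ ⟨f, hf, rfl⟩
    obtain ⟨g, hg, hgf⟩ := this
    obtain ⟨α, hα⟩ := exists_equiv_of_sameType hK hlim g f (htyp g f hgf)
    rw [show f = fun x => α (g x) from funext hα]
    exact hS g hg α
  refine Set.Finite.of_finite_image (f := fun R => typ '' R) (Set.toFinite _) ?_
  exact fun R hR S hS h => (key R S hS h).antisymm (key S R hR h.symm)

theorem finite_orb (hK : FinitelyBoundedBy K b)
    (hlim : FirstOrder.Language.IsFraisseLimit (orderedClass K) H) : Finite (Orb ℓ H) := by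
  refine ((finite_aut_closed hK hlim (Fin ℓ)).subset ?_).to_subtype
  rintro _ ⟨a, rfl⟩ f ⟨β, hβ⟩ α
  exact ⟨α.comp β, fun i => congrArg α (hβ i)⟩

variable {V : Type*} {m : Op H 3} {p : Op H 2}

theorem finite_invariant_constraints (hK : FinitelyBoundedBy K b)
    (hlim : FirstOrder.Language.IsFraisseLimit (orderedClass K) H) {V₀ : Set V} (hV : V₀.Finite) :
    {C : Constraint V H | C.scope ⊆ V₀ ∧ Invariant ℓ m p C.rel}.Finite := by
  have h1 : (⋃ U ∈ 𝒫 V₀, (fun R : Set (U → H) => (⟨U, R⟩ : Constraint V H)) ''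
      {R : Set (U → H) | Invariant ℓ m p R}).Finite := by
    refine hV.finite_subsets.biUnion fun U hU => Set.Finite.image _ ?_
    have := (hV.subset hU).to_subtype
    exact (finite_aut_closed hK hlim U).subset fun R hR f hf α => hR.aut α hf
  refine h1.subset fun C hC => ?_
  simp only [Set.mem_iUnion]
  exact ⟨C.scope, hC.1, C.rel, hC.2, rfl⟩

theorem CSPInst.Tame.finite_cons (hK : FinitelyBoundedBy K b)
    (hlim : FirstOrder.Language.IsFraisseLimit (orderedClass K) H) {I : CSPInst V H}
    (hI : I.Tame ℓ m p) : I.cons.Finite :=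
  (finite_invariant_constraints hK hlim hI.1 (m := m) (p := p)).subset
    fun C hC => ⟨I.scope_subset C hC, (hI.2 C hC).2⟩

/-- `J` has fewer variables than `I`, or arises from `I` by a proper shrinking of constraints. -/
def CSPInst.Below (J I : CSPInst V H) : Prop := J.vars ⊂ I.vars ∨ I.Shrinks J ∧ J ≠ I

/-- Only finitely many tame instances have their variables among those of `I`, and `Below` is a
strict order on them; its transitivity rests on antisymmetry of shrinking. -/
theorem CSPInst.Tame.induction (hK : FinitelyBoundedBy K b)
    (hlim : FirstOrder.Language.IsFraisseLimit (orderedClass K) H) {P : CSPInst V H → Prop}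
    (h : ∀ I : CSPInst V H, I.Tame ℓ m p →
      (∀ J : CSPInst V H, J.Tame ℓ m p → J.Below I → P J) → P I)
    (I : CSPInst V H) (hI : I.Tame ℓ m p) : P I := by
  let T : Set (CSPInst V H) := {J | J.vars ⊆ I.vars ∧ J.Tame ℓ m p}
  have hT : T.Finite := by
    have hfin : (𝒫 I.vars ×ˢ 𝒫 {C : Constraint V H | C.scope ⊆ I.vars ∧
        Invariant ℓ m p C.rel}).Finite :=
      hI.1.finite_subsets.prod (finite_invariant_constraints hK hlim hI.1).finite_subsets
    refine Set.Finite.of_finite_image (f := fun J : CSPInst V H => (J.vars, J.cons))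
      (hfin.subset ?_) ?_
    · rintro _ ⟨J, hJ, rfl⟩
      exact ⟨hJ.1, fun C hC => ⟨(J.scope_subset C hC).trans hJ.1, (hJ.2.2 C hC).2⟩⟩
    · intro J _ J' _ hJ
      exact CSPInst.ext' (congrArg Prod.fst hJ) (congrArg Prod.snd hJ)
  have := hT.to_subtype
  let r : T → T → Prop := fun J J' => J.1.Below J'.1
  have htrans : IsTrans T r := ⟨by
    rintro ⟨A, hA⟩ ⟨B, hB⟩ ⟨C, hC⟩ h1 h2
    rcases h1 with h1 | ⟨h1, h1'⟩ <;> rcases h2 with h2 | ⟨h2, h2'⟩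
    · exact Or.inl (h1.trans h2)
    · exact Or.inl (h2.1 ▸ h1)
    · refine Or.inl ?_
      change A.vars ⊂ C.vars
      rw [h1.1]; exact h2
    · refine Or.inr ⟨h2.trans h1, ?_⟩
      rintro rfl
      exact h1' (h1.antisymm (hB.2.finite_cons hK hlim) h2).symm⟩
  have hirr : Std.Irrefl r := ⟨by
    rintro A (h1 | ⟨-, h1⟩)
    · exact h1.2 subset_rfl
    · exact h1 rfl⟩
  have hwf : WellFounded r := Finite.wellFounded_of_trans_of_irrefl r
  have main : ∀ J : T, P J.1 := by
    intro J
    induction J using hwf.induction with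
    | _ J ih =>
      refine h J.1 J.2.2 fun L hL hLJ => ?_
      have hsub : L.vars ⊆ I.vars := by
        rcases hLJ with h1 | h1
        · exact h1.subset.trans J.2.1
        · rw [h1.1.1]; exact J.2.1
      exact ih ⟨L, hsub, hL⟩ hLJ
  exact main ⟨I, subset_rfl, hI⟩

theorem finite_incTuples (ℓ : ℕ) {V : Type*} [LinearOrder V] {S : Set V} (hS : S.Finite) :
    (incTuples ℓ S).Finite := by
  refine Set.Finite.of_finite_image (f := fun v : Fin ℓ ↪o V => (v : Fin ℓ → V)) ?_
    (fun _ _ _ _ h => DFunLike.coe_injective h)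
  refine (Set.Finite.pi' (fun _ : Fin ℓ => hS)).subset ?_
  rintro _ ⟨v, hv, rfl⟩
  exact hv

end Finiteness

/-! ## The procedure Eq-Subdirect -/

/-- There is an assignment with the kernel of `a` on `v` whose kernel is realized by a map in every
constraint. -/
def CSPInst.KerSol {V H : Type*} (I : CSPInst V H) {k : ℕ} (v : Fin k → V) (a : Fin k → H) : Prop :=
  ∃ s : V → H, (∀ i j, s (v i) = s (v j) ↔ a i = a j) ∧
    ∀ C ∈ I.cons, ∃ f ∈ C.rel, ∀ x y : C.scope, f x = f y ↔ s x = s y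

section EqSubdirect

variable {ℓ : ℕ} {K : Set (Bundled.{u} (hyperLang ℓ).Structure)} {b : ℕ}
  {H : Type u} [Countable H] [(hyperLang ℓ).Structure H] [LinearOrder H]
  {V : Type*} [LinearOrder V] {m : Op H 3} {p : Op H 2} {LA : FirstOrder.Language}
  [LA.Structure H] {N : ℕ}

theorem orb_eq_of_mem {k : ℕ} {H : Type*} [(hyperLang ℓ).Structure H] {x y : Fin k → H}
    (h : x ∈ orb ℓ y) : orb ℓ x = orb ℓ y := by
  obtain ⟨α, hα⟩ := h
  ext z
  constructor
  · rintro ⟨β, hβ⟩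
    exact ⟨β.comp α, fun i => by rw [hβ, hα]; rfl⟩
  · rintro ⟨β, hβ⟩
    exact ⟨β.comp α.symm, fun i => by
      rw [hβ, hα]; exact congrArg β (α.symm_apply_apply _).symm⟩

theorem Orb.eq_orb {H : Type*} [(hyperLang ℓ).Structure H] (O : Orb ℓ H) {a : Fin ℓ → H}
    (ha : a ∈ O.1) : O.1 = orb ℓ a := by
  obtain ⟨_, b, rfl⟩ := O
  exact (orb_eq_of_mem ha).symm

theorem injective_of_mem_orb {H : Type*} [(hyperLang ℓ).Structure H] {k : ℕ} {x y : Fin k → H}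
    (h : x ∈ orb ℓ y) : Function.Injective x ↔ Function.Injective y := by
  obtain ⟨α, hα⟩ := h
  rw [show x = α ∘ y from funext hα]
  exact α.injective.of_comp_iff y

theorem disjoint_orb_injTuples {H : Type*} [(hyperLang ℓ).Structure H] {k : ℕ} {a : Fin k → H}
    (ha : ¬ Function.Injective a) : Disjoint (orb ℓ a) (injTuples H k) :=
  Set.disjoint_left.2 fun _ hx hinj => ha ((injective_of_mem_orb hx).1 hinj)

theorem mem_orb_of_kernel (hK : FinitelyBoundedBy K b)
    (hlim : FirstOrder.Language.IsFraisseLimit (orderedClass K) H) {x y : Fin ℓ → H}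
    (hx : ¬ Function.Injective x) (h : ∀ i j, x i = x j ↔ y i = y j) : y ∈ orb ℓ x :=
  (mem_orb_iff hK hlim x y).2 (sameType_of_not_injective (isHypergraph_limit hK hlim) hx h)

theorem exists_extend {X B : Type*} {S : Set X} (s : S → B) (b : B) :
    ∃ s' : X → B, ∀ x : S, s' x = s x := by
  classical
  exact ⟨fun x => if h : x ∈ S then s ⟨x, h⟩ else b, fun x => dif_pos x.2⟩

/-- Closing constraints under all permutations leaves only kernels visible, and restricting a
non-injective value to an orbit is a condition on its kernel. This frees Eq-Subdirect from orbits.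
-/
theorem mem_eqPart_iff (hℓ : 0 < ℓ) (hK : FinitelyBoundedBy K b)
    (hlim : FirstOrder.Language.IsFraisseLimit (orderedClass K) H) {I : CSPInst V H}
    (hI : I.Tame ℓ m p) {v : Fin ℓ ↪o V} (hinv : Invariant ℓ m p (I.proj v)) {a : Fin ℓ → H} :
    a ∈ eqPart ℓ I v ↔ a ∈ I.proj v ∧ (Function.Injective a ∨ I.KerSol v a) := by
  by_cases ha : Function.Injective a
  · simp only [ha, true_or, and_true]
    constructor
    · rintro (h | h)
      · exact h.1
      · simp only [Set.mem_iUnion] at h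
        obtain ⟨O, hO, haO⟩ := h
        exact absurd ha (Set.disjoint_left.1 hO.1 haO)
    · exact fun h => Or.inl ⟨h, ha⟩
  simp only [ha, false_or]
  constructor
  · rintro (h | h)
    · exact absurd h.2 ha
    simp only [Set.mem_iUnion] at h
    obtain ⟨O, ⟨-, hOsub, s, hs⟩, haO⟩ := h
    have haP := hOsub haO
    obtain ⟨s', hs'⟩ := exists_extend s (a ⟨0, hℓ⟩)
    refine ⟨haP, s', ?_⟩
    have hC : ∀ C ∈ I.cons, ∃ h ∈ C.rel, (∀ hv : ∀ i, v i ∈ C.scope,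
        (fun i => h ⟨v i, hv i⟩) ∈ O.1) ∧ ∀ x y : C.scope, h x = h y ↔ s' x = s' y := by
      intro C hC
      obtain ⟨h, ⟨hh, hhO⟩, σ, hσ⟩ := hs _ ⟨_, ⟨C, hC, rfl⟩, rfl⟩
      refine ⟨h, hh, hhO, fun x y => ?_⟩
      have h1 : s ⟨x, I.scope_subset C hC x.2⟩ = σ (h x) := hσ x
      have h2 : s ⟨y, I.scope_subset C hC y.2⟩ = σ (h y) := hσ y
      rw [hs' ⟨x, I.scope_subset C hC x.2⟩, hs' ⟨y, I.scope_subset C hC y.2⟩, h1, h2,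
        σ.injective.eq_iff]
    refine ⟨fun i j => ?_, fun C hC' => ?_⟩
    · obtain ⟨C, hC', f, -, hvC, -⟩ := CSPInst.mem_proj.1 haP
      obtain ⟨h, -, h1, h2⟩ := hC C hC'
      rw [← h2 ⟨v i, hvC i⟩ ⟨v j, hvC j⟩]
      have h3 := h1 hvC
      rw [O.eq_orb haO, mem_orb_iff hK hlim] at h3
      exact (h3.1 i j).symm
    · obtain ⟨h, h0, -, h2⟩ := hC C hC'
      exact ⟨h, h0, h2⟩
  · rintro ⟨haP, s, hsv, hs⟩
    refine Or.inr ?_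
    simp only [Set.mem_iUnion]
    refine ⟨⟨orb ℓ a, a, rfl⟩, ⟨disjoint_orb_injTuples ha, hinv.orb_subset haP,
      fun x => s x, ?_⟩, mem_orb_self a⟩
    rintro _ ⟨_, ⟨C, hC, rfl⟩, rfl⟩
    obtain ⟨f, hf, hfs⟩ := hs C hC
    have := (hI.1.subset (I.scope_subset C hC)).to_subtype
    obtain ⟨σ, hσ⟩ := exists_perm_of_kernel f (fun x : C.scope => s x) hfs
    refine ⟨f, ⟨hf, fun hvC => ?_⟩, σ, fun x => hσ x⟩
    exact mem_orb_of_kernel hK hlim ha fun i j => by rw [hfs]; exact (hsv i j).symm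

/-- An injective operation intersects kernels, so it combines assignments that witness the arguments
into one that witnesses the value. -/
theorem invariant_eqPart (hℓ : 0 < ℓ) (hK : FinitelyBoundedBy K b)
    (hlim : FirstOrder.Language.IsFraisseLimit (orderedClass K) H)
    (hm : Function.Injective m) (hp : Function.Injective p) {I : CSPInst V H}
    (hI : I.Tame ℓ m p) {v : Fin ℓ ↪o V}
    (hinv : Invariant ℓ m p (I.proj v)) : Invariant ℓ m p (eqPart ℓ I v) := by
  intro n q hq a ha
  simp only [mem_eqPart_iff hℓ hK hlim hI hinv] at ha ⊢
  refine ⟨hinv n q hq a fun i => (ha i).1, ?_⟩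
  have hqinj := hq.injective hm hp
  -- One injective argument already makes the value injective.
  by_cases h : ∃ i, Function.Injective (a i)
  · obtain ⟨i, hi⟩ := h
    exact Or.inl fun x y hxy => hi (congrFun (hqinj hxy) i)
  push Not at h
  have h2 := fun i => (ha i).2.resolve_left (h i)
  choose s hsv hs using h2
  refine Or.inr ⟨fun x => q fun i => s i x, fun i j => ?_, fun C hC => ?_⟩
  · rw [hqinj.eq_iff, hqinj.eq_iff, funext_iff, funext_iff]
    exact forall_congr' fun t => hsv t i j
  · choose f hf hfs using fun i => hs i C hC
    refine ⟨_, (hI.2 C hC).2 n q hq f hf, fun x y => ?_⟩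
    rw [hqinj.eq_iff, hqinj.eq_iff, funext_iff, funext_iff]
    exact forall_congr' fun t => hfs t x y

/-- The kernel of a solution witnesses its own value on `v`. -/
theorem hasSolution_restrictTuple_eqPart (hℓ : 0 < ℓ) (hK : FinitelyBoundedBy K b)
    (hlim : FirstOrder.Language.IsFraisseLimit (orderedClass K) H) {I : CSPInst V H}
    (hI : I.Tame ℓ m p) {v : Fin ℓ ↪o V} (hv : v ∈ incTuples ℓ I.vars)
    (hinv : Invariant ℓ m p (I.proj v)) (h : I.HasSolution) :
    (I.restrictTuple v (eqPart ℓ I v)).HasSolution := by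
  obtain ⟨s, hs⟩ := h
  obtain ⟨s', hs'⟩ := exists_extend s (s ⟨v ⟨0, hℓ⟩, hv _⟩)
  refine ⟨s, ?_⟩
  rintro _ ⟨C, hC, rfl⟩
  refine ⟨hs C hC, fun hvC => ?_⟩
  rw [mem_eqPart_iff hℓ hK hlim hI hinv]
  refine ⟨CSPInst.mem_proj.2 ⟨C, hC, _, hs C hC, hvC, fun _ => rfl⟩, Or.inr
    ⟨s', fun i j => ?_, fun D hD => ⟨_, hs D hD, fun x y => ?_⟩⟩⟩
  · rw [hs' ⟨v i, hv i⟩, hs' ⟨v j, hv j⟩]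
    exact Iff.rfl
  · rw [hs' ⟨x, I.scope_subset D hD x.2⟩, hs' ⟨y, I.scope_subset D hD y.2⟩]

/-- The last two clauses serve termination and the fixed point: a pass that reports a change has
changed the instance, and a pass that returns its input had nothing to remove at any tuple. -/
theorem eqPass_spec (hK : FinitelyBoundedBy K b)
    (hlim : FirstOrder.Language.IsFraisseLimit (orderedClass K) H)
    (hm : Function.Injective m) (hp : Function.Injective p) (hT : IsTemplate ℓ V LA m p N)
    (l : List (Fin ℓ ↪o V)) : ∀ I : CSPInst V H, (∀ v ∈ l, v ∈ incTuples ℓ I.vars) →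
      I.IsInstanceOf LA → I.Minimal ℓ ℓ →
      (eqPass ℓ l I).1.IsInstanceOf LA ∧ (eqPass ℓ l I).1.Minimal ℓ ℓ ∧ I.Shrinks (eqPass ℓ l I).1 ∧
      (I.HasSolution → (eqPass ℓ l I).1.HasSolution) ∧
      ((eqPass ℓ l I).2 = true → (eqPass ℓ l I).1 ≠ I) ∧
      ((eqPass ℓ l I).1 = I → ∀ v ∈ l, I.restrictTuple v (eqPart ℓ I v) = I) := by
  have hℓ : 0 < ℓ := by have := hT.three_le; omega
  induction l with
  | nil =>
    intro I _ hI hmin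
    exact ⟨hI, hmin, .refl I, id, by simp [eqPass], by simp⟩
  | cons v l ih =>
    intro I hl hI hmin
    have htame := hT.tame hI
    have hfin := htame.finite_cons hK hlim
    have hv := hl v (by simp)
    have hinv := CSPInst.invariant_proj htame hℓ hmin le_rfl v hv
    have hX : (I.restrictTuple v (eqPart ℓ I v)).IsInstanceOf LA :=
      hT.restrictTuple hI v (invariant_eqPart hℓ hK hlim hm hp htame hinv)
    have hIX := I.shrinks_restrictTuple v (eqPart ℓ I v)
    have hsol := hasSolution_restrictTuple_eqPart hℓ hK hlim htame hv hinv
    set X := I.restrictTuple v (eqPart ℓ I v) with hXdef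
    by_cases hXmin : X.Minimal ℓ ℓ
    · have heq : eqPass ℓ (v :: l) I = eqPass ℓ l X := by
        rw [eqPass, if_pos hXmin]
      rw [heq]
      obtain ⟨h1, h2, h3, h4, h5, h6⟩ := ih X (fun w hw => hl w (by simp [hw])) hX hXmin
      have hXI : (eqPass ℓ l X).1 = I → X = I := fun h =>
        (hIX.antisymm hfin (h ▸ h3)).symm
      refine ⟨h1, h2, hIX.trans h3, fun h => h4 (hsol h), fun h h' => ?_, fun h w hw => ?_⟩
      · exact h5 h (h'.trans (hXI h').symm)
      · rcases List.mem_cons.1 hw with rfl | hw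
        · exact hXI h
        · have := h6 (h.trans (hXI h).symm) w hw
          rwa [hXI h] at this
    · have heq : eqPass ℓ (v :: l) I = (X.minimalize ℓ ℓ, true) := by
        rw [eqPass, if_neg hXmin]
      rw [heq]
      have hcov : X.Covers ℓ := hIX.covers hmin.1
      have hXJ := CSPInst.shrinks_minimalize (m := ℓ) hcov
      have hne : X.minimalize ℓ ℓ ≠ I := by
        intro h
        -- Returning to `I` would squeeze `X` between `I` and itself, but `I` is minimal and `X` is
        -- not.
        have : I = X := hIX.antisymm hfin (h ▸ hXJ)
        exact hXmin (this ▸ hmin)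
      refine ⟨hT.minimalize_of_covers hX hcov, X.minimal_minimalize ℓ ℓ, hIX.trans hXJ,
        fun h => ?_, fun _ => hne, fun h => absurd h hne⟩
      obtain ⟨s, hs⟩ := hsol h
      exact ⟨s, hs.minimalize ℓ ℓ⟩

theorem EqSubdirectOutput.spec (hK : FinitelyBoundedBy K b)
    (hlim : FirstOrder.Language.IsFraisseLimit (orderedClass K) H)
    (hm : Function.Injective m) (hp : Function.Injective p) (hT : IsTemplate ℓ V LA m p N)
    {I J : CSPInst V H} (h : EqSubdirectOutput ℓ I J) (hI : I.IsInstanceOf LA)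
    (hmin : I.Minimal ℓ ℓ) :
    J.IsInstanceOf LA ∧ J.Minimal ℓ ℓ ∧ I.Shrinks J ∧ (I.HasSolution → J.HasSolution) ∧
      (J = I → ∀ v ∈ incTuples ℓ I.vars, I.restrictTuple v (eqPart ℓ I v) = I) := by
  induction h with
  | @finish I J l hl h =>
    have := eqPass_spec hK hlim hm hp hT l I (fun v hv => (hl v).1 hv) hI hmin
    rw [h] at this
    exact ⟨this.1, this.2.1, this.2.2.1, this.2.2.2.1,
      fun h v hv => this.2.2.2.2.2 h v ((hl v).2 hv)⟩
  | @next I J K' l hl h hK' ih =>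
    have := eqPass_spec hK hlim hm hp hT l I (fun v hv => (hl v).1 hv) hI hmin
    rw [h] at this
    obtain ⟨h1, h2, h3, h4, h5, h6⟩ := this
    obtain ⟨g1, g2, g3, g4, g5⟩ := ih h1 h2
    refine ⟨g1, g2, h3.trans g3, fun h => g4 (h4 h), ?_⟩
    rintro rfl
    have hJI : K' = J := h3.antisymm ((hT.tame hI).finite_cons hK hlim) g3
    exact absurd hJI.symm (h5 rfl)

theorem exists_eqSubdirectOutput (hK : FinitelyBoundedBy K b)
    (hlim : FirstOrder.Language.IsFraisseLimit (orderedClass K) H)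
    (hm : Function.Injective m) (hp : Function.Injective p) (hT : IsTemplate ℓ V LA m p N)
    {I : CSPInst V H} (hI : I.IsInstanceOf LA) (hmin : I.Minimal ℓ ℓ) :
    ∃ J, EqSubdirectOutput ℓ I J := by
  revert hI hmin
  suffices I.Tame ℓ m p → I.IsInstanceOf LA → I.Minimal ℓ ℓ → ∃ J, EqSubdirectOutput ℓ I J from
    fun hI => this (hT.tame hI) hI
  refine CSPInst.Tame.induction hK hlim
    (P := fun I => I.IsInstanceOf LA → I.Minimal ℓ ℓ → ∃ J, EqSubdirectOutput ℓ I J) ?_ I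
  intro I htame ih hI hmin
  obtain ⟨l, hl⟩ : ∃ l : List (Fin ℓ ↪o V), ∀ v, v ∈ l ↔ v ∈ incTuples ℓ I.vars :=
    ⟨(finite_incTuples ℓ hI.1).toFinset.toList, by simp⟩
  have h := eqPass_spec hK hlim hm hp hT l I (fun v hv => (hl v).1 hv) hI hmin
  cases hc : (eqPass ℓ l I).2 with
  | false => exact ⟨_, .finish l hl (Prod.ext rfl hc)⟩
  | true =>
    obtain ⟨J, hJ⟩ := ih _ (hT.tame h.1) (Or.inr ⟨h.2.2.1, h.2.2.2.2.1 hc⟩) h.1 h.2.1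
    exact ⟨J, .next l hl (Prod.ext rfl hc) hJ⟩

/-- Every non-injective tuple in a projection is compatible with an assignment as in the definition
of eq-subdirectness. -/
def CSPInst.KernelSubdirect (ℓ : ℕ) {V H : Type*} [LinearOrder V] (I : CSPInst V H) : Prop :=
  ∀ v ∈ incTuples ℓ I.vars, ∀ a ∈ I.proj v, ¬ Function.Injective a → I.KerSol v a

theorem CSPInst.kernelSubdirect_of_fixed (hℓ : 0 < ℓ) (hK : FinitelyBoundedBy K b)
    (hlim : FirstOrder.Language.IsFraisseLimit (orderedClass K) H) {I : CSPInst V H}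
    (hI : I.Tame ℓ m p) (hmin : I.Minimal ℓ ℓ)
    (h : ∀ v ∈ incTuples ℓ I.vars, I.restrictTuple v (eqPart ℓ I v) = I) :
    I.KernelSubdirect ℓ := by
  intro v hv a ha hinj
  obtain ⟨C, hC, f, hf, hvC, haf⟩ := CSPInst.mem_proj.1 ha
  rw [← h v hv] at hC
  obtain ⟨D, hD, rfl⟩ := hC
  have : a ∈ eqPart ℓ I v := by
    rw [show a = fun i => f ⟨v i, hvC i⟩ from funext haf]
    exact hf.2 hvC
  rw [mem_eqPart_iff hℓ hK hlim hI (CSPInst.invariant_proj hI hℓ hmin le_rfl v hv)] at this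
  exact this.2.resolve_left hinj

theorem MinimalEqSubdirectOutput.spec (hK : FinitelyBoundedBy K b)
    (hlim : FirstOrder.Language.IsFraisseLimit (orderedClass K) H)
    (hm : Function.Injective m) (hp : Function.Injective p) (hT : IsTemplate ℓ V LA m p N)
    {I J : CSPInst V H} (h : MinimalEqSubdirectOutput ℓ (2 * ℓ) N I J) (hI : I.IsInstanceOf LA) :
    J.IsInstanceOf LA ∧ J.Minimal (2 * ℓ) N ∧ (I.minimalize (2 * ℓ) N).Shrinks J ∧
      (J.HasSolution ↔ I.HasSolution) ∧ J.KernelSubdirect ℓ := by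
  have hℓ := hT.three_le
  have hN := hT.le_cover
  induction h with
  | @finish I h =>
    have hX := hT.minimalize I hI
    have hmin := I.minimal_minimalize (2 * ℓ) N
    have hmin' : (I.minimalize (2 * ℓ) N).Minimal ℓ ℓ := hmin.mono (by omega) (by omega)
    refine ⟨hX, hmin, .refl _, ⟨CSPInst.hasSolution_of_minimalize, fun ⟨s, hs⟩ =>
      ⟨s, hs.minimalize _ _⟩⟩, ?_⟩
    exact CSPInst.kernelSubdirect_of_fixed (by omega) hK hlim (hT.tame hX) hmin'
      ((h.spec hK hlim hm hp hT hX hmin').2.2.2.2 rfl)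
  | @next I J K' h hne hK' ih =>
    have hX := hT.minimalize I hI
    have hmin := I.minimal_minimalize (2 * ℓ) N
    have hmin' : (I.minimalize (2 * ℓ) N).Minimal ℓ ℓ := hmin.mono (by omega) (by omega)
    obtain ⟨h1, -, h3, h4, -⟩ := h.spec hK hlim hm hp hT hX hmin'
    obtain ⟨g1, g2, g3, g4, g5⟩ := ih h1
    refine ⟨g1, g2, (h3.trans (CSPInst.shrinks_minimalize (h3.covers hmin.1))).trans g3,
      ⟨fun h => ?_, fun ⟨s, hs⟩ => ?_⟩, g5⟩
    · exact CSPInst.hasSolution_of_minimalize (h3.hasSolution (g4.1 h))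
    · exact g4.2 (h4 ⟨s, hs.minimalize _ _⟩)

theorem exists_minimalEqSubdirectOutput (hK : FinitelyBoundedBy K b)
    (hlim : FirstOrder.Language.IsFraisseLimit (orderedClass K) H)
    (hm : Function.Injective m) (hp : Function.Injective p) (hT : IsTemplate ℓ V LA m p N)
    {I : CSPInst V H} (hI : I.IsInstanceOf LA) :
    ∃ J, MinimalEqSubdirectOutput ℓ (2 * ℓ) N I J := by
  have hℓ := hT.three_le
  have hN := hT.le_cover
  -- The induction runs over the minimal instance rather than over `I`: passing to it from `I` may
  -- add full constraints, but from one round to the next the minimal instances shrink.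
  suffices ∀ X : CSPInst V H, X.Tame ℓ m p → ∀ I : CSPInst V H, I.IsInstanceOf LA →
      I.minimalize (2 * ℓ) N = X → ∃ J, MinimalEqSubdirectOutput ℓ (2 * ℓ) N I J from
    this _ (hT.tame (hT.minimalize I hI)) I hI rfl
  refine CSPInst.Tame.induction hK hlim ?_
  rintro X htame ih I hI rfl
  have hX := hT.minimalize I hI
  have hmin := I.minimal_minimalize (2 * ℓ) N
  have hmin' : (I.minimalize (2 * ℓ) N).Minimal ℓ ℓ := hmin.mono (by omega) (by omega)
  obtain ⟨J, hJ⟩ := exists_eqSubdirectOutput hK hlim hm hp hT hX hmin'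
  by_cases hne : J = I.minimalize (2 * ℓ) N
  · subst hne
    exact ⟨_, .finish hJ⟩
  obtain ⟨h1, -, h3, -, -⟩ := hJ.spec hK hlim hm hp hT hX hmin'
  have hs := CSPInst.shrinks_minimalize (m := 2 * ℓ) (h3.covers hmin.1)
  obtain ⟨L, hL⟩ := ih _ (hT.tame (hT.minimalize J h1)) (Or.inr ⟨h3.trans hs, fun h =>
    hne (h3.antisymm (htame.finite_cons hK hlim) (h ▸ hs)).symm⟩) J h1 rfl
  exact ⟨L, .next hJ hne hL⟩

end EqSubdirect

/-! ## Identification of variables -/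

section ForcedEqual

variable {V H : Type*} {I : CSPInst V H}

theorem ForcedEqual.eq {x y : V} (h : ForcedEqual I x y) {C : Constraint V H} (hC : C ∈ I.cons)
    {f : C.scope → H} (hf : f ∈ C.rel) (hx : x ∈ C.scope) (hy : y ∈ C.scope) :
    f ⟨x, hx⟩ = f ⟨y, hy⟩ := by
  rcases h with rfl | h
  · rfl
  have : ![f ⟨x, hx⟩, f ⟨y, hy⟩] ∈ I.proj ![x, y] := by
    refine CSPInst.mem_proj.2 ⟨C, hC, f, hf, fun i => ?_, fun i => ?_⟩
    · fin_cases i <;> assumption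
    · fin_cases i <;> rfl
  rw [h] at this
  exact this

theorem mem_proj_pair {x y : V} {a : Fin 2 → H} : a ∈ I.proj ![x, y] ↔
    ∃ C ∈ I.cons, ∃ f ∈ C.rel, ∃ (hx : x ∈ C.scope) (hy : y ∈ C.scope),
      a 0 = f ⟨x, hx⟩ ∧ a 1 = f ⟨y, hy⟩ := by
  rw [CSPInst.mem_proj]
  constructor
  · rintro ⟨C, hC, f, hf, hv, ha⟩
    exact ⟨C, hC, f, hf, hv 0, hv 1, ha 0, ha 1⟩
  · rintro ⟨C, hC, f, hf, hx, hy, h0, h1⟩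
    refine ⟨C, hC, f, hf, fun i => ?_, fun i => ?_⟩
    · fin_cases i <;> assumption
    · fin_cases i <;> assumption

theorem ForcedEqual.symm {x y : V} (h : ForcedEqual I x y) : ForcedEqual I y x := by
  rcases h with rfl | h
  · exact Or.inl rfl
  refine Or.inr (Set.ext fun a => ?_)
  have h1 : a ∈ I.proj ![y, x] ↔ ![a 1, a 0] ∈ I.proj ![x, y] := by
    rw [mem_proj_pair, mem_proj_pair]
    constructor
    · rintro ⟨C, hC, f, hf, hx, hy, h0, h1⟩
      exact ⟨C, hC, f, hf, hy, hx, h1, h0⟩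
    · rintro ⟨C, hC, f, hf, hx, hy, h0, h1⟩
      exact ⟨C, hC, f, hf, hy, hx, h1, h0⟩
  rw [h1, h]
  exact eq_comm

theorem ForcedEqual.trans {k n : ℕ} (hk : 2 ≤ k) (hn : 3 ≤ n) (hmin : I.Minimal k n) {x y z : V}
    (hx : x ∈ I.vars) (hy : y ∈ I.vars) (hz : z ∈ I.vars)
    (h : ForcedEqual I x y) (h' : ForcedEqual I y z) : ForcedEqual I x z := by
  rcases id h with rfl | hxy
  · exact h'
  obtain ⟨D, hD, hvD⟩ := CSPInst.Covers.tuple hmin.1 (by norm_num) hn ![x, y, z] (by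
    intro i; fin_cases i <;> assumption)
  have hxD : x ∈ D.scope := hvD 0
  have hyD : y ∈ D.scope := hvD 1
  have hzD : z ∈ D.scope := hvD 2
  refine Or.inr (Set.ext fun a => ?_)
  have h1 : ∀ x y : V, x ∈ D.scope → y ∈ D.scope → I.proj ![x, y] = D.proj ![x, y] := by
    intro x y hx hy
    refine (hmin.mono hk le_rfl).proj_eq le_rfl hD ?_
    intro i; fin_cases i <;> assumption
  constructor
  · intro ha
    rw [h1 x z hxD hzD] at ha
    obtain ⟨f, hf, hv, ha⟩ := ha
    exact (ha 0).trans (((h.eq hD hf hxD hyD).trans (h'.eq hD hf hyD hzD)).trans (ha 1).symm)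
  · intro ha
    have h2 : a ∈ I.proj ![x, y] := by rw [hxy]; exact ha
    rw [h1 x y hxD hyD] at h2
    obtain ⟨f, hf, hv, hfa⟩ := h2
    exact mem_proj_pair.2 ⟨D, hD, f, hf, hxD, hzD, hfa 0,
      (hfa 1).trans (h'.eq hD hf hyD hzD)⟩

theorem exists_identifyAllEqualOutput {k n : ℕ} (hk : 2 ≤ k) (hn : 3 ≤ n) (hmin : I.Minimal k n) :
    ∃ J, IdentifyAllEqualOutput I J := by
  classical
  let s : Setoid I.vars :=
    { r := fun x y => ForcedEqual I x y
      iseqv := ⟨fun _ => Or.inl rfl, ForcedEqual.symm,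
        fun {x y z} h h' => h.trans hk hn hmin x.2 y.2 z.2 h'⟩ }
  let r : V → V := fun x => if h : x ∈ I.vars then
    ((Quotient.mk s ⟨x, h⟩).out : I.vars).1 else x
  have hr : ∀ x (h : x ∈ I.vars), r x = ((Quotient.mk s ⟨x, h⟩).out : I.vars).1 :=
    fun x h => dif_pos h
  refine ⟨_, r, fun x hx => ?_, fun x hx y hy hxy => ?_, rfl⟩
  · rw [hr x hx]
    refine ⟨Subtype.prop _, ?_⟩
    have : s.r (Quotient.mk s ⟨x, hx⟩).out ⟨x, hx⟩ := Quotient.mk_out (s := s) ⟨x, hx⟩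
    exact ForcedEqual.symm this
  · rw [hr x hx, hr y hy]
    have : Quotient.mk s ⟨x, hx⟩ = Quotient.mk s ⟨y, hy⟩ := Quotient.sound hxy
    rw [this]

end ForcedEqual

/-- Rename the variables of a constraint. -/
def Constraint.rename {V H : Type*} (r : V → V) (C : Constraint V H) : Constraint V H :=
  ⟨r '' C.scope, {f | (fun x : C.scope => f ⟨r x.1, Set.mem_image_of_mem r x.2⟩) ∈ C.rel}⟩

theorem Constraint.rename_eq_self {V H : Type*} {r : V → V} {C : Constraint V H}
    (h : ∀ x ∈ C.scope, r x = x) : C.rename r = C := by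
  have key : ∀ (T : Set V) (hT : ∀ x ∈ C.scope, r x ∈ T), T = C.scope →
      (⟨T, {f | (fun x : C.scope => f ⟨r x.1, hT x x.2⟩) ∈ C.rel}⟩ : Constraint V H) = C := by
    rintro _ hT rfl
    refine Constraint.mk_congr (Set.ext fun f => ?_)
    have : (fun x : C.scope => f ⟨r x.1, hT x x.2⟩) = f :=
      funext fun x => congrArg f (Subtype.ext (h x x.2))
    rw [Set.mem_ofPred_eq, this]
  refine key _ (fun x hx => Set.mem_image_of_mem r hx) (Set.ext fun x => ⟨?_, fun hx => ⟨x, hx, h x hx⟩⟩)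
  rintro ⟨y, hy, rfl⟩
  rwa [h y hy]

/-- The properties of a choice of representatives of the classes of forced equalities. -/
structure IsRepresentative {V H : Type*} (I : CSPInst V H) (r : V → V) : Prop where
  mem : ∀ x ∈ I.vars, r x ∈ I.vars
  forced : ∀ x ∈ I.vars, ForcedEqual I x (r x)
  eq : ∀ x ∈ I.vars, ∀ y ∈ I.vars, ForcedEqual I x y → r x = r y

namespace IsRepresentative

variable {V H : Type*} {I : CSPInst V H} {r : V → V} {k n : ℕ}

theorem idem (hr : IsRepresentative I r) {x : V} (hx : x ∈ I.vars) : r (r x) = r x :=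
  (hr.eq x hx _ (hr.mem x hx) (hr.forced x hx)).symm

theorem apply_of_mem (hr : IsRepresentative I r) {x : V} (hx : x ∈ (I.rename r).vars) : r x = x := by
  obtain ⟨y, hy, rfl⟩ := hx
  exact hr.idem hy

theorem vars_subset (hr : IsRepresentative I r) : (I.rename r).vars ⊆ I.vars := by
  rintro _ ⟨x, hx, rfl⟩
  exact hr.mem x hx

theorem forcedEqual_of_eq (hr : IsRepresentative I r) (hk : 2 ≤ k) (hn : 3 ≤ n)
    (hmin : I.Minimal k n) {x y : V} (hx : x ∈ I.vars) (hy : y ∈ I.vars) (h : r x = r y) :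
    ForcedEqual I x y :=
  (hr.forced x hx).trans hk hn hmin hx (hr.mem x hx) hy (h ▸ (hr.forced y hy).symm)

/-- Every map in a constraint factors through the renaming. -/
theorem exists_factor (hr : IsRepresentative I r) (hk : 2 ≤ k) (hn : 3 ≤ n)
    (hmin : I.Minimal k n) {C : Constraint V H} (hC : C ∈ I.cons) {f : C.scope → H}
    (hf : f ∈ C.rel) : ∃ g ∈ (C.rename r).rel,
      ∀ x : C.scope, g ⟨r x.1, Set.mem_image_of_mem r x.2⟩ = f x := by
  have h1 : ∀ y : r '' C.scope, ∃ x : C.scope, r x.1 = y.1 := by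
    rintro ⟨_, x, hx, rfl⟩
    exact ⟨⟨x, hx⟩, rfl⟩
  choose t ht using h1
  have h2 : ∀ x : C.scope, f (t ⟨r x.1, Set.mem_image_of_mem r x.2⟩) = f x := by
    intro x
    exact (hr.forcedEqual_of_eq hk hn hmin (I.scope_subset C hC (t _).2)
      (I.scope_subset C hC x.2) (ht _)).eq hC hf (t _).2 x.2
  refine ⟨fun y => f (t y), ?_, h2⟩
  change (fun x : C.scope => f (t ⟨r x.1, _⟩)) ∈ C.rel
  rwa [show (fun x : C.scope => f (t ⟨r x.1, Set.mem_image_of_mem r x.2⟩)) = f from funext h2]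

/-- Entries are exchanged one at a time. Each exchange compares two tuples inside one scope, which
has to contain the old tuple together with one new variable; hence `k + 1 ≤ n`. -/
theorem proj_congr (hr : IsRepresentative I r) (hk : 2 ≤ k) (hn : 3 ≤ n) (hkn : k + 1 ≤ n)
    (hmin : I.Minimal k n) {j : ℕ} (hj : j ≤ k) {w w' : Fin j → V} (hw : ∀ i, w i ∈ I.vars)
    (hw' : ∀ i, w' i ∈ I.vars) (h : ∀ i, r (w i) = r (w' i)) : I.proj w = I.proj w' := by
  classical
  have key : ∀ T : Finset (Fin j), I.proj (fun i => if i ∈ T then w' i else w i) = I.proj w := by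
    intro T
    induction T using Finset.induction_on with
    | empty => simp
    | insert c T hc ih =>
      rw [← ih]
      set w₁ : Fin j → V := fun i => if i ∈ T then w' i else w i with hw₁
      set w₂ : Fin j → V := fun i => if i ∈ insert c T then w' i else w i with hw₂
      have hv₁ : ∀ i, w₁ i ∈ I.vars := fun i => by
        dsimp only [w₁]; split_ifs; exacts [hw' i, hw i]
      have hv₂ : ∀ i, w₂ i ∈ I.vars := fun i => by
        dsimp only [w₂]; split_ifs; exacts [hw' i, hw i]
      have hrr : ∀ i, r (w₁ i) = r (w₂ i) := fun i => by
        dsimp only [w₁, w₂]; split_ifs <;> simp [h i]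
      have hne : ∀ i, i ≠ c → w₂ i = w₁ i := fun i hi => by
        simp [w₁, w₂, Finset.mem_insert, hi]
      obtain ⟨D, hD, hvD⟩ := CSPInst.Covers.tuple hmin.1 (Nat.succ_pos j) (by omega)
        (Fin.cons (w₂ c) w₁ : Fin (j + 1) → V) (by
          intro i
          refine Fin.cases ?_ (fun i => ?_) i
          exacts [hv₂ c, hv₁ i])
      have hD₁ : ∀ i, w₁ i ∈ D.scope := fun i => hvD i.succ
      have hD₂ : ∀ i, w₂ i ∈ D.scope := fun i => by
        by_cases hi : i = c
        · subst hi; exact hvD 0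
        · rw [hne i hi]; exact hD₁ i
      rw [(hmin.mono hj le_rfl).proj_eq le_rfl hD hD₁, (hmin.mono hj le_rfl).proj_eq le_rfl hD hD₂]
      have heq : ∀ f ∈ D.rel, ∀ i, f ⟨w₁ i, hD₁ i⟩ = f ⟨w₂ i, hD₂ i⟩ := fun f hf i =>
        (hr.forcedEqual_of_eq hk hn hmin (hv₁ i) (hv₂ i) (hrr i)).eq hD hf _ _
      ext a
      constructor
      · rintro ⟨f, hf, _, ha⟩
        exact ⟨f, hf, hD₁, fun i => (ha i).trans (heq f hf i).symm⟩
      · rintro ⟨f, hf, _, ha⟩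
        exact ⟨f, hf, hD₂, fun i => (ha i).trans (heq f hf i)⟩
  have := key Finset.univ
  simpa using this.symm

theorem proj_rename_constraint (hr : IsRepresentative I r) (hk : 2 ≤ k) (hn : 3 ≤ n)
    (hkn : k + 1 ≤ n) (hmin : I.Minimal k n) {j : ℕ} (hj : j ≤ k) {C : Constraint V H}
    (hC : C ∈ I.cons) {v : Fin j → V} (hv : ∀ i, v i ∈ r '' C.scope) :
    (C.rename r).proj v = I.proj v := by
  choose w hw hwv using hv
  have hwI : ∀ i, w i ∈ I.vars := fun i => I.scope_subset C hC (hw i)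
  have hvI : ∀ i, v i ∈ I.vars := fun i => hwv i ▸ hr.mem _ (hwI i)
  rw [hr.proj_congr hk hn hkn hmin hj hvI hwI (fun i => by rw [← hwv i, hr.idem (hwI i)]),
    (hmin.mono hj le_rfl).proj_eq le_rfl hC hw]
  obtain rfl : v = fun i => r (w i) := funext fun i => (hwv i).symm
  ext a
  constructor
  · rintro ⟨g, hg, hv, ha⟩
    exact ⟨_, hg, hw, ha⟩
  · rintro ⟨f, hf, _, ha⟩
    obtain ⟨g, hg, hgf⟩ := hr.exists_factor hk hn hmin hC hf
    exact ⟨g, hg, fun i => Set.mem_image_of_mem r (hw i), fun i =>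
      (ha i).trans (hgf ⟨w i, hw i⟩).symm⟩

theorem covers_rename (hr : IsRepresentative I r) (hcov : I.Covers n) : (I.rename r).Covers n := by
  intro L hL hne hcard
  obtain ⟨C, hC, hLC⟩ := hcov L (hL.trans hr.vars_subset) hne hcard
  exact ⟨C.rename r, ⟨C, hC, rfl⟩, fun x hx => ⟨x, hLC hx, hr.apply_of_mem (hL hx)⟩⟩

theorem minimal_rename (hr : IsRepresentative I r) (hk : 2 ≤ k) (hn : 3 ≤ n)
    (hkn : k + 1 ≤ n) (hmin : I.Minimal k n) : (I.rename r).Minimal k n := by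
  refine ⟨hr.covers_rename hmin.1, ?_⟩
  rintro j hj v _ ⟨C, hC, rfl⟩ _ ⟨D, hD, rfl⟩ hv hv'
  exact (hr.proj_rename_constraint hk hn hkn hmin hj hC hv).trans
    (hr.proj_rename_constraint hk hn hkn hmin hj hD hv').symm

theorem proj_rename (hr : IsRepresentative I r) (hk : 2 ≤ k) (hn : 3 ≤ n)
    (hkn : k + 1 ≤ n) (hmin : I.Minimal k n) {j : ℕ} (hj0 : 0 < j) (hj : j ≤ k) {v : Fin j → V}
    (hv : ∀ i, v i ∈ (I.rename r).vars) : (I.rename r).proj v = I.proj v := by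
  have hmin' := hr.minimal_rename hk hn hkn hmin
  obtain ⟨D, hD, hvD⟩ := CSPInst.Covers.tuple hmin'.1 hj0 (by omega) v hv
  rw [(hmin'.mono hj le_rfl).proj_eq le_rfl hD hvD]
  obtain ⟨C, hC, rfl⟩ := hD
  exact hr.proj_rename_constraint hk hn hkn hmin hj hC hvD

theorem eq_of_forcedEqual_rename (hr : IsRepresentative I r) (hk : 2 ≤ k) (hn : 3 ≤ n)
    (hkn : k + 1 ≤ n) (hmin : I.Minimal k n) {x y : V} (hx : x ∈ (I.rename r).vars)
    (hy : y ∈ (I.rename r).vars) (h : ForcedEqual (I.rename r) x y) : x = y := by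
  rcases h with h | h
  · exact h
  rw [hr.proj_rename hk hn hkn hmin (by norm_num) hk (by intro i; fin_cases i <;> assumption)] at h
  rw [← hr.apply_of_mem hx, ← hr.apply_of_mem hy]
  exact hr.eq x (hr.vars_subset hx) y (hr.vars_subset hy) (Or.inr h)

theorem isInstanceOf_rename {LA : FirstOrder.Language} [LA.Structure H] (hI : I.IsInstanceOf LA) :
    (I.rename r).IsInstanceOf LA := by
  refine ⟨hI.1.image r, ?_⟩
  rintro _ ⟨C, hC, rfl⟩
  obtain ⟨hne, j, R, t, ht, hR⟩ := hI.2 C hC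
  refine ⟨hne.image r, j, R, fun i => ⟨r (t i), Set.mem_image_of_mem r (t i).2⟩, ?_, ?_⟩
  · rintro ⟨_, x, hx, rfl⟩
    obtain ⟨i, hi⟩ := ht ⟨x, hx⟩
    exact ⟨i, Subtype.ext (congrArg (fun z : C.scope => r z.1) hi)⟩
  · intro f
    exact hR _

theorem hasSolution_rename_iff (hr : IsRepresentative I r) (hn : 2 ≤ n) (hcov : I.Covers n) :
    (I.rename r).HasSolution ↔ I.HasSolution := by
  constructor
  · rintro ⟨s, hs⟩
    exact ⟨fun x => s ⟨r x, Set.mem_image_of_mem r x.2⟩, fun C hC => hs _ ⟨C, hC, rfl⟩⟩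
  · rintro ⟨s, hs⟩
    refine ⟨fun x => s ⟨x, hr.vars_subset x.2⟩, ?_⟩
    have key : ∀ x (hx : x ∈ I.vars), s ⟨r x, hr.mem x hx⟩ = s ⟨x, hx⟩ := by
      intro x hx
      obtain ⟨D, hD, hvD⟩ := CSPInst.Covers.tuple hcov (by norm_num) hn ![x, r x] (by
        intro i; fin_cases i; exacts [hx, hr.mem x hx])
      exact ((hr.forced x hx).eq hD (hs D hD) (hvD 0) (hvD 1)).symm
    rintro _ ⟨C, hC, rfl⟩
    change (fun x : C.scope => s ⟨r x, _⟩) ∈ C.rel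
    have := hs C hC
    rwa [show (fun x : C.scope => s ⟨x, I.scope_subset C hC x.2⟩) =
      fun x : C.scope => s ⟨r x, hr.mem x (I.scope_subset C hC x.2)⟩ from
      funext fun x => (key x _).symm] at this

/-- An assignment whose kernel is realized in a scope containing `x` and `r x` identifies them, so
it is compatible with the renaming. -/
theorem kernelSubdirect_rename [LinearOrder V] {ℓ : ℕ} (hr : IsRepresentative I r) (hk : 2 ≤ k) (hn : 3 ≤ n)
    (hkn : k + 1 ≤ n) (hmin : I.Minimal k n) (hℓ : 0 < ℓ) (hℓk : ℓ ≤ k)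
    (h : I.KernelSubdirect ℓ) : (I.rename r).KernelSubdirect ℓ := by
  intro v hv a ha hinj
  rw [hr.proj_rename hk hn hkn hmin hℓ hℓk hv] at ha
  obtain ⟨s, hsv, hs⟩ := h v (fun i => hr.vars_subset (hv i)) a ha hinj
  refine ⟨s, hsv, ?_⟩
  have key : ∀ x (hx : x ∈ I.vars), s (r x) = s x := by
    intro x hx
    obtain ⟨D, hD, hvD⟩ := CSPInst.Covers.tuple hmin.1 (by norm_num) (by omega : 2 ≤ n)
      ![x, r x] (by intro i; fin_cases i; exacts [hx, hr.mem x hx])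
    obtain ⟨f, hf, hfs⟩ := hs D hD
    exact (hfs ⟨r x, hvD 1⟩ ⟨x, hvD 0⟩).1 ((hr.forced x hx).eq hD hf (hvD 0) (hvD 1)).symm
  rintro _ ⟨C, hC, rfl⟩
  obtain ⟨f, hf, hfs⟩ := hs C hC
  obtain ⟨g, hg, hgf⟩ := hr.exists_factor hk hn hmin hC hf
  refine ⟨g, hg, ?_⟩
  rintro ⟨_, x, hx, rfl⟩ ⟨_, y, hy, rfl⟩
  have h1 := hgf ⟨x, hx⟩
  have h2 := hgf ⟨y, hy⟩
  have h3 : s (r x) = s (r y) ↔ s x = s y := by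
    rw [key x (I.scope_subset C hC hx), key y (I.scope_subset C hC hy)]
  exact (Iff.of_eq (congrArg₂ (· = ·) h1 h2)).trans ((hfs ⟨x, hx⟩ ⟨y, hy⟩).trans h3.symm)

/-- Renaming is not a shrinking of constraints; for termination it must either be void or remove a
variable. -/
theorem rename_eq_self_or (hr : IsRepresentative I r) :
    I.rename r = I ∨ (I.rename r).vars ⊂ I.vars := by
  rcases hr.vars_subset.eq_or_ssubset with h | h
  · left
    refine CSPInst.ext' h ?_
    have hid : ∀ x ∈ I.vars, r x = x := fun x hx => hr.apply_of_mem (h ▸ hx)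
    have hC : ∀ C ∈ I.cons, C.rename r = C := fun C hC =>
      Constraint.rename_eq_self fun x hx => hid x (I.scope_subset C hC hx)
    change Constraint.rename r '' I.cons = I.cons
    ext C
    constructor
    · rintro ⟨D, hD, rfl⟩
      rwa [hC D hD]
    · exact fun h => ⟨C, h, hC C h⟩
  · exact Or.inr h

end IsRepresentative

/-! ### Injective maps in the constraints once forced equalities are identified. -/

section Separation

variable {ℓ : ℕ} {K : Set (Bundled.{u} (hyperLang ℓ).Structure)} {b : ℕ}
  {H : Type u} [Countable H] [(hyperLang ℓ).Structure H] [LinearOrder H]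
  {V : Type*} {m : Op H 3} {p : Op H 2}

theorem exists_equiv_apply_eq (hℓ : 2 ≤ ℓ) (hK : FinitelyBoundedBy K b)
    (hlim : FirstOrder.Language.IsFraisseLimit (orderedClass K) H) (c d : H) :
    ∃ α : H ≃[hyperLang ℓ] H, α c = d := by
  have hno : ∀ (x : Fin 1 → H) (t : Fin ℓ → Fin 1), x ∘ t ∉ edgeSet ℓ H := by
    intro x t h
    have h1 := (isHypergraph_limit hK hlim).1 _ h
    have h2 : (⟨0, by omega⟩ : Fin ℓ) = ⟨1, by omega⟩ := h1 (congrArg x (Subsingleton.elim _ _))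
    simp at h2
  obtain ⟨α, hα⟩ := exists_equiv_of_sameType hK hlim (fun _ : Fin 1 => c) (fun _ => d)
    ⟨fun _ _ => by simp, fun t => iff_of_false (hno _ t) (hno _ t)⟩
  exact ⟨α, (hα 0).symm⟩

/-- If no two variables are forced to be equal, then every non-empty constraint contains an
injective map. -/
theorem exists_injective_of_not_forcedEqual (hℓ : 2 ≤ ℓ) (hK : FinitelyBoundedBy K b)
    (hlim : FirstOrder.Language.IsFraisseLimit (orderedClass K) H) (hp : Function.Injective p)
    {I : CSPInst V H} (hI : I.Tame ℓ m p) {k n : ℕ} (hk : 2 ≤ k) (hmin : I.Minimal k n)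
    (hforced : ∀ x ∈ I.vars, ∀ y ∈ I.vars, ForcedEqual I x y → x = y)
    {C : Constraint V H} (hC : C ∈ I.cons) (hne : C.rel.Nonempty) :
    ∃ f ∈ C.rel, Function.Injective f := by
  classical
  -- If all maps of `C` identified `x` and `y`, then by transitivity of the automorphism group the
  -- projection to the pair would be the whole equality relation.
  have hsep : ∀ x y : C.scope, x ≠ y → ∃ f ∈ C.rel, f x ≠ f y := by
    intro x y hxy
    by_contra! hcon
    refine hxy (Subtype.ext (hforced x (I.scope_subset C hC x.2) y (I.scope_subset C hC y.2)
      (Or.inr ?_)))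
    rw [(hmin.mono hk le_rfl).proj_eq le_rfl hC (by intro i; fin_cases i; exacts [x.2, y.2])]
    ext a
    constructor
    · rintro ⟨f, hf, hv, ha⟩
      exact (ha 0).trans ((hcon f hf).trans (ha 1).symm)
    · intro ha
      obtain ⟨f, hf⟩ := hne
      obtain ⟨α, hα⟩ := exists_equiv_apply_eq hℓ hK hlim (f x) (a 0)
      refine ⟨_, (hI.2 C hC).2.aut α hf, by intro i; fin_cases i; exacts [x.2, y.2], fun i => ?_⟩
      fin_cases i
      · exact hα.symm
      · change a 1 = α (f y)
        rw [← hcon f hf, hα]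
        exact Eq.symm ha
  have hfin := (hI.1.subset (I.scope_subset C hC)).to_subtype
  have := Fintype.ofFinite C.scope
  -- As `p` is injective, `p(f, g)` separates every pair that `f` or `g` separates.
  have key : ∀ T : Finset (C.scope × C.scope), ∃ f ∈ C.rel, ∀ e ∈ T, e.1 ≠ e.2 → f e.1 ≠ f e.2 := by
    intro T
    induction T using Finset.induction_on with
    | empty =>
      obtain ⟨f, hf⟩ := hne
      exact ⟨f, hf, by simp⟩
    | insert e T _ ih =>
      obtain ⟨f, hf, hfT⟩ := ih
      by_cases he : e.1 = e.2
      · refine ⟨f, hf, fun e' he' hne' => ?_⟩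
        rcases Finset.mem_insert.1 he' with rfl | he'
        · exact absurd he hne'
        · exact hfT e' he' hne'
      obtain ⟨g, hg, hge⟩ := hsep e.1 e.2 he
      refine ⟨_, (hI.2 C hC).2.bin hf hg, fun e' he' hne' h => ?_⟩
      have h' := hp h
      rcases Finset.mem_insert.1 he' with rfl | he'
      · exact hge (congrFun h' 1)
      · exact hfT e' he' hne' (congrFun h' 0)
  obtain ⟨f, hf, h⟩ := key Finset.univ
  exact ⟨f, hf, fun x y hxy => by_contra fun hne => h (x, y) (Finset.mem_univ _) hne hxy⟩

end Separation

/-! ## Solutions of the injective finitisation -/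

/-- The value of a partial assignment on a tuple of variables in its domain. -/
abbrev tup {X B : Type*} {U : Set X} {k : ℕ} (f : U → B) (v : Fin k → X) (h : ∀ i, v i ∈ U) :
    Fin k → B :=
  fun i => f ⟨v i, h i⟩

section Combine

variable {ℓ : ℕ} {K : Set (Bundled.{u} (hyperLang ℓ).Structure)} {b : ℕ}
  {H : Type u} [Countable H] [(hyperLang ℓ).Structure H] [LinearOrder H]
  {V : Type*} [LinearOrder V] {m : Op H 3} {p : Op H 2}

theorem orb_of_injective (hK : FinitelyBoundedBy K b)
    (hlim : FirstOrder.Language.IsFraisseLimit (orderedClass K) H) {x : Fin ℓ → H}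
    (hx : Function.Injective x) :
    (x ∈ edgeSet ℓ H ∧ orb ℓ x = edgeSet ℓ H) ∨ (x ∉ edgeSet ℓ H ∧ orb ℓ x = nonEdgeSet ℓ H) := by
  have hH := isHypergraph_limit hK hlim
  have h1 : ∀ y, y ∈ orb ℓ x ↔ Function.Injective y ∧ (x ∈ edgeSet ℓ H ↔ y ∈ edgeSet ℓ H) := by
    intro y
    rw [mem_orb_iff hK hlim]
    refine ⟨fun h => ⟨fun i j hij => hx ((h.1 i j).2 hij), h.2 id⟩, fun h =>
      sameType_of_injective hH hx h.1 h.2⟩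
  by_cases hxE : x ∈ edgeSet ℓ H
  · refine Or.inl ⟨hxE, Set.ext fun y => ?_⟩
    rw [h1]
    exact ⟨fun h => h.2.1 hxE, fun h => ⟨hH.1 y h, by simp [hxE, h]⟩⟩
  · refine Or.inr ⟨hxE, Set.ext fun y => ?_⟩
    rw [h1]
    exact ⟨fun h => ⟨h.1, fun h' => hxE (h.2.2 h')⟩, fun h => ⟨h.1, by simp [hxE, h.2]⟩⟩

theorem mem_edgeSet_iff_of_mem_orb {H : Type*} [(hyperLang ℓ).Structure H] {x y : Fin ℓ → H}
    (h : x ∈ orb ℓ y) : x ∈ edgeSet ℓ H ↔ y ∈ edgeSet ℓ H := by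
  obtain ⟨α, hα⟩ := h
  rw [show x = fun i => α (y i) from funext hα]
  exact mem_edgeSet_equiv α y

theorem mem_edgeSet_iff_of_orbLT_eq {H : Type*} [(hyperLang ℓ).Structure H] [LinearOrder H]
    {x y : Fin ℓ → H} (h : orbLT ℓ x = orbLT ℓ y) : x ∈ edgeSet ℓ H ↔ y ∈ edgeSet ℓ H :=
  (sameType_of_orbLT_eq h).1.2 id

theorem app_pair {H : Type*} (p : Op H 2) {k : ℕ} (x y : Fin k → H) :
    p.app ![x, y] = fun i => p ![x i, y i] := by
  funext j
  refine congrArg p (funext fun i => ?_)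
  fin_cases i <;> rfl

theorem orbLT_app_pair {H : Type*} [(hyperLang ℓ).Structure H] [LinearOrder H] {p : Op H 2} (hp : p.IsCanonical ℓ) {k : ℕ} {x y x' y' : Fin k → H}
    (hx : orbLT ℓ x = orbLT ℓ x') (hy : orbLT ℓ y = orbLT ℓ y') :
    orbLT ℓ (p.app ![x, y]) = orbLT ℓ (p.app ![x', y']) :=
  hp k _ _ (by intro i; fin_cases i <;> assumption)

theorem orbLT_eq_of_strictMono (hK : FinitelyBoundedBy K b)
    (hlim : FirstOrder.Language.IsFraisseLimit (orderedClass K) H) {x y : Fin ℓ → H}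
    (hx : StrictMono x) (hy : StrictMono y) (h : x ∈ edgeSet ℓ H ↔ y ∈ edgeSet ℓ H) :
    orbLT ℓ x = orbLT ℓ y :=
  orbLT_eq_of_sameType hlim (sameType_of_injective (isHypergraph_limit hK hlim) hx.injective
    hy.injective h) fun i j => by rw [hx.lt_iff_lt, hy.lt_iff_lt]

/-- A reordering of the values of an assignment `s` such that the values on a given tuple `w` with
deterministic orbit are ordered as in the definition of determinism. -/
theorem exists_good_order {V H : Type*} [(hyperLang ℓ).Structure H] [LinearOrder H] {p : Op H 2}
    {s : V → H} {w : Fin ℓ → V} {a : Fin ℓ → H}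
    (hker : ∀ i j, a i = a j ↔ s (w i) = s (w j))
    (hdet : Function.Injective a ∨ IsDeterministic ℓ p (orb ℓ a)) :
    ∃ c : V → H, (∀ x y, c x = c y ↔ s x = s y) ∧ (Function.Injective a ∨
      ∀ e ∈ edgeSet ℓ H, ∀ n ∈ nonEdgeSet ℓ H, StrictMono e → StrictMono n →
        orbLT ℓ (p.app ![fun i => c (w i), e]) = orbLT ℓ (p.app ![fun i => c (w i), n])) := by
  rcases hdet with h | h
  · exact ⟨s, fun _ _ => Iff.rfl, Or.inl h⟩
  · obtain ⟨α, hα⟩ := h a (mem_orb_self a)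
    -- A permutation that carries the values of `s` on `w` to the ordered tuple witnessing
    -- determinism; it need not preserve edges, as only the order is used.
    obtain ⟨γ, hγ⟩ := exists_perm_of_kernel (fun i => s (w i)) (fun i => α (a i))
      fun i j => by rw [α.injective.eq_iff]; exact (hker i j).symm
    refine ⟨fun x => γ (s x), fun x y => γ.injective.eq_iff, Or.inr ?_⟩
    rwa [show (fun i => γ (s (w i))) = fun i => α (a i) from funext fun i => (hγ i).symm]

variable {I : CSPInst V H} {S : Set (Fin ℓ ↪o V)} {s : V → H}
  {F : ∀ C : Constraint V H, C ∈ I.cons → C.scope → H}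

/-- Induction on the tuples whose edge status has been made independent of the constraint. Each step
composes with `p`, using the given family `F` as first argument; increasing maps ensure that the
values on increasing tuples have at most two ordered orbits. -/
theorem exists_independent_family (hK : FinitelyBoundedBy K b)
    (hlim : FirstOrder.Language.IsFraisseLimit (orderedClass K) H) (hp : IsLexProjection ℓ p)
    (hI : I.Tame ℓ m p) (hne : ∀ C ∈ I.cons, ∃ f ∈ C.rel, Function.Injective f)
    (hcov : ∀ v ∈ S, ∃ C ∈ I.cons, ∀ i, v i ∈ C.scope)
    (hF : ∀ C hC, F C hC ∈ C.rel)
    (hker : ∀ C hC, ∀ x y : C.scope, F C hC x = F C hC y ↔ s x = s y)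
    (hstat : ∀ v ∈ S, ∀ C hC D hD, ∀ (hv : ∀ i, v i ∈ C.scope) (hv' : ∀ i, v i ∈ D.scope),
      tup (F C hC) v hv ∈ edgeSet ℓ H ↔ tup (F D hD) v hv' ∈ edgeSet ℓ H)
    (hdet : ∀ v ∈ S, ∀ C hC, ∀ hv : ∀ i, v i ∈ C.scope,
      Function.Injective (tup (F C hC) v hv) ∨ IsDeterministic ℓ p (orb ℓ (tup (F C hC) v hv)))
    (l : List (Fin ℓ ↪o V)) (hl : ∀ v ∈ l, v ∈ S) :
    ∃ G : ∀ C : Constraint V H, C ∈ I.cons → C.scope → H,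
      (∀ C hC, G C hC ∈ C.rel ∧ StrictMono (G C hC)) ∧
      ∀ v ∈ l, ∀ C hC D hD, ∀ (hv : ∀ i, v i ∈ C.scope) (hv' : ∀ i, v i ∈ D.scope),
        tup (G C hC) v hv ∈ edgeSet ℓ H ↔ tup (G D hD) v hv' ∈ edgeSet ℓ H := by
  have hfin : ∀ C ∈ I.cons, Finite C.scope := fun C hC =>
    (hI.1.subset (I.scope_subset C hC)).to_subtype
  induction l with
  | nil =>
    have h1 : ∀ C : Constraint V H, C ∈ I.cons → ∃ g : C.scope → H, g ∈ C.rel ∧ StrictMono g := by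
      intro C hC
      obtain ⟨h, hh, hinj⟩ := hne C hC
      have := hfin C hC
      obtain ⟨α, hα⟩ := exists_equiv_order hK hlim h (fun x : C.scope => x.1)
        fun x y => by rw [hinj.eq_iff, Subtype.ext_iff]
      exact ⟨_, (hI.2 C hC).2.aut α hh, fun x y hxy => (hα x y).2 hxy⟩
    choose G hG using h1
    exact ⟨G, hG, by simp⟩
  | cons w l ih =>
    obtain ⟨G, hG, hGl⟩ := ih fun v hv => hl v (by simp [hv])
    have hw : w ∈ S := hl w (by simp)
    obtain ⟨C₀, hC₀, hwC₀⟩ := hcov w hw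
    -- A single order `c` serves all constraints, so that a non-injective value of the reordered `F`
    -- has the same ordered orbit everywhere.
    obtain ⟨c, hc, hgood⟩ := exists_good_order (s := s) (w := w) (p := p)
      (fun i j => hker C₀ hC₀ ⟨w i, hwC₀ i⟩ ⟨w j, hwC₀ j⟩) (hdet w hw C₀ hC₀ hwC₀)
    have h1 : ∀ C : Constraint V H, ∀ hC : C ∈ I.cons, ∃ α : H ≃[hyperLang ℓ] H,
        ∀ x y : C.scope, α (F C hC x) < α (F C hC y) ↔ c x < c y := by
      intro C hC
      have := hfin C hC
      exact exists_equiv_order hK hlim (F C hC) (fun x : C.scope => c x) fun x y => by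
        rw [hker C hC, hc]
    choose α hα using h1
    -- The order of the new maps is governed by the second argument of `p`, so they remain strictly
    -- increasing.
    refine ⟨fun C hC x => p ![α C hC (F C hC x), G C hC x], fun C hC => ⟨?_, ?_⟩, ?_⟩
    · exact (hI.2 C hC).2.bin ((hI.2 C hC).2.aut _ (hF C hC)) (hG C hC).1
    · exact fun x y hxy => hp.lex _ _ _ _ (Or.inl ((hG C hC).2 hxy))
    intro v hv C hC D hD hvC hvD
    have hvS := hl v hv
    have happ : ∀ C hC, ∀ hvC : ∀ i, v i ∈ C.scope,
        tup (fun x => p ![α C hC (F C hC x), G C hC x]) v hvC =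
          p.app ![fun i => α C hC (tup (F C hC) v hvC i), tup (G C hC) v hvC] := fun C hC hvC =>
      (app_pair p _ _).symm
    rw [happ C hC hvC, happ D hD hvD]
    have hmono : ∀ C hC, ∀ hvC : ∀ i, v i ∈ C.scope, StrictMono (tup (G C hC) v hvC) :=
      fun C hC hvC i j hij => (hG C hC).2 (v.strictMono hij)
    have hkerv : ∀ i j, tup (F C hC) v hvC i = tup (F C hC) v hvC j ↔
        tup (F D hD) v hvD i = tup (F D hD) v hvD j := fun i j =>
      (hker C hC _ _).trans (hker D hD ⟨v i, hvD i⟩ ⟨v j, hvD j⟩).symm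
    by_cases hinj : Function.Injective (tup (F C hC) v hvC)
    · have hinj' : Function.Injective (tup (F D hD) v hvD) := fun i j hij =>
        hinj ((hkerv i j).2 hij)
      have key : ∀ C hC, ∀ hvC : ∀ i, v i ∈ C.scope, Function.Injective (tup (F C hC) v hvC) →
          (p.app ![fun i => α C hC (tup (F C hC) v hvC i), tup (G C hC) v hvC] ∈ edgeSet ℓ H ↔
            tup (F C hC) v hvC ∈ edgeSet ℓ H) := by
        intro C hC hvC hinj
        have h2 := hp.first (fun i => α C hC (tup (F C hC) v hvC i))
          ((α C hC).injective.comp hinj) _ (hmono C hC hvC).injective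
        exact (mem_edgeSet_iff_of_mem_orb (h2 ▸ mem_orb_self _)).trans
          (mem_edgeSet_equiv (α C hC) _)
      rw [key C hC hvC hinj, key D hD hvD hinj', hstat v hvS C hC D hD hvC hvD]
    · have hord : ∀ C hC, ∀ hvC : ∀ i, v i ∈ C.scope,
          ¬ Function.Injective (tup (F C hC) v hvC) →
          orbLT ℓ (fun i => α C hC (tup (F C hC) v hvC i)) = orbLT ℓ fun i => c (v i) := by
        intro C hC hvC hinj
        refine orbLT_eq_of_sameType hlim (sameType_of_not_injective (isHypergraph_limit hK hlim)
          (fun h => hinj fun i j hij => h (congrArg (α C hC) hij)) fun i j => ?_) fun i j =>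
            hα C hC _ _
        rw [(α C hC).injective.eq_iff, hker C hC, hc]
      have hinj' : ¬ Function.Injective (tup (F D hD) v hvD) := fun h => hinj fun i j hij =>
        h ((hkerv i j).1 hij)
      have hA := hord C hC hvC hinj
      have hB := hord D hD hvD hinj'
      suffices orbLT ℓ (p.app ![fun i => c (v i), tup (G C hC) v hvC]) =
          orbLT ℓ (p.app ![fun i => c (v i), tup (G D hD) v hvD]) by
        refine mem_edgeSet_iff_of_orbLT_eq ?_
        rw [orbLT_app_pair hp.canonical hA rfl, orbLT_app_pair hp.canonical hB rfl, this]
      by_cases hst : tup (G C hC) v hvC ∈ edgeSet ℓ H ↔ tup (G D hD) v hvD ∈ edgeSet ℓ H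
      · exact orbLT_app_pair hp.canonical rfl
          (orbLT_eq_of_strictMono hK hlim (hmono C hC hvC) (hmono D hD hvD) hst)
      -- The status of `G` can still vary with the constraint only at the new tuple; there the
      -- choice of `c` and determinism absorb the difference.
      rcases List.mem_cons.1 hv with rfl | hvl
      · have hg := hgood.resolve_left fun h => hinj fun i j hij => h
          ((hker C₀ hC₀ _ _).2 ((hker C hC ⟨v i, hvC i⟩ ⟨v j, hvC j⟩).1 hij))
        by_cases hE : tup (G C hC) v hvC ∈ edgeSet ℓ H
        · exact hg _ hE _ ⟨(hmono D hD hvD).injective, fun h => hst (iff_of_true hE h)⟩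
            (hmono C hC hvC) (hmono D hD hvD)
        · refine (hg _ (by_contra fun h => hst (iff_of_false hE h)) _
            ⟨(hmono C hC hvC).injective, hE⟩ (hmono D hD hvD) (hmono C hC hvC)).symm
      · exact absurd (hGl v hvl C hC D hD hvC hvD) hst

/-- A coherent family of maps in the constraints, whose values on the tuples in `S` are injective or
have deterministic orbits, yields a solution of the injective finitisation on `S`. -/
theorem hasSolution_injFinOn (hK : FinitelyBoundedBy K b)
    (hlim : FirstOrder.Language.IsFraisseLimit (orderedClass K) H) (hp : IsLexProjection ℓ p)
    (hI : I.Tame ℓ m p) (hne : ∀ C ∈ I.cons, ∃ f ∈ C.rel, Function.Injective f)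
    (hS : S.Finite) (hcov : ∀ v ∈ S, ∃ C ∈ I.cons, ∀ i, v i ∈ C.scope)
    (hF : ∀ C hC, F C hC ∈ C.rel)
    (hker : ∀ C hC, ∀ x y : C.scope, F C hC x = F C hC y ↔ s x = s y)
    (hstat : ∀ v ∈ S, ∀ C hC D hD, ∀ (hv : ∀ i, v i ∈ C.scope) (hv' : ∀ i, v i ∈ D.scope),
      tup (F C hC) v hv ∈ edgeSet ℓ H ↔ tup (F D hD) v hv' ∈ edgeSet ℓ H)
    (hdet : ∀ v ∈ S, ∀ C hC, ∀ hv : ∀ i, v i ∈ C.scope,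
      Function.Injective (tup (F C hC) v hv) ∨ IsDeterministic ℓ p (orb ℓ (tup (F C hC) v hv))) :
    (I.injFinOn ℓ S).HasSolution := by
  obtain ⟨G, hG, hstG⟩ := exists_independent_family hK hlim hp hI hne hcov hF hker hstat hdet
    hS.toFinset.toList (by simp)
  choose C₀ hC₀ hvC₀ using hcov
  refine ⟨fun v => ⟨orb ℓ (tup (G (C₀ v.1 v.2) (hC₀ v.1 v.2)) v.1 (hvC₀ v.1 v.2)), _, rfl⟩, ?_⟩
  rintro _ ⟨_, ⟨_, ⟨C, hC, rfl⟩, rfl⟩, rfl⟩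
  have hinj : ∀ C hC, ∀ v : Fin ℓ ↪o V, ∀ hvC : ∀ i, v i ∈ C.scope,
      Function.Injective (tup (G C hC) v hvC) := fun C hC v hvC =>
    StrictMono.injective fun i j hij => (hG C hC).2 (v.strictMono hij)
  refine ⟨fun v => ⟨orb ℓ (tup (G C hC) v.1 v.2), _, rfl⟩,
    ⟨⟨G C hC, (hG C hC).1, fun v => mem_orb_self _⟩, fun v => ?_⟩, fun v => Subtype.ext ?_⟩
  · rcases orb_of_injective hK hlim (hinj C hC v.1 v.2) with h | h
    · exact Or.inl h.2
    · exact Or.inr h.2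
  · refine orb_eq_of_mem ((mem_orb_iff hK hlim _ _).2 ?_)
    exact sameType_of_injective (isHypergraph_limit hK hlim) (hinj C hC v.1 v.2.1)
      (hinj _ _ _ _) (hstG v.1 (by simpa using v.2.2) _ _ _ _ v.2.1 _)

end Combine

/-! ## Partitions of projections -/

theorem mem_proj_append {X B : Type*} {I : CSPInst X B} {j k : ℕ} {v : Fin j → X} {w : Fin k → X}
    {a : Fin j → B} {c : Fin k → B} : Fin.append a c ∈ I.proj (Fin.append v w) ↔
      ∃ C ∈ I.cons, ∃ f ∈ C.rel, ∃ (hv : ∀ i, v i ∈ C.scope) (hw : ∀ i, w i ∈ C.scope),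
        a = tup f v hv ∧ c = tup f w hw := by
  rw [CSPInst.mem_proj]
  constructor
  · rintro ⟨C, hC, f, hf, h, ha⟩
    have hv : ∀ i, v i ∈ C.scope := fun i => by simpa using h (Fin.castAdd k i)
    have hw : ∀ i, w i ∈ C.scope := fun i => by simpa using h (Fin.natAdd j i)
    refine ⟨C, hC, f, hf, hv, hw, funext fun i => ?_, funext fun i => ?_⟩
    · simpa using ha (Fin.castAdd k i)
    · simpa using ha (Fin.natAdd j i)
  · rintro ⟨C, hC, f, hf, hv, hw, rfl, rfl⟩
    refine ⟨C, hC, f, hf, fun i => ?_, fun i => ?_⟩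
    · refine Fin.addCases (fun i => ?_) (fun i => ?_) i
      · simpa using hv i
      · simpa using hw i
    · refine Fin.addCases (fun i => ?_) (fun i => ?_) i <;> simp

theorem CSPInst.Covers.pair {X B : Type*} {I : CSPInst X B} {n : ℕ} (h : I.Covers n) {j k : ℕ}
    (hj : 0 < j) (hn : j + k ≤ n) {v : Fin j → X} {w : Fin k → X} (hv : ∀ i, v i ∈ I.vars)
    (hw : ∀ i, w i ∈ I.vars) : ∃ C ∈ I.cons, (∀ i, v i ∈ C.scope) ∧ ∀ i, w i ∈ C.scope := by
  obtain ⟨C, hC, h⟩ := h.tuple (k := j + k) (by omega) hn (Fin.append v w) (fun i => by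
    refine Fin.addCases (fun i => ?_) (fun i => ?_) i
    · simpa using hv i
    · simpa using hw i)
  exact ⟨C, hC, fun i => by simpa using h (Fin.castAdd k i),
    fun i => by simpa using h (Fin.natAdd j i)⟩

section Partition

variable {ℓ : ℕ} {H : Type*} [(hyperLang ℓ).Structure H] {V : Type*} {m : Op H 3} {p : Op H 2}
  {LA : FirstOrder.Language} [LA.Structure H] {N : ℕ}

/-- An automorphism of the hypergraph, as an automorphism of the template. -/
def IsTemplate.equiv [LA.IsRelational] (hT : IsTemplate ℓ V LA m p N) (α : H ≃[hyperLang ℓ] H) :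
    H ≃[LA] H where
  toEquiv := α.toEquiv
  map_fun' := fun {_} f => isEmptyElim f
  map_rel' := fun {k} r x => by
    refine ⟨fun h => ?_, fun h => (hT.invariant k r).aut α h⟩
    have := (hT.invariant k r).aut α.symm h
    rwa [show (fun i => α.symm ((α.toEquiv.toFun ∘ x) i)) = x from
      funext fun i => α.symm_apply_apply (x i)] at this

theorem PPDefinable.orb_subset [LA.IsRelational] (hT : IsTemplate ℓ V LA m p N) {k : ℕ}
    {R : Set (Fin k → H)} (hR : PPDefinable LA R) {a : Fin k → H} (ha : a ∈ R) : orb ℓ a ⊆ R := by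
  rintro c ⟨α, hα⟩
  obtain ⟨n, Φ, -, h⟩ := hR
  obtain ⟨d, hd⟩ := (h a).1 ha
  refine (h c).2 ⟨fun i => α (d i), fun φ hφ => ?_⟩
  have h1 := (FirstOrder.Language.StrongHomClass.realize_formula (hT.equiv α) φ).2 (hd φ hφ)
  convert h1 using 1
  funext x
  cases x with
  | inl i => exact hα i
  | inr i => rfl

end Partition

theorem mem_transport {ℓ : ℕ} {V H : Type*} [LinearOrder V] {I : CSPInst V H} {v w : Fin ℓ ↪o V} {E : Set (Fin ℓ → H)} {a : Fin ℓ → H} :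
    a ∈ transport I v w E ↔ ∃ C ∈ I.cons, ∃ f ∈ C.rel, ∃ (hv : ∀ i, v i ∈ C.scope)
      (hw : ∀ i, w i ∈ C.scope), tup f v hv ∈ E ∧ a = tup f w hw := by
  constructor
  · rintro ⟨c, hc, h⟩
    obtain ⟨C, hC, f, hf, hv, hw, rfl, rfl⟩ := mem_proj_append.1 h
    exact ⟨C, hC, f, hf, hv, hw, hc, rfl⟩
  · rintro ⟨C, hC, f, hf, hv, hw, hc, rfl⟩
    exact ⟨_, hc, mem_proj_append.2 ⟨C, hC, f, hf, hv, hw, rfl, rfl⟩⟩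

section System

variable {ℓ : ℕ} {K : Set (Bundled.{u} (hyperLang ℓ).Structure)} {b : ℕ}
  {H : Type u} [(hyperLang ℓ).Structure H] [LinearOrder H]
  {V : Type*} [LinearOrder V] {m : Op H 3} {p : Op H 2} {LA : FirstOrder.Language}
  [LA.Structure H] {N : ℕ} {I : CSPInst V H}

/-- The invariants of the procedure ExtendPartition. -/
structure PartSystem (p : Op H 2) (I : CSPInst V H) {s : ℕ} (S : Set (Fin ℓ ↪o V))
    (E : (Fin ℓ ↪o V) → Fin (s + 1) → Set (Fin ℓ → H)) : Prop where
  sub : ∀ v ∈ S, v ∈ incTuples ℓ I.vars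
  disjoint : ∀ v ∈ S, ∀ i j, i ≠ j → Disjoint (E v i) (E v j)
  union : ∀ v ∈ S, ∀ a, a ∈ I.proj v ↔ ∃ i, a ∈ E v i
  aut : ∀ v ∈ S, ∀ i, ∀ a ∈ E v i, orb ℓ a ⊆ E v i
  inj : ∀ v ∈ S, ∀ a ∈ I.proj v, Function.Injective a → a ∈ E v 0
  nonDet : ∀ v ∈ S, NoNonDeterministic ℓ p (E v 0)
  coherent : ∀ F : ∀ C : Constraint V H, C ∈ I.cons → C.scope → H, (∀ C hC, F C hC ∈ C.rel) →
    (∀ v ∈ S, ∀ C hC D hD, ∀ (hv : ∀ i, v i ∈ C.scope) (hv' : ∀ i, v i ∈ D.scope), ∀ i,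
      tup (F C hC) v hv ∈ E v i → tup (F D hD) v hv' ∈ E v i) →
    ∃ i, ∀ v ∈ S, ∀ C hC, ∀ hv : ∀ i, v i ∈ C.scope, tup (F C hC) v hv ∈ E v i

theorem tup_mem_proj {X B : Type*} {I : CSPInst X B} {C : Constraint X B} (hC : C ∈ I.cons)
    {f : C.scope → B} (hf : f ∈ C.rel) {k : ℕ} {v : Fin k → X} (hv : ∀ i, v i ∈ C.scope) :
    tup f v hv ∈ I.proj v :=
  CSPInst.mem_proj.2 ⟨C, hC, f, hf, hv, fun _ => rfl⟩

theorem partSystem_singleton [LA.IsRelational] (hT : IsTemplate ℓ V LA m p N) (hcov : I.Covers N)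
    {u : Fin ℓ ↪o V} (hu : u ∈ incTuples ℓ I.vars) {s : ℕ} {E : Fin (s + 1) → Set (Fin ℓ → H)}
    (hE : IsAdmissiblePartition ℓ LA p I u E) : PartSystem p I {u} fun _ => E where
  sub := by rintro _ rfl; exact hu
  disjoint := fun _ _ => hE.disjoint
  union := by
    rintro _ rfl a
    rw [← hE.union, Set.mem_iUnion]
  aut := fun _ _ i _ ha => (hE.ppDefinable i).orb_subset hT ha
  inj := by
    rintro _ rfl a ha hinj
    exact hE.inj_subset ⟨ha, hinj⟩
  nonDet := fun _ _ => hE.noNonDet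
  coherent := by
    intro F hF hco
    have hℓ := hT.three_le
    have hN := hT.le_cover
    obtain ⟨C, hC, hv⟩ := CSPInst.Covers.tuple hcov (by omega : 0 < ℓ) (by omega) u hu
    have h1 := tup_mem_proj hC (hF C hC) hv
    rw [← hE.union, Set.mem_iUnion] at h1
    obtain ⟨i, hi⟩ := h1
    refine ⟨i, ?_⟩
    intro v hvu D hD hv'
    obtain rfl : v = u := hvu
    exact hco v rfl C hC D hD hv hv' i hi

/-- Composing `f` with an injective map through `p` gives an injective map whose value on `w` stays
in the same orbit; an automorphism then restores the value itself. -/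
theorem exists_injective_extension (hp : IsLexProjection ℓ p) (hI : I.Tame ℓ m p)
    (hne : ∀ C ∈ I.cons, ∃ f ∈ C.rel, Function.Injective f) {C : Constraint V H} (hC : C ∈ I.cons)
    {f : C.scope → H} (hf : f ∈ C.rel) {w : Fin ℓ ↪o V} (hw : ∀ i, w i ∈ C.scope)
    (hinj : Function.Injective (tup f w hw)) :
    ∃ g ∈ C.rel, Function.Injective g ∧ tup g w hw = tup f w hw := by
  obtain ⟨h, hh, hhinj⟩ := hne C hC
  have hwinj : Function.Injective (tup h w hw) := fun i j hij =>
    w.injective (congrArg Subtype.val (hhinj hij))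
  have h1 := hp.first _ hinj _ hwinj
  rw [app_pair] at h1
  obtain ⟨α, hα⟩ : tup f w hw ∈ orb ℓ (fun i => p ![tup f w hw i, tup h w hw i]) :=
    h1 ▸ mem_orb_self _
  refine ⟨_, (hI.2 C hC).2.aut α ((hI.2 C hC).2.bin hf hh), fun x y hxy => ?_, ?_⟩
  · exact hhinj (congrFun (hp.injective (α.injective hxy)) 1)
  · exact funext fun i => (hα i).symm

/-- Coherence passes from `v` to `w` inside a scope containing both, by the definition of the
transported classes. An injective value at `w` is taken by an injective map, whose value at `v` lies
in the distinguished class; so the value at `w` does too. -/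
theorem PartSystem.step (hℓ : 0 < ℓ) (hN : 2 * ℓ ≤ N) (hp : IsLexProjection ℓ p)
    (hI : I.Tame ℓ m p) (hmin : I.Minimal (2 * ℓ) N)
    (hne : ∀ C ∈ I.cons, ∃ f ∈ C.rel, Function.Injective f) {s : ℕ} {σ τ : PartState ℓ V H s}
    (hσ : PartSystem p I σ.1 σ.2) (h : ExtendStep ℓ p I σ τ) : PartSystem p I τ.1 τ.2 := by
  classical
  obtain ⟨v, hv, w, hw, hwσ, hdisj, hnd, rfl⟩ := h
  have hupd : ∀ x ∈ σ.1, ∀ A : Fin (s + 1) → Set (Fin ℓ → H),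
      Function.update σ.2 w A x = σ.2 x := by
    intro x hx A
    rw [Function.update_of_ne]
    rintro rfl
    exact hwσ hx
  have hvI := hσ.sub v hv
  obtain ⟨D, hD, hvD, hwD⟩ := CSPInst.Covers.pair hmin.1 hℓ (by omega) hvI hw
  have hprojw : I.proj w = D.proj w := (hmin.mono (by omega : ℓ ≤ 2 * ℓ) le_rfl).proj_eq le_rfl hD hwD
  have hall : ∀ (P : (Fin ℓ ↪o V) → (Fin (s + 1) → Set (Fin ℓ → H)) → Prop),
      (∀ x ∈ σ.1, P x (σ.2 x)) → P w (fun t => transport I v w (σ.2 v t)) →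
      ∀ x ∈ insert w σ.1,
        P x (Function.update σ.2 w (fun t => transport I v w (σ.2 v t)) x) := by
    intro P h1 h2 x hx
    rcases hx with rfl | hx
    · rwa [Function.update_self]
    · rw [hupd x hx]
      exact h1 x hx
  refine ⟨?_, ?_, ?_, ?_, ?_, ?_, ?_⟩
  · rintro x (rfl | hx)
    exacts [hw, hσ.sub x hx]
  · refine hall (fun x E => ∀ i j, i ≠ j → Disjoint (E i) (E j)) hσ.disjoint ?_
    convert hdisj
  · refine hall (fun x E => ∀ a, a ∈ I.proj x ↔ ∃ i, a ∈ E i) hσ.union fun a => ⟨fun ha => ?_, ?_⟩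
    · rw [hprojw] at ha
      obtain ⟨f, hf, _, ha⟩ := ha
      obtain ⟨i, hi⟩ := (hσ.union v hv _).1 (tup_mem_proj hD hf hvD)
      exact ⟨i, mem_transport.2 ⟨D, hD, f, hf, hvD, hwD, hi, funext ha⟩⟩
    · rintro ⟨i, hi⟩
      obtain ⟨C, hC, f, hf, -, hwC, -, rfl⟩ := mem_transport.1 hi
      exact tup_mem_proj hC hf hwC
  · refine hall (fun x E => ∀ i, ∀ a ∈ E i, orb ℓ a ⊆ E i) hσ.aut ?_
    rintro i a ha c ⟨α, hα⟩
    obtain ⟨C, hC, f, hf, hvC, hwC, hE, rfl⟩ := mem_transport.1 ha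
    refine mem_transport.2 ⟨C, hC, _, (hI.2 C hC).2.aut α hf, hvC, hwC, ?_, funext hα⟩
    exact hσ.aut v hv i _ hE ⟨α, fun _ => rfl⟩
  · refine hall (fun x E => ∀ a ∈ I.proj x, Function.Injective a → a ∈ E 0) hσ.inj ?_
    intro a ha hinj
    rw [hprojw] at ha
    obtain ⟨f, hf, _, ha⟩ := ha
    obtain rfl : a = tup f w hwD := funext ha
    obtain ⟨g, hg, hginj, hgf⟩ := exists_injective_extension hp hI hne hD hf hwD hinj
    refine mem_transport.2 ⟨D, hD, g, hg, hvD, hwD, ?_, hgf.symm⟩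
    exact hσ.inj v hv _ (tup_mem_proj hD hg hvD) fun i j hij =>
      v.injective (congrArg Subtype.val (hginj hij))
  · exact hall (fun x E => NoNonDeterministic ℓ p (E 0)) hσ.nonDet hnd
  · intro F hF hco
    obtain ⟨i, hi⟩ := hσ.coherent F hF fun x hx C hC D hD hxC hxD i h => by
      have := hco x (Set.mem_insert_of_mem w hx) C hC D hD hxC hxD i
      dsimp only at this
      rw [hupd x hx] at this
      exact this h
    refine ⟨i, ?_⟩
    rintro x (rfl | hx) C hC hxC
    · refine hco x (Set.mem_insert x _) D hD C hC hwD hxC i ?_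
      dsimp only
      rw [Function.update_self]
      exact mem_transport.2 ⟨D, hD, _, hF D hD, hvD, hwD, hi v hv D hD hvD, rfl⟩
    · dsimp only
      rw [hupd x hx]
      exact hi x hx C hC hxC

theorem PartSystem.of_reflTransGen (hℓ : 0 < ℓ) (hN : 2 * ℓ ≤ N) (hp : IsLexProjection ℓ p)
    (hI : I.Tame ℓ m p) (hmin : I.Minimal (2 * ℓ) N)
    (hne : ∀ C ∈ I.cons, ∃ f ∈ C.rel, Function.Injective f) {s : ℕ} {σ τ : PartState ℓ V H s}
    (hσ : PartSystem p I σ.1 σ.2) (h : Relation.ReflTransGen (ExtendStep ℓ p I) σ τ) :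
    PartSystem p I τ.1 τ.2 ∧ ∀ v ∈ σ.1, v ∈ τ.1 ∧ τ.2 v = σ.2 v := by
  classical
  induction h with
  | refl => exact ⟨hσ, fun v hv => ⟨hv, rfl⟩⟩
  | tail _ hstep ih =>
    refine ⟨ih.1.step hℓ hN hp hI hmin hne hstep, fun x hx => ?_⟩
    obtain ⟨h1, h2⟩ := ih.2 x hx
    obtain ⟨v, hv, w, hw, hwσ, hdisj, hnd, rfl⟩ := hstep
    refine ⟨Set.mem_insert_of_mem _ h1, ?_⟩
    rw [← h2]
    refine Function.update_of_ne ?_ _ _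
    rintro rfl
    exact hwσ h1

theorem PartSystem.deterministic {s : ℕ} {S : Set (Fin ℓ ↪o V)}
    {E : (Fin ℓ ↪o V) → Fin (s + 1) → Set (Fin ℓ → H)} (hE : PartSystem p I S E) {v : Fin ℓ ↪o V}
    (hv : v ∈ S) {a : Fin ℓ → H} (ha : a ∈ E v 0) :
    Function.Injective a ∨ IsDeterministic ℓ p (orb ℓ a) := by
  by_contra! h
  exact hE.nonDet v hv ⟨orb ℓ a, a, rfl⟩ ⟨disjoint_orb_injTuples h.1, h.2⟩ (hE.aut v hv 0 a ha)

variable {s : ℕ} {S : Set (Fin ℓ ↪o V)} {E : (Fin ℓ ↪o V) → Fin (s + 1) → Set (Fin ℓ → H)}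
  {F : ∀ C : Constraint V H, C ∈ I.cons → C.scope → H} {t : V → H}

theorem PartSystem.eq_of_mem (hE : PartSystem p I S E) {v : Fin ℓ ↪o V} (hv : v ∈ S)
    {a : Fin ℓ → H} {i j : Fin (s + 1)} (hi : a ∈ E v i) (hj : a ∈ E v j) : i = j :=
  by_contra fun h => Set.disjoint_left.1 (hE.disjoint v hv i j h) hi hj

variable [Countable H]

/-- A family of maps with a common kernel has the same index everywhere. -/
theorem PartSystem.exists_index (hE : PartSystem p I S E) (hK : FinitelyBoundedBy K b)
    (hlim : FirstOrder.Language.IsFraisseLimit (orderedClass K) H)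
    (hF : ∀ C hC, F C hC ∈ C.rel)
    (hker : ∀ C hC, ∀ x y : C.scope, F C hC x = F C hC y ↔ t x = t y) :
    ∃ i, ∀ v ∈ S, ∀ C hC, ∀ hv : ∀ i, v i ∈ C.scope, tup (F C hC) v hv ∈ E v i := by
  refine hE.coherent F hF fun v hv C hC D hD hvC hvD i hi => ?_
  have hkerv : ∀ i j, tup (F C hC) v hvC i = tup (F C hC) v hvC j ↔
      tup (F D hD) v hvD i = tup (F D hD) v hvD j := fun i j =>
    (hker C hC _ _).trans (hker D hD ⟨v i, hvD i⟩ ⟨v j, hvD j⟩).symm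
  by_cases hinj : Function.Injective (tup (F C hC) v hvC)
  · have hinj' : Function.Injective (tup (F D hD) v hvD) := fun i j hij => hinj ((hkerv i j).2 hij)
    rw [hE.eq_of_mem hv hi (hE.inj v hv _ (tup_mem_proj hC (hF C hC) hvC) hinj)]
    exact hE.inj v hv _ (tup_mem_proj hD (hF D hD) hvD) hinj'
  · exact hE.aut v hv i _ hi (mem_orb_of_kernel hK hlim hinj hkerv)

/-- A coherent family of maps with values in the distinguished classes yields a solution of the
injective finitisation. -/
theorem PartSystem.hasSolution_injFinOn (hE : PartSystem p I S E) (hK : FinitelyBoundedBy K b)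
    (hlim : FirstOrder.Language.IsFraisseLimit (orderedClass K) H) (hp : IsLexProjection ℓ p)
    (hI : I.Tame ℓ m p) (hne : ∀ C ∈ I.cons, ∃ f ∈ C.rel, Function.Injective f)
    (hℓ : 0 < ℓ) (hN : ℓ ≤ N) (hcov : I.Covers N)
    (hF : ∀ C hC, F C hC ∈ C.rel)
    (hker : ∀ C hC, ∀ x y : C.scope, F C hC x = F C hC y ↔ t x = t y)
    (hstat : ∀ v ∈ S, ∀ C hC D hD, ∀ (hv : ∀ i, v i ∈ C.scope) (hv' : ∀ i, v i ∈ D.scope),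
      tup (F C hC) v hv ∈ edgeSet ℓ H ↔ tup (F D hD) v hv' ∈ edgeSet ℓ H)
    (hzero : ∀ v ∈ S, ∀ C hC, ∀ hv : ∀ i, v i ∈ C.scope, tup (F C hC) v hv ∈ E v 0) :
    (I.injFinOn ℓ S).HasSolution :=
  _root_.hasSolution_injFinOn hK hlim hp hI hne ((finite_incTuples ℓ hI.1).subset hE.sub)
    (fun v hv => hcov.tuple hℓ hN v (hE.sub v hv)) hF hker hstat
    fun v hv C hC hvC => hE.deterministic hv (hzero v hv C hC hvC)

/-- Solutions survive the removal of the distinguished classes if the injective finitisation has no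
solution. -/
theorem PartSystem.hasSolution_removeClasses (hE : PartSystem p I S E) (hK : FinitelyBoundedBy K b)
    (hlim : FirstOrder.Language.IsFraisseLimit (orderedClass K) H) (hp : IsLexProjection ℓ p)
    (hI : I.Tame ℓ m p) (hne : ∀ C ∈ I.cons, ∃ f ∈ C.rel, Function.Injective f)
    (hℓ : 0 < ℓ) (hN : ℓ ≤ N) (hcov : I.Covers N) (hS : S.Nonempty)
    (hno : ¬ (I.injFinOn ℓ S).HasSolution) (hsol : I.HasSolution) :
    (I.removeClasses S fun v => E v 0).HasSolution := by
  obtain ⟨r, hr⟩ := hsol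
  obtain ⟨u, hu⟩ := hS
  obtain ⟨t, ht⟩ := exists_extend r (r ⟨u ⟨0, hℓ⟩, hE.sub u hu _⟩)
  let F : ∀ C : Constraint V H, C ∈ I.cons → C.scope → H :=
    fun C hC x => r ⟨x.1, I.scope_subset C hC x.2⟩
  have hker : ∀ C hC, ∀ x y : C.scope, F C hC x = F C hC y ↔ t x = t y := fun C hC x y => by
    rw [ht ⟨x, I.scope_subset C hC x.2⟩, ht ⟨y, I.scope_subset C hC y.2⟩]
  obtain ⟨i, hi⟩ := hE.exists_index hK hlim (F := F) hr hker
  -- The restrictions of one solution have the same edge status in all constraints, so index `0`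
  -- would solve the injective finitisation.
  have hi0 : i ≠ 0 := by
    rintro rfl
    exact hno (hE.hasSolution_injFinOn hK hlim hp hI hne hℓ hN hcov (F := F) hr hker
      (fun v _ C hC D hD hv hv' => Iff.rfl) hi)
  refine ⟨r, ?_⟩
  rintro _ ⟨C, hC, rfl⟩
  exact ⟨hr C hC, fun v hv hvC h0 => hi0 (hE.eq_of_mem hv (hi v hv C hC hvC) h0)⟩

/-- The complement of the distinguished class is preserved by canonical injective polymorphisms if
the injective finitisation has no solution. -/
theorem PartSystem.presBy_diff (hE : PartSystem p I S E) (hK : FinitelyBoundedBy K b)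
    (hlim : FirstOrder.Language.IsFraisseLimit (orderedClass K) H) (hp : IsLexProjection ℓ p)
    (hI : I.Tame ℓ m p) (hne : ∀ C ∈ I.cons, ∃ f ∈ C.rel, Function.Injective f)
    (hℓ : 0 < ℓ) (hN : ℓ ≤ N) (hmin : I.Minimal ℓ N) (hker : I.KernelSubdirect ℓ)
    (hno : ¬ (I.injFinOn ℓ S).HasSolution) {n : ℕ} {q : Op H n} (hq : IsBasicOp ℓ m p n q)
    (hqinj : Function.Injective q) (hqcan : q.IsCanonical ℓ) {v : Fin ℓ ↪o V} (hv : v ∈ S) :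
    PresBy q (I.proj v \ E v 0) := by
  intro a ha
  have hproj : (fun x => q fun i => a i x) ∈ I.proj v :=
    CSPInst.invariant_proj hI hℓ hmin hN v (hE.sub v hv) n q hq a fun i => (ha i).1
  refine ⟨hproj, fun hzero => hno ?_⟩
  have hninj : ∀ k, ¬ Function.Injective (a k) := fun k h =>
    (ha k).2 (hE.inj v hv _ (ha k).1 h)
  -- The arguments lie outside the distinguished class, hence are non-injective, and
  -- eq-subdirectness extends the kernel of each to a global assignment.
  choose t htv ht using fun k => hker v (hE.sub v hv) (a k) (ha k).1 (hninj k)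
  have hfam : ∀ k, ∀ C : Constraint V H, ∀ hC : C ∈ I.cons, ∃ f ∈ C.rel,
      (∀ x y : C.scope, f x = f y ↔ t k x = t k y) ∧
      ∀ x y : C.scope, f x < f y ↔ t k x < t k y := by
    intro k C hC
    obtain ⟨f, hf, hft⟩ := ht k C hC
    have := (hI.1.subset (I.scope_subset C hC)).to_subtype
    obtain ⟨α, hα⟩ := exists_equiv_order hK hlim f (fun x : C.scope => t k x) hft
    exact ⟨_, (hI.2 C hC).2.aut α hf, fun x y => by rw [α.injective.eq_iff, hft], hα⟩
  choose f hf hft hflt using hfam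
  -- At `v` the family has the kernel, hence the orbit, of `a k`, so its index is not `0`; but
  -- injective values always lie in class `0`.
  have hindex : ∀ k, ∀ w ∈ S, ∀ C hC, ∀ hw : ∀ i, w i ∈ C.scope,
      ¬ Function.Injective (tup (f k C hC) w hw) := by
    intro k
    obtain ⟨i, hi⟩ := hE.exists_index hK hlim (F := f k) (hf k) (hft k)
    have hi0 : i ≠ 0 := by
      rintro rfl
      obtain ⟨C, hC, hvC⟩ := CSPInst.Covers.tuple hmin.1 hℓ hN v (hE.sub v hv)
      have h1 := hi v hv C hC hvC
      have h2 : ¬ Function.Injective (tup (f k C hC) v hvC) := fun h => hninj k fun x y hxy =>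
        h ((hft k C hC _ _).2 ((htv k x y).2 hxy))
      refine (ha k).2 (hE.aut v hv 0 _ h1 (mem_orb_of_kernel hK hlim h2 fun x y => ?_))
      rw [hft k C hC, htv]
    intro w hw C hC hwC hinj
    exact hi0 (hE.eq_of_mem hw (hi w hw C hC hwC)
      (hE.inj w hw _ (tup_mem_proj hC (hf k C hC) hwC) hinj))
  -- The kernel of this family at `v` is that of `q(a)`, which was assumed to lie in class `0`; so
  -- the family has index `0` everywhere.
  let F : ∀ C : Constraint V H, C ∈ I.cons → C.scope → H := fun C hC x => q fun k => f k C hC x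
  have hF : ∀ C hC, F C hC ∈ C.rel := fun C hC => (hI.2 C hC).2 n q hq _ fun k => hf k C hC
  have hkerF : ∀ C hC, ∀ x y : C.scope, F C hC x = F C hC y ↔
      (q fun k => t k x) = q fun k => t k y := by
    intro C hC x y
    rw [hqinj.eq_iff, hqinj.eq_iff, funext_iff, funext_iff]
    exact forall_congr' fun k => hft k C hC x y
  obtain ⟨i, hi⟩ := hE.exists_index hK hlim (F := F) (t := fun x => q fun k => t k x) hF hkerF
  have hi0 : i = 0 := by
    obtain ⟨C, hC, hvC⟩ := CSPInst.Covers.tuple hmin.1 hℓ hN v (hE.sub v hv)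
    have hkerv : ∀ x y, (q fun k => a k x) = (q fun k => a k y) ↔
        tup (F C hC) v hvC x = tup (F C hC) v hvC y := by
      intro x y
      rw [hkerF C hC, hqinj.eq_iff, hqinj.eq_iff, funext_iff, funext_iff]
      exact forall_congr' fun k => (htv k x y).symm
    refine hE.eq_of_mem hv (hi v hv C hC hvC) ?_
    by_cases hinj : Function.Injective fun x => q fun k => a k x
    · exact hE.inj v hv _ (tup_mem_proj hC (hF C hC) hvC) fun x y hxy => hinj ((hkerv x y).2 hxy)
    · exact hE.aut v hv 0 _ hzero (mem_orb_of_kernel hK hlim hinj hkerv)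
  subst hi0
  refine hE.hasSolution_injFinOn hK hlim hp hI hne hℓ hN hmin.1 (F := F)
    (t := fun x => q fun k => t k x) hF hkerF ?_ hi
  -- Each argument is non-injective at `w`, with kernel and order prescribed by `t k`. Its ordered
  -- orbit is therefore the same in all constraints, and canonicity of `q` transfers this to the
  -- edge status of the value.
  intro w hw C hC D hD hwC hwD
  refine mem_edgeSet_iff_of_orbLT_eq (hqcan ℓ (fun k => tup (f k C hC) w hwC)
    (fun k => tup (f k D hD) w hwD) fun k => ?_)
  refine orbLT_eq_of_sameType hlim (sameType_of_not_injective (isHypergraph_limit hK hlim)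
    (hindex k w hw C hC hwC) fun x y => ?_) fun x y => ?_
  · rw [hft k C hC, hft k D hD]
  · rw [hflt k C hC, hflt k D hD]

/-- Removing the classes amounts to intersecting the constraints with the complements `I.proj v \ E
v 0`, which are invariant `ℓ`-ary relations. -/
theorem PartSystem.isInstanceOf_removeClasses (hE : PartSystem p I S E)
    (hK : FinitelyBoundedBy K b)
    (hlim : FirstOrder.Language.IsFraisseLimit (orderedClass K) H) (hm : IsInjectiveLinear ℓ m)
    (hp : IsLexProjection ℓ p) (hT : IsTemplate ℓ V LA m p N) (hI : I.IsInstanceOf LA)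
    (hne : ∀ C ∈ I.cons, ∃ f ∈ C.rel, Function.Injective f)
    (hmin : I.Minimal ℓ N) (hker : I.KernelSubdirect ℓ)
    (hno : ¬ (I.injFinOn ℓ S).HasSolution) :
    (I.removeClasses S fun v => E v 0).IsInstanceOf LA := by
  have hℓ := hT.three_le
  have hN := hT.le_cover
  have htame := hT.tame hI
  have hinv : ∀ v ∈ S, Invariant ℓ m p (I.proj v \ E v 0) := by
    intro v hv n q hq
    have key : Function.Injective q → q.IsCanonical ℓ → PresBy q (I.proj v \ E v 0) :=
      hE.presBy_diff hK hlim hp htame hne (by omega) (by omega : ℓ ≤ N) hmin hker hno hq (v := v)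
        (hv := hv)
    cases hq with
    | aut α =>
      intro a ha
      have hinv := CSPInst.invariant_proj htame (by omega) hmin (by omega) v (hE.sub v hv)
      refine ⟨hinv.aut α (ha 0).1, fun h => (ha 0).2 ?_⟩
      exact hE.aut v hv 0 _ h ⟨α.symm, fun i => (α.symm_apply_apply _).symm⟩
    | tern => exact key hm.injective hm.canonical
    | bin => exact key hp.injective hp.canonical
  refine hT.isInstanceOf_image hI rfl ?_
  rintro _ ⟨C, hC, rfl⟩
  -- Quantifying over `v` with `⇑v = w` leaves all tuples that do not come from `S` unrestricted.
  refine ⟨C, hC, fun w => {a | ∀ v ∈ S, ⇑v = w → a ∈ I.proj v \ E v 0}, fun w n q hq a ha v hv hvw =>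
    hinv v hv n q hq a fun i => ha i v hv hvw, Constraint.mk_congr (Set.ext fun f => ?_)⟩
  refine and_congr_right fun hf => ⟨fun h w hw v hv hvw => ?_, fun h v hv hvC h0 => ?_⟩
  · subst hvw
    exact ⟨tup_mem_proj hC hf hw, h v hv hw⟩
  · exact (h v hvC v hv rfl).2 h0

end System

/-! ## The linkedness congruence -/

section Linkedness

variable {ℓ : ℕ} {H V : Type*} [LinearOrder V] {I : CSPInst V H}

/-- The tuples `a` and `c` have a common neighbour in the projection of `I` to `(u, w)`. -/
def CSPInst.Near (I : CSPInst V H) (u w : Fin ℓ ↪o V) (a c : Fin ℓ → H) : Prop :=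
  ∃ d, Fin.append a d ∈ I.proj (Fin.append u w) ∧ Fin.append c d ∈ I.proj (Fin.append u w)

/-- The linkedness relation on the projection to `u` that is given by the tuples in `S`. -/
def CSPInst.Link (I : CSPInst V H) (S : Set (Fin ℓ ↪o V)) (u : Fin ℓ ↪o V) :
    (Fin ℓ → H) → (Fin ℓ → H) → Prop :=
  Relation.ReflTransGen fun a c => ∃ w ∈ S, I.Near u w a c

/-- The set of all tuples that are linked to a tuple in `X`. -/
def CSPInst.linkClosure (I : CSPInst V H) (S : Set (Fin ℓ ↪o V)) (u : Fin ℓ ↪o V)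
    (X : Set (Fin ℓ → H)) : Set (Fin ℓ → H) :=
  {a | ∃ x ∈ X, I.Link S u x a}

variable {S : Set (Fin ℓ ↪o V)} {u : Fin ℓ ↪o V}

namespace CSPInst

theorem Link.symm {a c : Fin ℓ → H} (h : I.Link S u a c) : I.Link S u c a := by
  have : Std.Symm fun a c => ∃ w ∈ S, I.Near u w a c :=
    ⟨fun _ _ ⟨w, hw, d, h1, h2⟩ => ⟨w, hw, d, h2, h1⟩⟩
  exact Relation.ReflTransGen.stdSymm.symm _ _ h

theorem Link.mem_proj {a c : Fin ℓ → H} (h : I.Link S u a c) (ha : a ∈ I.proj u) :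
    c ∈ I.proj u := by
  induction h with
  | refl => exact ha
  | tail _ h _ =>
    obtain ⟨w, hw, d, -, h⟩ := h
    obtain ⟨C, hC, f, hf, hv, -, rfl, -⟩ := mem_proj_append.1 h
    exact tup_mem_proj hC hf hv

theorem mem_linkClosure_of_link {X : Set (Fin ℓ → H)} {a c : Fin ℓ → H}
    (ha : a ∈ I.linkClosure S u X) (h : I.Link S u a c) : c ∈ I.linkClosure S u X := by
  obtain ⟨x, hx, hxa⟩ := ha
  exact ⟨x, hx, hxa.trans h⟩

theorem subset_linkClosure (X : Set (Fin ℓ → H)) : X ⊆ I.linkClosure S u X :=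
  fun x hx => ⟨x, hx, .refl⟩

theorem linkClosure_subset {X : Set (Fin ℓ → H)} (hX : X ⊆ I.proj u) :
    I.linkClosure S u X ⊆ I.proj u := by
  rintro a ⟨x, hx, h⟩
  exact h.mem_proj (hX hx)


theorem exists_append {N : ℕ} (hℓ : 0 < ℓ) (hN : 2 * ℓ ≤ N) (hmin : I.Minimal (2 * ℓ) N)
    (hS : S ⊆ incTuples ℓ I.vars) (hu : u ∈ S)
    {w : Fin ℓ ↪o V} (hw : w ∈ S) {a : Fin ℓ → H} (ha : a ∈ I.proj u) :
    ∃ C ∈ I.cons, ∃ f ∈ C.rel, ∃ (hv : ∀ i, u i ∈ C.scope), (∀ i, w i ∈ C.scope) ∧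
      a = tup f u hv := by
  obtain ⟨D, hD, huD, hwD⟩ := CSPInst.Covers.pair hmin.1 hℓ (by omega) (hS hu) (hS hw)
  rw [(hmin.mono (by omega : ℓ ≤ 2 * ℓ) le_rfl).proj_eq le_rfl hD huD] at ha
  obtain ⟨f, hf, _, ha⟩ := ha
  exact ⟨D, hD, f, hf, huD, hwD, funext ha⟩

variable [(hyperLang ℓ).Structure H] {m : Op H 3} {p : Op H 2} {N : ℕ}

/-- Changing one argument along a common neighbour `d` at `w` changes the value along a common
neighbour: apply `q` to `d` and to fixed neighbours of the other arguments. -/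
theorem Link.update (hℓ : 0 < ℓ) (hN : 2 * ℓ ≤ N) (hI : I.Tame ℓ m p) (hmin : I.Minimal (2 * ℓ) N)
    (hS : S ⊆ incTuples ℓ I.vars) (hu : u ∈ S)
    {n : ℕ} {q : Op H n} (hq : IsBasicOp ℓ m p n q) {a : Fin n → Fin ℓ → H}
    (ha : ∀ i, a i ∈ I.proj u) (j : Fin n) {x y : Fin ℓ → H} (h : I.Link S u x y) :
    I.Link S u (fun z => q fun i => Function.update a j x i z)
      (fun z => q fun i => Function.update a j y i z) := by
  refine Relation.ReflTransGen.lift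
    (fun x : Fin ℓ → H => fun z => q fun i => Function.update a j x i z) ?_ _ _ h
  rintro x y ⟨w, hw, d, hx, hy⟩
  refine ⟨w, hw, ?_⟩
  have hc : ∀ i, ∃ c, Fin.append (a i) c ∈ I.proj (Fin.append u w) := fun i => by
    obtain ⟨C, hC, f, hf, huC, hwC, h⟩ := exists_append hℓ hN hmin hS hu hw (ha i)
    exact ⟨_, mem_proj_append.2 ⟨C, hC, f, hf, huC, hwC, h, rfl⟩⟩
  choose c hc using hc
  have hinv : Invariant ℓ m p (I.proj (Fin.append u w)) :=
    invariant_proj hI (by omega) (hmin.mono (by omega : ℓ + ℓ ≤ 2 * ℓ) le_rfl) (by omega) _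
      fun i => by
        refine Fin.addCases (fun i => ?_) (fun i => ?_) i
        · simpa using hS hu i
        · rw [Fin.append_right]
          exact hS hw i
  have key : ∀ x, Fin.append x d ∈ I.proj (Fin.append u w) →
      Fin.append (fun z => q fun i => Function.update a j x i z)
        (fun z => q fun i => Function.update c j d i z) ∈ I.proj (Fin.append u w) := by
    intro x hx
    have := hinv n q hq (fun i => Fin.append (Function.update a j x i) (Function.update c j d i))
      fun i => by
        by_cases hij : i = j
        · subst hij
          simpa using hx
        · simpa [hij] using hc i
    convert this using 1
    funext z
    refine Fin.addCases (fun z => ?_) (fun z => ?_) z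
    · simp only [Fin.append_left]
    · simp only [Fin.append_right]
  exact ⟨_, key x hx, key y hy⟩

/-- Linkedness is a congruence; the arguments are changed one after the other. -/
theorem Link.basicOp (hℓ : 0 < ℓ) (hN : 2 * ℓ ≤ N) (hI : I.Tame ℓ m p) (hmin : I.Minimal (2 * ℓ) N)
    (hS : S ⊆ incTuples ℓ I.vars) (hu : u ∈ S)
    {n : ℕ} {q : Op H n} (hq : IsBasicOp ℓ m p n q) {a c : Fin n → Fin ℓ → H}
    (ha : ∀ i, a i ∈ I.proj u) (h : ∀ i, I.Link S u (a i) (c i)) :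
    I.Link S u (fun z => q fun i => a i z) (fun z => q fun i => c i z) := by
  classical
  have key : ∀ T : Finset (Fin n),
      I.Link S u (fun z => q fun i => a i z) (fun z => q fun i => (if i ∈ T then c i else a i) z) := by
    intro T
    induction T using Finset.induction_on with
    | empty => exact .refl
    | insert j T hj ih =>
      have hstep := Link.update hℓ hN hI hmin hS hu hq (a := fun i => if i ∈ T then c i else a i)
        (fun i => by
          split_ifs
          exacts [(h i).mem_proj (ha i), ha i]) j (h j)
      refine Relation.ReflTransGen.trans ih ?_
      change I.Link S u _ _
      convert hstep using 1
      · funext z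
        congr 1
        funext i
        by_cases hij : i = j
        · subst hij
          simp [hj]
        · simp [hij]
      · funext z
        congr 1
        funext i
        by_cases hij : i = j
        · subst hij
          simp
        · simp [hij]
  simpa using key Finset.univ

theorem invariant_linkClosure (hℓ : 0 < ℓ) (hN : 2 * ℓ ≤ N) (hI : I.Tame ℓ m p) (hmin : I.Minimal (2 * ℓ) N)
    (hS : S ⊆ incTuples ℓ I.vars) (hu : u ∈ S)
    {X : Set (Fin ℓ → H)} (hX : X ⊆ I.proj u) (hinv : Invariant ℓ m p X) :
    Invariant ℓ m p (I.linkClosure S u X) := by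
  intro n q hq a ha
  choose x hx hxa using ha
  exact ⟨_, hinv n q hq x hx, Link.basicOp hℓ hN hI hmin hS hu hq (fun i => hX (hx i)) hxa⟩

/-- The closure of an orbit is contained in every closure of an invariant set that it meets. -/
theorem linkClosure_orb_subset (hℓ : 0 < ℓ) (hN : 2 * ℓ ≤ N) (hI : I.Tame ℓ m p) (hmin : I.Minimal (2 * ℓ) N)
    (hS : S ⊆ incTuples ℓ I.vars) (hu : u ∈ S)
    {X : Set (Fin ℓ → H)} (hX : X ⊆ I.proj u)
    (hinv : Invariant ℓ m p X) {a c : Fin ℓ → H} (h : c ∈ I.linkClosure S u (orb ℓ a))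
    (h' : c ∈ I.linkClosure S u X) : I.linkClosure S u (orb ℓ a) ⊆ I.linkClosure S u X := by
  obtain ⟨x, hx, hxc⟩ := h
  obtain ⟨y, hy, hyc⟩ := h'
  have hinv' := invariant_linkClosure hℓ hN hI hmin hS hu hX hinv
  have hxX : x ∈ I.linkClosure S u X := ⟨y, hy, hyc.trans hxc.symm⟩
  have haX : orb ℓ a ⊆ I.linkClosure S u X := by
    obtain ⟨α, hα⟩ := hx
    refine hinv'.orb_subset (hinv'.orb_subset hxX ⟨α.symm, fun i => ?_⟩)
    rw [hα, α.symm_apply_apply]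
  rintro d ⟨z, hz, hzd⟩
  exact mem_linkClosure_of_link (haX hz) hzd

end CSPInst

variable [(hyperLang ℓ).Structure H] {m : Op H 3} {p : Op H 2} {N : ℕ}

/-- An injective operation of positive arity keeps the common kernel of its arguments, and the
kernel determines the orbit. -/
theorem invariant_orb_of_not_injective {K : Set (Bundled.{u} (hyperLang ℓ).Structure)} {b : ℕ}
    {H : Type u} [Countable H] [(hyperLang ℓ).Structure H] [LinearOrder H] {m : Op H 3}
    {p : Op H 2} (hK : FinitelyBoundedBy K b)
    (hlim : FirstOrder.Language.IsFraisseLimit (orderedClass K) H) (hm : Function.Injective m)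
    (hp : Function.Injective p) {a : Fin ℓ → H} (ha : ¬ Function.Injective a) :
    Invariant ℓ m p (orb ℓ a) := by
  intro n q hq c hc
  refine mem_orb_of_kernel hK hlim ha fun i j => ?_
  have hpos := hq.pos
  rw [(hq.injective hm hp).eq_iff, funext_iff]
  have h1 : ∀ k, a i = a j ↔ c k i = c k j := fun k => by
    obtain ⟨α, hα⟩ := hc k
    rw [hα, hα, α.injective.eq_iff]
  exact ⟨fun h k => (h1 k).1 h, fun h => (h1 ⟨0, hpos⟩).2 (h _)⟩

theorem invariant_injTuples (hm : Function.Injective m) (hp : Function.Injective p) :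
    Invariant ℓ m p (injTuples H ℓ) := by
  intro n q hq c hc i j hij
  exact hc ⟨0, hq.pos⟩ (congrFun (hq.injective hm hp hij) ⟨0, hq.pos⟩)

theorem IsTemplate.ppDefinable {V : Type*} {LA : FirstOrder.Language} [LA.Structure H]
    (hT : IsTemplate ℓ V LA m p N) {R : Set (Fin ℓ → H)}
    (hR : Invariant ℓ m p R) : PPDefinable LA R := by
  obtain ⟨r, hr⟩ := hT.exists_rel R hR
  refine ⟨0, [r.formula fun i => FirstOrder.Language.Term.var (Sum.inl i)], ?_, fun a => ?_⟩
  · rintro φ hφ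
    rw [List.mem_singleton.1 hφ]
    exact .rel _ _
  · rw [← hr]
    simp [FirstOrder.Language.Formula.realize_rel]

end Linkedness

/-! ## Irreducibility of the output -/

section Irreducible

variable {ℓ : ℕ} {K : Set (Bundled.{u} (hyperLang ℓ).Structure)} {b : ℕ}
  {H : Type u} [(hyperLang ℓ).Structure H]
  {V : Type*} [LinearOrder V] {m : Op H 3} {p : Op H 2} {LA : FirstOrder.Language}
  [LA.Structure H] {N : ℕ} {I : CSPInst V H} {S : Set (Fin ℓ ↪o V)} {u : Fin ℓ ↪o V}

theorem step_restrict_fin {C : Constraint V H} (hC : C ∈ I.cons) {f : C.scope → H} (hf : f ∈ C.rel)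
    {v w : Fin ℓ ↪o V} (hv : v ∈ S) (hw : w ∈ S) (hvC : ∀ i, v i ∈ C.scope)
    (hwC : ∀ i, w i ∈ C.scope) :
    ((I.fin ℓ).restrict S).Step (v, ⟨orb ℓ (tup f v hvC), _, rfl⟩)
      (w, ⟨orb ℓ (tup f w hwC), _, rfl⟩) := by
  refine ⟨_, ⟨_, ⟨C, hC, rfl⟩, rfl⟩, fun x => ⟨orb ℓ (tup f x.1 x.2.1), _, rfl⟩,
    ⟨fun x => ⟨orb ℓ (tup f x.1 x.2), _, rfl⟩, ⟨f, hf, fun x => mem_orb_self _⟩, fun x => rfl⟩,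
    fun i => ?_, fun i => ?_⟩
  · fin_cases i
    exacts [⟨hvC, hv⟩, ⟨hwC, hw⟩]
  · fin_cases i <;> rfl

/-- A common neighbour at `w` gives two steps of the finitisation, from `u` to `w` and back. -/
theorem reflTransGen_step_of_link (hu : u ∈ S) {a c : Fin ℓ → H} (h : I.Link S u a c) :
    Relation.ReflTransGen ((I.fin ℓ).restrict S).Step (u, ⟨orb ℓ a, _, rfl⟩)
      (u, ⟨orb ℓ c, _, rfl⟩) := by
  induction h with
  | refl => exact .refl
  | tail _ h ih =>
    obtain ⟨w, hw, d, h1, h2⟩ := h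
    obtain ⟨C, hC, f, hf, huC, hwC, rfl, rfl⟩ := mem_proj_append.1 h1
    obtain ⟨D, hD, g, hg, huD, hwD, rfl, hfg⟩ := mem_proj_append.1 h2
    refine (ih.tail (step_restrict_fin hC hf hu hw huC hwC)).tail ?_
    have := step_restrict_fin hD hg hw hu hwD huD
    rwa [← hfg] at this

/-- Injectivising before restricting is the stronger condition: the removed maps may be
non-injective only outside `S`. -/
theorem hasSolution_inj_of_injFinOn {T : Set (Fin ℓ ↪o V)} (hST : S ⊆ T)
    (h : (I.injFinOn ℓ T).HasSolution) : ((I.fin ℓ).restrict S).inj.HasSolution := by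
  obtain ⟨s, hs⟩ := h
  refine ⟨fun v => s ⟨v, hST v.2⟩, ?_⟩
  rintro _ ⟨_, ⟨_, ⟨C, hC, rfl⟩, rfl⟩, rfl⟩
  obtain ⟨g, ⟨hg, hginj⟩, hgs⟩ := hs _ ⟨_, ⟨_, ⟨C, hC, rfl⟩, rfl⟩, rfl⟩
  refine ⟨⟨g, hg, fun x => hgs ⟨x.1, x.2.1, hST x.2.2⟩⟩, fun x => ?_⟩
  have := hgs ⟨x.1, x.2.1, hST x.2.2⟩
  dsimp only at this ⊢
  rw [this]
  exact hginj _

variable [LinearOrder H]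

variable (ℓ p) in
/-- In the restriction of the finitisation to `S`, some injective orbit is linked to a
non-deterministic orbit. -/
def CSPInst.LinksNonDeterministic (I : CSPInst V H) (S : Set (Fin ℓ ↪o V)) : Prop :=
  ∃ v ∈ S, ∃ O P : Orb ℓ H, (O.1 = edgeSet ℓ H ∨ O.1 = nonEdgeSet ℓ H) ∧
    IsNonDeterministic ℓ p P ∧ ((I.fin ℓ).restrict S).Linked v O P

/-- A non-deterministic orbit at `w` in the transported class would be linked at `w` to an injective
orbit: go from `w` to `u` along an injective map, follow the links at `u`, and return to `w`. -/
theorem noNonDeterministic_transport [Countable H] (hK : FinitelyBoundedBy K b)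
    (hlim : FirstOrder.Language.IsFraisseLimit (orderedClass K) H) (hp : IsLexProjection ℓ p)
    (hℓ : 0 < ℓ) (hN : 2 * ℓ ≤ N) (hI : I.Tame ℓ m p) (hmin : I.Minimal (2 * ℓ) N)
    (hne : ∀ C ∈ I.cons, ∃ f ∈ C.rel, Function.Injective f)
    (hS : S ⊆ incTuples ℓ I.vars) (hu : u ∈ S) (hno : ¬ I.LinksNonDeterministic ℓ p S)
    {w : Fin ℓ ↪o V} (hw : w ∈ S) :
    NoNonDeterministic ℓ p
      (transport I u w (I.linkClosure S u (I.proj u ∩ injTuples H ℓ))) := by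
  intro O hO hsub
  obtain ⟨c, hc⟩ := O.2
  have hcinj : ¬ Function.Injective c := fun h =>
    Set.disjoint_left.1 hO.1 (hc ▸ mem_orb_self c) h
  obtain ⟨C, hC, f, hf, huC, hwC, ⟨i, ⟨hi, hinj⟩, hlink⟩, rfl⟩ :=
    mem_transport.1 (hsub (hc ▸ mem_orb_self c))
  obtain ⟨D, hD, g, hg, huD, hwD, rfl⟩ := CSPInst.exists_append hℓ hN hmin hS hu hw hi
  obtain ⟨h, hh, hhinj, hhg⟩ := exists_injective_extension hp hI hne hD hg huD hinj
  have hwinj : Function.Injective (tup h w hwD) := fun i j hij =>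
    w.injective (congrArg Subtype.val (hhinj hij))
  rw [← hhg] at hlink
  have hpath := (((Relation.ReflTransGen.single (step_restrict_fin hD hh hw hu hwD huD)).trans
    (reflTransGen_step_of_link hu hlink)).tail (step_restrict_fin hC hf hu hw huC hwC))
  refine hno ⟨w, hw, ⟨orb ℓ (tup h w hwD), _, rfl⟩, O, ?_, hO, ?_⟩
  · rcases orb_of_injective hK hlim hwinj with h | h
    · exact Or.inl h.2
    · exact Or.inr h.2
  · have hOeq : O = ⟨orb ℓ (tup f w hwC), _, rfl⟩ := Subtype.ext hc
    rw [hOeq]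
    refine (Relation.reflTransGen_iff_eq_or_transGen.1 hpath).resolve_left fun heq => hcinj ?_
    have h1 : orb ℓ (tup f w hwC) = orb ℓ (tup h w hwD) := congrArg (fun x => x.2.1) heq
    have h2 := injective_of_mem_orb (h1 ▸ mem_orb_self (tup f w hwC))
    tauto

/-- If no injective orbit is linked to a non-deterministic orbit, then the linkedness classes form an
admissible partition with distinguished class the closure of the injective tuples. -/
theorem exists_admissiblePartition [Countable H] (hK : FinitelyBoundedBy K b)
    (hlim : FirstOrder.Language.IsFraisseLimit (orderedClass K) H) (hm : IsInjectiveLinear ℓ m)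
    (hp : IsLexProjection ℓ p) (hT : IsTemplate ℓ V LA m p N) (hI : I.Tame ℓ m p)
    (hmin : I.Minimal (2 * ℓ) N) (hne : ∀ C ∈ I.cons, ∃ f ∈ C.rel, Function.Injective f)
    (hS : S ⊆ incTuples ℓ I.vars) (hu : u ∈ S) (hno : ¬ I.LinksNonDeterministic ℓ p S) :
    ∃ (s : ℕ) (E : Fin (s + 1) → Set (Fin ℓ → H)), IsAdmissiblePartition ℓ LA p I u E ∧
      E 0 = I.linkClosure S u (I.proj u ∩ injTuples H ℓ) ∧
      ∀ i a c, a ∈ E i → I.Link S u a c → c ∈ E i := by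
  have hℓ : 0 < ℓ := by have := hT.three_le; omega
  have hN : 2 * ℓ ≤ N := by have := hT.le_cover; omega
  have hmin1 := hmin.mono (by omega : ℓ ≤ 2 * ℓ) le_rfl
  have hprojinv := CSPInst.invariant_proj hI hℓ hmin1 (by omega) u (hS hu)
  set X : Set (Fin ℓ → H) := I.proj u ∩ injTuples H ℓ with hXdef
  have hXinv : Invariant ℓ m p X := hprojinv.inter (invariant_injTuples hm.injective hp.injective)
  have hXsub : X ⊆ I.proj u := Set.inter_subset_left
  -- The classes not met by injective tuples. Each is the closure of a single non-injective orbit,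
  -- which is invariant, so the class is invariant and hence a relation of the template.
  let 𝒞 : Set (Set (Fin ℓ → H)) := {D | ∃ a ∈ I.proj u, a ∉ I.linkClosure S u X ∧
    D = I.linkClosure S u (orb ℓ a)}
  have hfin : 𝒞.Finite := by
    have := finite_orb hK hlim (ℓ := ℓ)
    refine (Set.finite_range fun O : Orb ℓ H => I.linkClosure S u O.1).subset ?_
    rintro _ ⟨a, -, -, rfl⟩
    exact ⟨⟨orb ℓ a, a, rfl⟩, rfl⟩
  have hninj : ∀ a ∈ I.proj u, a ∉ I.linkClosure S u X → ¬ Function.Injective a :=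
    fun a ha h hinj => h (CSPInst.subset_linkClosure X ⟨ha, hinj⟩)
  have horbinv : ∀ a, ¬ Function.Injective a → Invariant ℓ m p (orb ℓ a) := fun a ha =>
    invariant_orb_of_not_injective hK hlim hm.injective hp.injective ha
  have horbsub : ∀ a ∈ I.proj u, orb ℓ a ⊆ I.proj u := fun a ha => hprojinv.orb_subset ha
  have := hfin.to_subtype
  obtain ⟨s, ⟨e⟩⟩ := Finite.exists_equiv_fin 𝒞
  let E : Fin (s + 1) → Set (Fin ℓ → H) :=
    Fin.cons (I.linkClosure S u X) fun i => (e.symm i).1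
  have hall : ∀ P : Set (Fin ℓ → H) → Prop, P (I.linkClosure S u X) →
      (∀ a ∈ I.proj u, a ∉ I.linkClosure S u X → P (I.linkClosure S u (orb ℓ a))) →
      ∀ i, P (E i) := by
    intro P h1 h2 i
    refine Fin.cases h1 (fun i => ?_) i
    obtain ⟨a, ha, ha', h⟩ := (e.symm i).2
    change P (e.symm i).1
    rw [h]
    exact h2 a ha ha'
  have hlink : ∀ i a c, a ∈ E i → I.Link S u a c → c ∈ E i :=
    hall (fun D => ∀ a c, a ∈ D → I.Link S u a c → c ∈ D)
      (fun a c h h' => CSPInst.mem_linkClosure_of_link h h')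
      fun d _ _ a c h h' => CSPInst.mem_linkClosure_of_link h h'
  have hzero : ∀ i, Disjoint (I.linkClosure S u X) (e.symm i).1 := by
    intro i
    obtain ⟨a, ha, ha', h⟩ := (e.symm i).2
    rw [h, Set.disjoint_left]
    exact fun c hc hc' => ha' (CSPInst.linkClosure_orb_subset hℓ hN hI hmin hS hu hXsub hXinv
      hc' hc (CSPInst.subset_linkClosure _ (mem_orb_self a)))
  refine ⟨s, E, ⟨?_, ?_, ?_, ?_, ?_, ?_⟩, rfl, hlink⟩
  · refine hall _ ?_ fun a _ _ => ⟨a, CSPInst.subset_linkClosure _ (mem_orb_self a)⟩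
    obtain ⟨C, hC, huC⟩ := CSPInst.Covers.tuple hmin.1 hℓ (by omega) u (hS hu)
    obtain ⟨f, hf, hinj⟩ := hne C hC
    exact ⟨tup f u huC, CSPInst.subset_linkClosure _ ⟨tup_mem_proj hC hf huC, fun i j hij =>
      u.injective (congrArg Subtype.val (hinj hij))⟩⟩
  · intro i j
    refine Fin.cases (fun hij => ?_) (fun i hij => ?_) i
    · revert hij
      refine Fin.cases (fun h => absurd rfl h) (fun j _ => hzero j) j
    · revert hij
      refine Fin.cases (fun _ => (hzero i).symm) (fun j hij => ?_) j
      rw [Set.disjoint_left]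
      intro c (hc : c ∈ (e.symm i).1) (hc' : c ∈ (e.symm j).1)
      refine hij (congrArg Fin.succ (e.symm.injective (Subtype.ext ?_)))
      obtain ⟨a, ha, ha', h⟩ := (e.symm i).2
      obtain ⟨a₁, ha₁, ha₁', h₁⟩ := (e.symm j).2
      rw [h] at hc ⊢
      rw [h₁] at hc' ⊢
      exact Set.Subset.antisymm
        (CSPInst.linkClosure_orb_subset hℓ hN hI hmin hS hu (horbsub a₁ ha₁)
          (horbinv a₁ (hninj a₁ ha₁ ha₁')) hc hc')
        (CSPInst.linkClosure_orb_subset hℓ hN hI hmin hS hu (horbsub a ha)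
          (horbinv a (hninj a ha ha')) hc' hc)
  · refine Set.Subset.antisymm (Set.iUnion_subset ?_) fun a ha => ?_
    · exact hall (· ⊆ I.proj u) (CSPInst.linkClosure_subset hXsub)
        fun a ha _ => CSPInst.linkClosure_subset (horbsub a ha)
    · by_cases h : a ∈ I.linkClosure S u X
      · exact Set.mem_iUnion.2 ⟨0, h⟩
      · refine Set.mem_iUnion.2 ⟨(e ⟨_, a, ha, h, rfl⟩).succ, ?_⟩
        change a ∈ (e.symm (e _)).1
        rw [e.symm_apply_apply]
        exact CSPInst.subset_linkClosure _ (mem_orb_self a)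
  · exact hall (PPDefinable LA)
      (hT.ppDefinable (CSPInst.invariant_linkClosure hℓ hN hI hmin hS hu hXsub hXinv))
      fun a ha ha' => hT.ppDefinable (CSPInst.invariant_linkClosure hℓ hN hI hmin hS hu
        (horbsub a ha) (horbinv a (hninj a ha ha')))
  · exact CSPInst.subset_linkClosure X
  · intro O hO hsub
    -- The class at `u` is contained in its transport from `u` to `u`.
    refine noNonDeterministic_transport hK hlim hp hℓ hN hI hmin hne hS hu hno hu O hO fun a ha => ?_
    obtain ⟨C, hC, f, hf, huC, -, rfl⟩ := CSPInst.exists_append hℓ hN hmin hS hu hu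
      (CSPInst.linkClosure_subset hXsub (hsub ha))
    exact mem_transport.2 ⟨C, hC, f, hf, huC, huC, hsub ha, rfl⟩

/-- ExtendPartition, started at some `u ∈ S` with the linkedness partition, cannot stop before it
has absorbed `S`. -/
theorem hasSolution_inj_restrict_fin [Countable H] [LA.IsRelational] (hK : FinitelyBoundedBy K b)
    (hlim : FirstOrder.Language.IsFraisseLimit (orderedClass K) H) (hm : IsInjectiveLinear ℓ m)
    (hp : IsLexProjection ℓ p) (hT : IsTemplate ℓ V LA m p N) (hI : I.Tame ℓ m p)
    (hmin : I.Minimal (2 * ℓ) N) (hne : ∀ C ∈ I.cons, ∃ f ∈ C.rel, Function.Injective f)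
    (h : ∀ u ∈ incTuples ℓ I.vars, ∀ (s : ℕ) (E : Fin (s + 1) → Set (Fin ℓ → H)),
      IsAdmissiblePartition ℓ LA p I u E → ∃ τ : PartState ℓ V H s,
        ExtendPartitionOutput ℓ p I u E τ ∧ (I.injFinOn ℓ τ.1).HasSolution)
    (hS : S ⊆ incTuples ℓ I.vars) (hno : ¬ I.LinksNonDeterministic ℓ p S) :
    ((I.fin ℓ).restrict S).inj.HasSolution := by
  have hℓ : 0 < ℓ := by have := hT.three_le; omega
  have hN : 2 * ℓ ≤ N := by have := hT.le_cover; omega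
  rcases S.eq_empty_or_nonempty with rfl | ⟨u, hu⟩
  -- Even on empty scopes the constraints must contain the empty map, which uses that no constraint
  -- is empty.
  · refine ⟨fun v => v.2.elim, ?_⟩
    rintro _ ⟨_, ⟨_, ⟨C, hC, rfl⟩, rfl⟩, rfl⟩
    obtain ⟨f, hf, -⟩ := hne C hC
    exact ⟨⟨fun x => ⟨orb ℓ (tup f x.1 x.2), _, rfl⟩, ⟨f, hf, fun x => mem_orb_self _⟩,
      fun x => x.2.2.elim⟩, fun x => x.2.2.elim⟩
  obtain ⟨s, E, hE, hE0, hlink⟩ :=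
    exists_admissiblePartition hK hlim hm hp hT hI hmin hne hS hu hno
  obtain ⟨τ, ⟨hτ, hmax⟩, hsol⟩ := h u (hS hu) s E hE
  obtain ⟨hsys, hpres⟩ := (partSystem_singleton hT hmin.1 (hS hu) hE).of_reflTransGen hℓ hN hp hI
    hmin hne (σ := ({u}, fun _ => E)) hτ
  obtain ⟨huτ, hEτ⟩ := hpres u rfl
  refine hasSolution_inj_of_injFinOn (fun w hw => ?_) hsol
  by_contra hwτ
  -- A missing `w` could be added directly from `u`: two tuples at `u` with a common neighbour at
  -- `w` are linked, so distinct classes have disjoint transports.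
  refine hmax _ ⟨u, huτ, w, hS hw, hwτ, ?_, ?_, rfl⟩
  · rw [hEτ]
    intro i j hij
    rw [Set.disjoint_left]
    rintro c ⟨a, ha, hac⟩ ⟨a', ha', hac'⟩
    exact Set.disjoint_left.1 (hE.disjoint i j hij)
      (hlink i a a' ha (.single ⟨w, hw, c, hac, hac'⟩)) ha'
  · rw [hEτ]
    dsimp only
    rw [hE0]
    exact noNonDeterministic_transport hK hlim hp hℓ hN hI hmin hne hS hu hno hw

end Irreducible

/-! ## Correctness and termination of the algorithm -/

section Main

/-- Comparing projections to the empty tuple shows that one empty constraint empties all of them; no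
common scope is needed. -/
theorem CSPInst.Minimal.nonempty {X B : Type*} {I : CSPInst X B} {k n : ℕ} (h : I.Minimal k n)
    {C D : Constraint X B} (hC : C ∈ I.cons) (hD : D ∈ I.cons) (hne : C.rel.Nonempty) :
    D.rel.Nonempty := by
  obtain ⟨f, hf⟩ := hne
  have h1 : (Fin.elim0 : Fin 0 → B) ∈ C.proj (Fin.elim0 : Fin 0 → X) :=
    ⟨f, hf, fun i => i.elim0, fun i => i.elim0⟩
  rw [h.2 0 (Nat.zero_le _) _ C hC D hD (fun i => i.elim0) fun i => i.elim0] at h1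
  obtain ⟨g, hg, -⟩ := h1
  exact ⟨g, hg⟩

theorem shrinks_removeClasses {ℓ : ℕ} {V H : Type*} [LinearOrder V] (I : CSPInst V H)
    (S : Set (Fin ℓ ↪o V)) (E : (Fin ℓ ↪o V) → Set (Fin ℓ → H)) :
    I.Shrinks (I.removeClasses S E) :=
  ⟨rfl, _, fun _ _ => ⟨_, fun _ hf => hf.1, rfl⟩, rfl⟩

theorem removeClasses_ne {ℓ : ℕ} {V H : Type*} [LinearOrder V] {I : CSPInst V H}
    {S : Set (Fin ℓ ↪o V)} {E : (Fin ℓ ↪o V) → Set (Fin ℓ → H)} {u : Fin ℓ ↪o V} (hu : u ∈ S)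
    {a : Fin ℓ → H} (ha : a ∈ I.proj u) (haE : a ∈ E u) : I.removeClasses S E ≠ I := by
  intro h
  rw [← h] at ha
  obtain ⟨_, ⟨C, hC, rfl⟩, f, hf, huC, haf⟩ := CSPInst.mem_proj.1 ha
  refine hf.2 u hu huC ?_
  rwa [← show a = _ from funext haf]

theorem exists_extendPartitionOutput {ℓ : ℕ} {V H : Type*} [LinearOrder V]
    [(hyperLang ℓ).Structure H] [LinearOrder H] (p : Op H 2) {I : CSPInst V H} (hI : I.vars.Finite)
    (u : Fin ℓ ↪o V) {s : ℕ} (E : Fin (s + 1) → Set (Fin ℓ → H)) :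
    ∃ τ, ExtendPartitionOutput ℓ p I u E τ := by
  suffices ∀ n (σ : PartState ℓ V H s), (incTuples ℓ I.vars \ σ.1).ncard = n →
      ∃ τ, Relation.ReflTransGen (ExtendStep ℓ p I) σ τ ∧ ∀ τ', ¬ ExtendStep ℓ p I τ τ' from
    this _ _ rfl
  intro n
  induction n using Nat.strong_induction_on with
  | _ n ih =>
    intro σ hσ
    by_cases h : ∃ τ, ExtendStep ℓ p I σ τ
    · obtain ⟨τ, hτ⟩ := h
      have hlt : (incTuples ℓ I.vars \ τ.1).ncard < n := by
        obtain ⟨v, -, w, hw, hwσ, -, -, rfl⟩ := hτ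
        rw [← hσ]
        refine Set.ncard_lt_ncard ⟨?_, fun h => ?_⟩ ((finite_incTuples ℓ hI).sdiff)
        · exact Set.sdiff_subset_sdiff_right (Set.subset_insert _ _)
        · exact (h ⟨hw, hwσ⟩).2 (Set.mem_insert _ _)
      obtain ⟨τ', h1, h2⟩ := ih _ hlt τ rfl
      exact ⟨τ', .head hτ h1, h2⟩
    · exact ⟨σ, .refl, fun τ' h' => h ⟨τ', h'⟩⟩

variable {ℓ : ℕ} {K : Set (Bundled.{u} (hyperLang ℓ).Structure)} {b : ℕ}
  {H : Type u} [Countable H] [(hyperLang ℓ).Structure H] [LinearOrder H]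
  {V : Type*} [LinearOrder V] {m : Op H 3} {p : Op H 2} {LA : FirstOrder.Language}
  [LA.Structure H] {N : ℕ} {I J L : CSPInst V H}

theorem IdentifyAllEqualOutput.spec (hK : FinitelyBoundedBy K b)
    (hlim : FirstOrder.Language.IsFraisseLimit (orderedClass K) H) (hp : Function.Injective p)
    (hT : IsTemplate ℓ V LA m p N) (hJ : J.IsInstanceOf LA) (hmin : J.Minimal (2 * ℓ) N)
    (hker : J.KernelSubdirect ℓ) (h : IdentifyAllEqualOutput J L) :
    L.IsInstanceOf LA ∧ L.Minimal (2 * ℓ) N ∧ (L.HasSolution ↔ J.HasSolution) ∧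
      L.KernelSubdirect ℓ ∧ (∀ C ∈ L.cons, C.rel.Nonempty →
        ∀ D ∈ L.cons, ∃ f ∈ D.rel, Function.Injective f) ∧ (L = J ∨ L.vars ⊂ J.vars) := by
  have hℓ := hT.three_le
  have hN := hT.le_cover
  obtain ⟨r, h1, h2, rfl⟩ := h
  have hr : IsRepresentative J r := ⟨fun x hx => (h1 x hx).1, fun x hx => (h1 x hx).2, h2⟩
  have hL := IsRepresentative.isInstanceOf_rename (r := r) hJ
  have hLmin := hr.minimal_rename (by omega) (by omega) (by omega) hmin
  refine ⟨hL, hLmin, hr.hasSolution_rename_iff (by omega : 2 ≤ N) hmin.1,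
    hr.kernelSubdirect_rename (by omega) (by omega) (by omega) hmin (by omega) (by omega) hker,
    fun C hC hne D hD => ?_, hr.rename_eq_self_or⟩
  exact exists_injective_of_not_forcedEqual (by omega) hK hlim hp (hT.tame hL)
    (by omega : 2 ≤ 2 * ℓ) hLmin (fun x hx y hy hxy => hr.eq_of_forcedEqual_rename (by omega)
      (by omega) (by omega) hmin hx hy hxy) hD (hLmin.nonempty hC hD hne)

/-- The effect of the removal of the distinguished classes in the main loop. -/
theorem removeClasses_spec [LA.IsRelational] (hK : FinitelyBoundedBy K b)
    (hlim : FirstOrder.Language.IsFraisseLimit (orderedClass K) H) (hm : IsInjectiveLinear ℓ m)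
    (hp : IsLexProjection ℓ p) (hT : IsTemplate ℓ V LA m p N) (hI : I.IsInstanceOf LA)
    (hmin : I.Minimal (2 * ℓ) N) (hker : I.KernelSubdirect ℓ)
    (hinj : ∀ C ∈ I.cons, C.rel.Nonempty → ∀ D ∈ I.cons, ∃ f ∈ D.rel, Function.Injective f)
    {u : Fin ℓ ↪o V} (hu : u ∈ incTuples ℓ I.vars) {s : ℕ} {E : Fin (s + 1) → Set (Fin ℓ → H)}
    (hE : IsAdmissiblePartition ℓ LA p I u E) {τ : PartState ℓ V H s}
    (hτ : ExtendPartitionOutput ℓ p I u E τ) (hno : ¬ (I.injFinOn ℓ τ.1).HasSolution) :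
    (I.removeClasses τ.1 fun v => τ.2 v 0).IsInstanceOf LA ∧
      ((I.removeClasses τ.1 fun v => τ.2 v 0).HasSolution ↔ I.HasSolution) ∧
      (I.removeClasses τ.1 fun v => τ.2 v 0) ≠ I := by
  have hℓ : 0 < ℓ := by have := hT.three_le; omega
  have hN : 3 * ℓ ≤ N := hT.le_cover
  have htame := hT.tame hI
  obtain ⟨a, ha⟩ := hE.nonempty 0
  have haI : a ∈ I.proj u := hE.union ▸ Set.mem_iUnion.2 ⟨0, ha⟩
  obtain ⟨C, hC, f, hf, -⟩ := CSPInst.mem_proj.1 haI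
  have hne := hinj C hC ⟨f, hf⟩
  obtain ⟨hsys, hpres⟩ := (partSystem_singleton hT hmin.1 hu hE).of_reflTransGen hℓ
    (by omega : 2 * ℓ ≤ N) hp htame hmin hne (σ := ({u}, fun _ => E)) hτ.1
  obtain ⟨huτ, hEτ⟩ := hpres u rfl
  refine ⟨hsys.isInstanceOf_removeClasses hK hlim hm hp hT hI hne
    (hmin.mono (by omega) le_rfl) hker hno, ⟨(shrinks_removeClasses _ _ _).hasSolution, ?_⟩, ?_⟩
  · exact hsys.hasSolution_removeClasses hK hlim hp htame hne hℓ (by omega) hmin.1 ⟨u, huτ⟩ hno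
  · exact removeClasses_ne huτ haI (by rw [hEτ]; exact ha)

theorem exists_injIrreducibilityOutput [LA.IsRelational] (hK : FinitelyBoundedBy K b)
    (hlim : FirstOrder.Language.IsFraisseLimit (orderedClass K) H) (hm : IsInjectiveLinear ℓ m)
    (hp : IsLexProjection ℓ p) (hT : IsTemplate ℓ V LA m p (max (3 * ℓ) b))
    (hI : I.IsInstanceOf LA) : ∃ I', InjIrreducibilityOutput ℓ LA p b I I' := by
  have hℓ := hT.three_le
  have hN := hT.le_cover
  suffices ∀ X : CSPInst V H, X.Tame ℓ m p → ∀ I : CSPInst V H, I.IsInstanceOf LA →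
      I.minimalize (2 * ℓ) (max (3 * ℓ) b) = X → ∃ I', InjIrreducibilityOutput ℓ LA p b I I' from
    this _ (hT.tame (hT.minimalize I hI)) I hI rfl
  refine CSPInst.Tame.induction hK hlim ?_
  rintro X htame ih I hI rfl
  obtain ⟨J, hJ⟩ := exists_minimalEqSubdirectOutput hK hlim hm.injective hp.injective hT hI
  obtain ⟨h1, h2, h3, -, h5⟩ := hJ.spec hK hlim hm.injective hp.injective hT hI
  obtain ⟨L, hL⟩ := exists_identifyAllEqualOutput (by omega : 2 ≤ 2 * ℓ)
    (by omega : 3 ≤ max (3 * ℓ) b) h2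
  obtain ⟨hL1, hL2, -, hL4, hL5, hL6⟩ := hL.spec hK hlim hp.injective hT h1 h2 h5
  by_cases hfin : ∀ u ∈ incTuples ℓ L.vars, ∀ (s : ℕ) (E : Fin (s + 1) → Set (Fin ℓ → H)),
      IsAdmissiblePartition ℓ LA p L u E → ∃ τ : PartState ℓ V H s,
        ExtendPartitionOutput ℓ p L u E τ ∧ (L.injFinOn ℓ τ.1).HasSolution
  · exact ⟨L, .finish hJ hL hfin⟩
  push Not at hfin
  obtain ⟨u, hu, s, E, hE, hno⟩ := hfin
  obtain ⟨τ, hτ⟩ := exists_extendPartitionOutput p hL1.1 u E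
  obtain ⟨h6, -, h7⟩ :=
    removeClasses_spec hK hlim hm hp hT hL1 hL2 hL4 hL5 hu hE hτ (hno τ hτ)
  have hsh := shrinks_removeClasses L τ.1 fun v => τ.2 v 0
  have hs := CSPInst.shrinks_minimalize (m := 2 * ℓ) (hsh.covers hL2.1)
  -- Either variables were identified, or `L = J` and the removal properly shrinks it, since the
  -- distinguished class at `u` is non-empty.
  have hbelow : ((L.removeClasses τ.1 fun v => τ.2 v 0).minimalize (2 * ℓ) (max (3 * ℓ) b)).Below
      (I.minimalize (2 * ℓ) (max (3 * ℓ) b)) := by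
    rcases hL6 with rfl | hL6
    · refine Or.inr ⟨(h3.trans hsh).trans hs, fun h => h7 ?_⟩
      rw [h] at hs
      exact (hsh.antisymm ((hT.tame hL1).finite_cons hK hlim) (hs.trans h3)).symm
    · refine Or.inl ?_
      rw [← h3.1]
      exact hL6
  obtain ⟨I', hI'⟩ := ih _ (hT.tame (hT.minimalize _ h6)) hbelow _ h6 rfl
  exact ⟨I', .next hJ hL u hu s E hE τ hτ (hno τ hτ) hI'⟩

theorem InjIrreducibilityOutput.spec [LA.IsRelational] (hK : FinitelyBoundedBy K b)
    (hlim : FirstOrder.Language.IsFraisseLimit (orderedClass K) H) (hm : IsInjectiveLinear ℓ m)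
    (hp : IsLexProjection ℓ p) (hT : IsTemplate ℓ V LA m p (max (3 * ℓ) b)) {I' : CSPInst V H}
    (h : InjIrreducibilityOutput ℓ LA p b I I') (hI : I.IsInstanceOf LA) :
    I'.IsInstanceOf LA ∧ (I'.HasSolution ↔ I.HasSolution) ∧
      (I'.Trivial ∨ I'.InjIrreducible ℓ LA p) := by
  have hℓ := hT.three_le
  have hN := hT.le_cover
  induction h with
  | @finish I J L hJ hL hfin =>
    obtain ⟨h1, h2, -, h4, h5⟩ := hJ.spec hK hlim hm.injective hp.injective hT hI
    obtain ⟨hL1, hL2, hL3, -, hL5, -⟩ := hL.spec hK hlim hp.injective hT h1 h2 h5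
    refine ⟨hL1, hL3.trans h4, or_iff_not_imp_left.2 fun htriv => ⟨hL1, htriv,
      hL2.mono (by omega) (by omega), fun S hS => ?_⟩⟩
    have hne : ∀ C ∈ L.cons, ∃ f ∈ C.rel, Function.Injective f := fun C hC =>
      hL5 C hC (Set.nonempty_iff_ne_empty.2 fun h => htriv ⟨C, hC, h⟩) C hC
    -- The first or the third alternative always holds: edges and non-edges share the distinguished
    -- class, so whether they are linked is irrelevant.
    by_cases hno : L.LinksNonDeterministic ℓ p S
    · exact Or.inr (Or.inr hno)
    · exact Or.inl (hasSolution_inj_restrict_fin hK hlim hm hp hT (hT.tame hL1) hL2 hne hfin hS hno)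
  | @next I J L I' hJ hL u hu s E hE τ hτ hno _ ih =>
    obtain ⟨h1, h2, -, h4, h5⟩ := hJ.spec hK hlim hm.injective hp.injective hT hI
    obtain ⟨hL1, hL2, hL3, hL4, hL5, -⟩ := hL.spec hK hlim hp.injective hT h1 h2 h5
    obtain ⟨h6, h7, -⟩ := removeClasses_spec hK hlim hm hp hT hL1 hL2 hL4 hL5 hu hE hτ hno
    obtain ⟨h8, h9, h10⟩ := ih h6
    exact ⟨h8, h9.trans (h7.trans (hL3.trans h4)), h10⟩

end Main

theorem mainTheorem3 {ℓ : ℕ} (hℓ : 3 ≤ ℓ)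
    (K : Set (Bundled.{u} (hyperLang ℓ).Structure)) (b : ℕ) (hK : FinitelyBoundedBy K b)
    (hamal : FirstOrder.Language.Amalgamation (orderedClass K))
    (H : Type u) [Countable H] [(hyperLang ℓ).Structure H] [LinearOrder H]
    (hlim : FirstOrder.Language.IsFraisseLimit (orderedClass K) H)
    (LA : FirstOrder.Language) [LA.IsRelational] [LA.Structure H] (hred : IsFOReduct ℓ H LA)
    (m : Op H 3) (hm : IsInjectiveLinear ℓ m) (hmpol : m.IsPolymorphism LA)
    (p : Op H 2) (hp : IsLexProjection ℓ p) (hppol : p.IsPolymorphism LA)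
    (V : Type*) [LinearOrder V]
    (horb : ∀ R : Set (Fin ℓ → H), (∀ a ∈ R, orb ℓ a ⊆ R) → m.Preserves R → p.Preserves R →
      ∃ r : LA.Relations ℓ, {x | FirstOrder.Language.Structure.RelMap r x} = R)
    (hmin : ∀ I : CSPInst V H, I.IsInstanceOf LA →
      (I.minimalize (2 * ℓ) (max (3 * ℓ) b)).IsInstanceOf LA)
    (I : CSPInst V H) (hI : I.IsInstanceOf LA) :
    (∃ I' : CSPInst V H, InjIrreducibilityOutput ℓ LA p b I I') ∧
    ∀ I' : CSPInst V H, InjIrreducibilityOutput ℓ LA p b I I' →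
      I'.IsInstanceOf LA ∧ (I'.HasSolution ↔ I.HasSolution) ∧
      (I'.Trivial ∨ I'.InjIrreducible ℓ LA p) := by
  have hT : IsTemplate ℓ V LA m p (max (3 * ℓ) b) :=
    isTemplate hℓ hred hmpol hppol horb (le_max_left _ _) hmin
  exact ⟨exists_injIrreducibilityOutput hK hlim hm hp hT hI,
    fun _ h => h.spec hK hlim hm hp hT hI⟩
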